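/- Graphs are finite undirected multigraphs (parallel edges and self-loops are allowed; a self-loop adds $2$ to the degree and is a cycle of length $1$, two parallel edges form a cycle of length $2$). The running time is the number of elementary steps (arithmetic, comparisons, access to array cells and to list heads). **Low diameter decomposition.** Call a randomized procedure $D$ an $(A,b)$-decomposition procedure if on every multigraph $G$ with $n\ge 1$ vertices and $m$ edges it runs in at most $A(n+m)$ steps, and with probability at least $1-n^{-b}$ it returns a set $R$ of at most $m/12$ edges such that every connected component of $G\setminus R$ has strong diameter at most $12A\log n$. **ImprovedShortCycle.** The input is a multigraph $G$ with $n$ vertices, $m$ edges and maximum degree $\Delta$. If $n\le 100$, run NaiveShortCycle: as long as vertices remain, remove a vertex of degree at most $2$ if there is one; otherwise run breadth first search from a remaining vertex until the first non-tree edge $e$, output the cycle formed by $e$ and tree edges, and remove its vertices. If $n>100$, then, as long as the cycles found so far contain fewer than $\frac{m}{10\Delta}$ vertices, compute $R=D(G)$ on the current graph, apply OneRoundShortCycle to each connected component of $G\setminus R$, add the cycles returned to the output, and delete their vertices from $G$. On a connected graph with $m'$ edges, OneRoundShortCycle takes a breadth first search tree, re-rooted at a leaf, and splits it (TreeSplit)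 into subtrees, from the leaves upward, cutting off a part as soon as the sum of the degrees in it reaches $4\sqrt{m'}$ (a part of the root below this threshold is merged with an adjacent part). It contracts the parts, removes the edges of their spanning trees, greedily chooses vertex-disjoint cycles of length $2$ and then of length $1$ in the contracted multigraph, and completes each of them to a cycle of the original graph through the spanning trees of the parts (PullUp). **Lemma.** Let $a>0$. 1. There is a constant $C$, depending only on $a$, for which guarantee $(*)$ holds when $D$ is the explicit procedure "ball growing" (grow clusters, one after the other, by breadth first layers among the vertices without a cluster; stop a cluster as soon as the number of edges leaving it to such vertices is at most $\frac1{24}\left(\frac mn+w\right)$, where $w$ is the number of edges between its consecutive layers; $R$ is the set of the edges between different clusters). 2. Ball growing is an $(A,a+2)$-decomposition procedure for some $A$. 3. For every $A$ there is a constant $C$, depending only on $a$ and $A$, such that $(*)$ holds for every $(A,a+2)$-decomposition procedure $D$. $(*)$ For every multigraph $G$ with $n\ge 1$ vertices, $m=10n$ edges and maximum degree $\Delta$, with probability at least $1-n^{-a}$, ImprovedShortCycle with subroutine $D$ terminates within $C\,m\sqrt n$ steps and returns pairwise vertex-disjoint cycles of $G$, each of length at most $C\log n$ (if $n\ge 2$),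 which together contain at least $\frac{m}{10\Delta}$ vertices. -/

import Mathlib

/-! ### Multigraphs, cycles, distances -/

/-- A finite undirected multigraph with vertex set `Fin n` and edge set `Fin m`, given by the array
of the endpoints of its edges.  Parallel edges and self-loops are allowed. -/
abbrev MGraph (n m : ℕ) : Type := Fin m → Fin n × Fin n

/-- The edge `e` joins `u` and `v`. -/
def MGraph.Joins {n m : ℕ} (G : MGraph n m) (e : Fin m) (u v : Fin n) : Prop :=
  G e = (u, v) ∨ G e = (v, u)

/-- The degree of a vertex; a self-loop adds `2` to the degree of its vertex. -/
def MGraph.degree {n m : ℕ} (G : MGraph n m) (v : Fin n) : ℕ :=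
  ∑ e : Fin m, ((if (G e).1 = v then 1 else 0) + (if (G e).2 = v then 1 else 0))

/-- The maximum degree `Δ(G)`. -/
def MGraph.maxDegree {n m : ℕ} (G : MGraph n m) : ℕ :=
  Finset.univ.sup G.degree

/-- A closed sequence `(v₁, e₁), …, (v_k, e_k)`, where `e_i` leads from `v_i` to `v_{i+1}` and
`e_k` leads from `v_k` back to `v₁`. -/
abbrev Cyc (n m : ℕ) : Type := List (Fin n × Fin m)

/-- The vertices on a cycle. -/
def Cyc.verts {n m : ℕ} (c : Cyc n m) : Finset (Fin n) := (c.map Prod.fst).toFinset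

/-- `c` is a cycle of `G`: nonempty, without repeated vertices or edges.  Its length is
`c.length`; a self-loop is a cycle of length `1`, two parallel edges form a cycle of length `2`. -/
def MGraph.IsCycle {n m : ℕ} (G : MGraph n m) (c : Cyc n m) : Prop :=
  c ≠ [] ∧ (c.map Prod.fst).Nodup ∧ (c.map Prod.snd).Nodup ∧
    List.Forall₂ (fun x y => G.Joins x.2 x.1 y.1) c (c.rotate 1)

/-- The simple graph underlying `G \ R`, where `R` is the set of edges marked `true`.  It has the
same connected components and the same distances as the multigraph `G \ R`. -/
def MGraph.simpleMinus {n m : ℕ} (G : MGraph n m) (R : Fin m → Bool) : SimpleGraph (Fin n) :=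
  SimpleGraph.fromRel (fun u v => ∃ e, R e = false ∧ G.Joins e u v)

/-! ### Step counting

An algorithm is a program in the monad `Timed`, which carries the number of elementary steps.  One
step pays for a bounded number of elementary operations of a random access machine: arithmetic and
comparison of numbers, access to a cell of an array, and access to the head of a list.  Arrays are
functions on their index set, a write being `Function.update`.  Steps are charged by `tick`, by
`Timed.fold` (one step per element of the list, in addition to the steps of the loop body) and by
`Timed.tabulate` (one step per cell). -/

/-- A value together with the number of steps used to compute it. -/
structure Timed (α : Type) : Type where
  val : α
  time : ℕ

instance : Monad Timed where
  pure a := ⟨a, 0⟩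
  bind x f :=
    let y := f x.val
    ⟨y.val, x.time + y.time⟩

/-- Spend `k` steps. -/
def tick (k : ℕ) : Timed Unit := ⟨(), k⟩

/-- Create an array with `k` cells whose entries are given by the constant-time expression `f`.  An
array on the vertices of a subgraph has one cell for each of these vertices. -/
def Timed.tabulate {α : Type} (k : ℕ) (f : α) : Timed α := ⟨f, k⟩

/-- The loop `for a in l do b ← f b a`. -/
def Timed.fold {α β : Type} (f : β → α → Timed β) : β → List α → Timed β
  | b, [] => pure b
  | b, a :: l => do
    tick 1
    let b' ← f b a
    Timed.fold f b' l

/-- The sublist of the elements that pass a constant-time test. -/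
def Timed.filter {α : Type} (p : α → Bool) (l : List α) : Timed (List α) := do
  let r ← Timed.fold (fun acc a => pure (if p a then a :: acc else acc)) [] l
  tick l.length
  return r.reverse

/-! ### Elementary graph routines

A subgraph of `G` is passed as the list `vs` of its vertices and the list `es` of its edges. -/

section Algorithms

variable {n m : ℕ}

/-- Adjacency lists: `w` is listed with the edge `e` at `u` for every `e = uw`; a self-loop at `u`
is listed twice at `u`. -/
def buildAdj (G : MGraph n m) (vs : List (Fin n)) (es : List (Fin m)) :
    Timed (Fin n → List (Fin m × Fin n)) := do
  let adj ← Timed.tabulate vs.length (fun _ => [])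
  Timed.fold (fun adj e =>
    let u := (G e).1
    let v := (G e).2
    let adj := Function.update adj u ((e, v) :: adj u)
    pure (Function.update adj v ((e, u) :: adj v))) adj es

/-- The array of degrees in the subgraph `(vs, es)`. -/
def degrees (G : MGraph n m) (vs : List (Fin n)) (es : List (Fin m)) : Timed (Fin n → ℕ) := do
  let d ← Timed.tabulate vs.length (fun _ => 0)
  Timed.fold (fun d e =>
    let u := (G e).1
    let v := (G e).2
    let d := Function.update d u (d u + 1)
    pure (Function.update d v (d v + 1))) d es

/-- Rooted forests: the vertices reached so far, the parent of a vertex with the edge to it, and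
the depth of a vertex. -/
structure Forest (n m : ℕ) : Type where
  seen : Fin n → Bool
  par : Fin n → Option (Fin n × Fin m)
  dep : Fin n → ℕ

/-- The forest in which no vertex is reached yet. -/
def Forest.empty : Forest n m := ⟨fun _ => false, fun _ => none, fun _ => 0⟩

/-- Make `r` a root. -/
def Forest.addRoot (T : Forest n m) (r : Fin n) : Forest n m :=
  ⟨Function.update T.seen r true, Function.update T.par r none, Function.update T.dep r 0⟩

/-- Make `w` a child of `u` through the edge `e`. -/
def Forest.addChild (T : Forest n m) (u : Fin n) (e : Fin m) (w : Fin n) : Forest n m :=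
  ⟨Function.update T.seen w true, Function.update T.par w (some (u, e)),
    Function.update T.dep w (T.dep u + 1)⟩

/-- Breadth first search, layer by layer.  `order` lists the reached vertices, the latest first.
The number `fuel` bounds the number of layers. -/
def bfsLoop (adj : Fin n → List (Fin m × Fin n)) :
    ℕ → Forest n m → List (Fin n) → List (Fin n) → Timed (Forest n m × List (Fin n))
  | 0, T, _, order => pure (T, order)
  | _ + 1, T, [], order => do
    tick 1
    return (T, order)
  | fuel + 1, T, u :: us, order => do
    tick 1
    let s ← Timed.fold (fun s u =>
      Timed.fold (fun (s : Forest n m × List (Fin n) × List (Fin n)) (ew : Fin m × Fin n) =>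
        pure (if s.1.seen ew.2 then s
          else (s.1.addChild u ew.1 ew.2, ew.2 :: s.2.1, ew.2 :: s.2.2))) s (adj u))
      (T, [], order) (u :: us)
    bfsLoop adj fuel s.1 s.2.1 s.2.2

/-- Breadth first search from `r` among the vertices that `T` has not reached yet.  Returns the
extended forest and the list of the newly reached vertices, the latest first. -/
def bfs (adj : Fin n → List (Fin m × Fin n)) (fuel : ℕ) (T : Forest n m) (r : Fin n) :
    Timed (Forest n m × List (Fin n)) :=
  bfsLoop adj fuel (T.addRoot r) [r] [r]

/-- Put in front of `acc` the path of the forest `T` that leads from `a` to `b`. -/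
def treePath (T : Forest n m) : ℕ → Fin n → Fin n → Cyc n m → Timed (Cyc n m)
  | 0, _, _, acc => pure acc
  | fuel + 1, a, b, acc => do
    tick 1
    if a = b then pure acc
    else if T.dep b ≤ T.dep a then
      match T.par a with
      | none => pure acc
      | some (p, e) => do
        let r ← treePath T fuel p b acc
        return (a, e) :: r
    else
      match T.par b with
      | none => pure acc
      | some (p, e) => treePath T fuel a p ((p, e) :: acc)

/-- The connected components of the graph with all vertices of `G` and the edges `es`, each as its
list of vertices and its list of edges. -/
def components (G : MGraph n m) (es : List (Fin m)) :
    Timed (List (List (Fin n) × List (Fin m))) := do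
  let adj ← buildAdj G (List.finRange n) es
  let T ← Timed.tabulate n (Forest.empty : Forest n m)
  let root ← Timed.tabulate n (fun v : Fin n => v)
  let s ← Timed.fold
    (fun (s : Forest n m × (Fin n → Fin n) × List (Fin n × List (Fin n))) v =>
      if s.1.seen v then pure s
      else do
        let t ← bfs adj n s.1 v
        let root ← Timed.fold (fun root w => pure (Function.update root w v)) s.2.1 t.2
        return (t.1, root, (v, t.2) :: s.2.2))
    (T, root, []) (List.finRange n)
  let bucket ← Timed.tabulate n (fun _ : Fin n => ([] : List (Fin m)))
  let bucket ← Timed.fold (fun bucket e =>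
    let r := s.2.1 (G e).1
    pure (Function.update bucket r (e :: bucket r))) bucket es
  Timed.fold (fun acc c => pure ((c.2, bucket c.1) :: acc)) [] s.2.2

/-- Delete from `(vs, es)` the vertices in `del`, with the edges incident to them. -/
def deleteVerts (G : MGraph n m) (del vs : List (Fin n)) (es : List (Fin m)) :
    Timed (List (Fin n) × List (Fin m)) := do
  let mark ← Timed.tabulate n (fun _ : Fin n => false)
  let mark ← Timed.fold (fun mark v => pure (Function.update mark v true)) mark del
  let vs' ← Timed.filter (fun v => !mark v) vs
  let es' ← Timed.filter (fun e => !mark (G e).1 && !mark (G e).2) es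
  return (vs', es')

/-! ### NaiveShortCycle -/

/-- Scan the adjacency list of `u` in a breadth first search; stop at the first non-tree edge. The
state is the search tree with the next layer. -/
def scanForCycle (u : Fin n) :
    List (Fin m × Fin n) → Forest n m × List (Fin n) →
      Timed ((Forest n m × List (Fin n)) × Option (Fin n × Fin m × Fin n))
  | [], s => pure (s, none)
  | (e, w) :: l, s => do
    tick 1
    if (s.1.par u).map Prod.snd = some e then scanForCycle u l s
    else if s.1.seen w then pure (s, some (u, e, w))
    else scanForCycle u l (s.1.addChild u e w, w :: s.2)

/-- Scan a layer of a breadth first search; stop at the first non-tree edge. -/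
def scanLayerForCycle (adj : Fin n → List (Fin m × Fin n)) :
    List (Fin n) → Forest n m × List (Fin n) →
      Timed ((Forest n m × List (Fin n)) × Option (Fin n × Fin m × Fin n))
  | [], s => pure (s, none)
  | u :: us, s => do
    tick 1
    let r ← scanForCycle u (adj u) s
    match r.2 with
    | some _ => pure r
    | none => scanLayerForCycle adj us r.1

/-- Breadth first search until the first non-tree edge `e = uw`; returns the cycle formed by `e`
and tree edges. -/
def findCycle (adj : Fin n → List (Fin m × Fin n)) :
    ℕ → Forest n m → List (Fin n) → Timed (Option (Cyc n m))
  | 0, _, _ => pure none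
  | _ + 1, _, [] => pure none
  | fuel + 1, T, v :: vs => do
    tick 1
    let r ← scanLayerForCycle adj (v :: vs) (T, [])
    match r.2 with
    | some (u, e, w) => do
      let c ← treePath r.1.1 (n + 1) w u [(u, e)]
      return some c
    | none => findCycle adj fuel r.1.1 r.1.2

/-- The loop of `naiveShortCycle`: as long as there are vertices, remove a vertex of degree at most
`2` if there is one, and otherwise find a cycle by breadth first search and remove its vertices.
Every round removes a vertex, so that `n` rounds suffice. -/
def naiveLoop (G : MGraph n m) :
    ℕ → List (Fin n) → List (Fin m) → List (Cyc n m) → Timed (List (Cyc n m))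
  | 0, _, _, C => pure C
  | _ + 1, [], _, C => pure C
  | fuel + 1, r :: vs, es, C => do
    tick 1
    let d ← degrees G (r :: vs) es
    let low ← Timed.filter (fun v => decide (d v ≤ 2)) (r :: vs)
    match low with
    | u :: _ => do
      let s ← deleteVerts G [u] (r :: vs) es
      naiveLoop G fuel s.1 s.2 C
    | [] => do
      let adj ← buildAdj G (r :: vs) es
      let T ← Timed.tabulate n (Forest.empty.addRoot r : Forest n m)
      let c ← findCycle adj n T [r]
      match c with
      | none => pure C
      | some c => do
        tick c.length
        let s ← deleteVerts G (c.map Prod.fst) (r :: vs) es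
        naiveLoop G fuel s.1 s.2 (c :: C)

/-- NaiveShortCycle. -/
def naiveShortCycle (G : MGraph n m) : Timed (List (Cyc n m)) :=
  naiveLoop G n (List.finRange n) (List.finRange m) []

/-! ### TreeSplit, PullUp and OneRoundShortCycle -/

/-- TreeSplit for the tree `T`, whose vertices are listed in `rev` with children before parents,
vertex labels `c` and threshold `t = √tsq`.

Upward pass: `extra v` collects the labels below `v`; if it reaches `t`, the edge from `v` to its
parent is cut.  Downward pass: the parts are numbered; if the part of the root is below the
threshold, it is reconnected to the first part that is met.  Returns the number of the part of
every vertex, the array telling which vertices are the top vertex of their part, and the number of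
parts. -/
def treeSplit (tsq : ℕ) (T : Forest n m) (rev : List (Fin n)) (c : Fin n → ℕ) :
    Timed ((Fin n → ℕ) × (Fin n → Bool) × ℕ) := do
  let extra ← Timed.tabulate rev.length c
  let cut ← Timed.tabulate rev.length (fun _ : Fin n => false)
  let s ← Timed.fold (fun (s : (Fin n → ℕ) × (Fin n → Bool)) v =>
    let x := s.1 v
    if tsq ≤ x * x then pure (s.1, Function.update s.2 v true)
    else
      match T.par v with
      | none => pure s
      | some (p, _) => pure (Function.update s.1 p (s.1 p + x), s.2)) (extra, cut) rev
  tick rev.length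
  let label ← Timed.tabulate rev.length (fun _ : Fin n => 0)
  let top ← Timed.tabulate rev.length (fun _ : Fin n => false)
  let q ← Timed.fold (fun (q : ((Fin n → ℕ) × (Fin n → Bool) × ℕ) × Bool) v =>
    let (label, top, k) := q.1
    match T.par v with
    | none => pure ((Function.update label v k, Function.update top v true, k + 1), !s.2 v)
    | some (p, _) =>
      if s.2 v && !q.2 then
        pure ((Function.update label v k, Function.update top v true, k + 1), q.2)
      else
        pure ((Function.update label v (label p), top, k), q.2 && !s.2 v))
    ((label, top, 0), false) rev.reverse
  return q.1

/-- An edge `e` of the contracted graph as an oriented edge `(a, e, b)` of the base graph. -/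
abbrev Dart (n m : ℕ) : Type := Fin n × Fin m × Fin n

/-- Pull back the rest `(a₁, e₁, b₂), (a₂, e₂, b₃), …` of a cycle of the contracted graph that
enters the current part at `b`: join `b` to `a₁` inside the part, then follow `e₁`, and so on. -/
def pullUpCycle (T : Forest n m) (fuel : ℕ) : Fin n → List (Dart n m) → Timed (Cyc n m)
  | _, [] => pure []
  | b, d :: ds => do
    tick 1
    let rest ← pullUpCycle T fuel d.2.2 ds
    treePath T fuel b d.1 ((d.1, d.2.1) :: rest)

/-- PullUp.  The spanning trees of the parts are the subtrees of `T` on the parts. -/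
def pullUp (T : Forest n m) (fuel : ℕ) (C : List (List (Dart n m))) : Timed (List (Cyc n m)) :=
  Timed.fold (fun acc c => do
    tick c.length
    match c.getLast? with
    | none => pure acc
    | some d => do
      let c' ← pullUpCycle T fuel d.2.2 c
      return c' :: acc) [] C

/-- OneRoundShortCycle on the connected graph with vertices `vs` and edges `es`. -/
def oneRoundShortCycle (G : MGraph n m) (vs : List (Fin n)) (es : List (Fin m)) :
    Timed (List (Cyc n m)) :=
  match vs with
  | [] => pure []
  | r :: _ => do
    -- a spanning tree, found by breadth first search, and then rooted at a leaf
    let adj ← buildAdj G vs es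
    let T₀ ← Timed.tabulate vs.length (Forest.empty : Forest n m)
    let s ← bfs adj vs.length T₀ r
    let treeEdges ← Timed.fold (fun acc v =>
      match s.1.par v with
      | none => pure acc
      | some (_, e) => pure (e :: acc)) [] s.2
    let leaf := s.2.headD r
    let treeAdj ← buildAdj G vs treeEdges
    let T₁ ← Timed.tabulate vs.length (Forest.empty : Forest n m)
    let t ← bfs treeAdj vs.length T₁ leaf
    let T := t.1
    -- split it with the degrees as labels and with threshold `4 √|es|`
    let c ← degrees G vs es
    tick es.length
    let p ← treeSplit (16 * es.length) T t.2 c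
    let label := p.1
    let top := p.2.1
    let k := p.2.2
    -- contract the parts, and leave out the edges of the spanning trees of the parts;
    -- `H i j` with `i ≤ j` lists the edges between the parts `i` and `j`, oriented from `i` to `j`
    let H ← Timed.tabulate (k * k) (fun _ _ : ℕ => ([] : List (Dart n m)))
    let isTreeEdge : Fin n → Fin m → Bool := fun v e =>
      !top v && decide ((T.par v).map Prod.snd = some e)
    let H ← Timed.fold (fun (H : ℕ → ℕ → List (Dart n m)) e =>
      let u := (G e).1
      let v := (G e).2
      if isTreeEdge u e || isTreeEdge v e then pure H
      else
        let i := label u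
        let j := label v
        if i ≤ j then
          pure (Function.update H i (Function.update (H i) j ((u, e, v) :: H i j)))
        else
          pure (Function.update H j (Function.update (H j) i ((v, e, u) :: H j i)))) H es
    -- greedily choose cycles of length 2, and then cycles of length 1
    let used ← Timed.tabulate k (fun _ : ℕ => false)
    tick k
    let q ← Timed.fold (fun q i => do
      tick k
      Timed.fold (fun (q : (ℕ → Bool) × List (List (Dart n m))) j =>
        if i < j && !q.1 i && !q.1 j then
          match H i j with
          | d₁ :: d₂ :: _ =>
            pure (Function.update (Function.update q.1 i true) j true,
              [d₁, (d₂.2.2, d₂.2.1, d₂.1)] :: q.2)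
          | _ => pure q
        else pure q) q (List.range k)) (used, []) (List.range k)
    let q ← Timed.fold (fun (q : (ℕ → Bool) × List (List (Dart n m))) i =>
      if q.1 i then pure q
      else
        match H i i with
        | d :: _ => pure (Function.update q.1 i true, [d] :: q.2)
        | [] => pure q) q (List.range k)
    pullUp T (vs.length + 1) q.2

/-! ### ImprovedShortCycle -/

/-- The data of the main loop: the edges of the current graph, the cycles found so far, and the
number of their vertices.  Deleted vertices stay as isolated vertices. -/
structure LoopState (n m : ℕ) : Type where
  edges : List (Fin m)
  cycles : List (Cyc n m)
  covered : ℕ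

/-- The current graph of the main loop, with its edges renumbered. -/
def LoopState.graph (G : MGraph n m) (s : LoopState n m) : MGraph n s.edges.length :=
  fun i => G (s.edges.get i)

/-- The part of a round of the main loop that follows the low diameter decomposition `R`. -/
def roundAfterDecomp (G : MGraph n m) (s : LoopState n m) (R : Fin s.edges.length → Bool) :
    Timed (LoopState n m) := do
  let kept ← Timed.filter (fun i => !R i) (List.finRange s.edges.length)
  tick kept.length
  let comps ← components G (kept.map s.edges.get)
  let new ← Timed.fold (fun (acc : List (Cyc n m)) comp => do
    let C ← oneRoundShortCycle G comp.1 comp.2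
    tick C.length
    return C ++ acc) [] comps
  let verts ← Timed.fold (fun (acc : List (Fin n)) c => do
    tick c.length
    return c.map Prod.fst ++ acc) [] new
  let t ← deleteVerts G verts [] s.edges
  tick (new.length + verts.length)
  return ⟨t.2, new ++ s.cycles, s.covered + verts.length⟩

end Algorithms

/-- A randomized procedure that takes a multigraph and returns a set `R` of edges (as a Boolean
array), with its number of steps. -/
abbrev DecompProc : Type := ∀ n m : ℕ, MGraph n m → PMF (Timed (Fin m → Bool))

/-- The main loop.  `fuel` bounds the number of rounds that are simulated; the result is `none` if
the loop has not ended by then, and a result `some _` does not change with more fuel. -/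
noncomputable def mainLoop (D : DecompProc) {n m : ℕ} (G : MGraph n m) (Δ : ℕ) :
    ℕ → LoopState n m → PMF (Timed (Option (List (Cyc n m))))
  | 0, _ => PMF.pure ⟨none, 0⟩
  | fuel + 1, s =>
    if m ≤ 10 * Δ * s.covered then PMF.pure ⟨some s.cycles, 1⟩
    else
      (D n s.edges.length (s.graph G)).bind fun R =>
        let t := roundAfterDecomp G s R.val
        (mainLoop D G Δ fuel t.val).map fun out =>
          ⟨out.val, 1 + s.edges.length + R.time + t.time + out.time⟩

/-- ImprovedShortCycle, with the subroutine `D` for low diameter decompositions with `β = 1/12`. -/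
noncomputable def improvedShortCycle (D : DecompProc) (fuel : ℕ) {n m : ℕ} (G : MGraph n m) :
    PMF (Timed (Option (List (Cyc n m)))) :=
  if n ≤ 100 then
    PMF.pure ⟨some (naiveShortCycle G).val, 1 + (naiveShortCycle G).time⟩
  else
    let Δ : Timed ℕ := do
      let d ← degrees G (List.finRange n) (List.finRange m)
      Timed.fold (fun x v => pure (max x (d v))) 0 (List.finRange n)
    (mainLoop D G Δ.val fuel ⟨List.finRange m, [], 0⟩).map fun out =>
      ⟨out.val, 1 + m + Δ.time + out.time⟩

/-! ### Low diameter decomposition -/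

/-- `D` is a low diameter decomposition procedure with parameter `β` and exponent `b`: on every
multigraph with `n ≥ 1` vertices and `m` edges it takes at most `A (n + m)` steps, and with
probability at least `1 - n⁻ᵇ` it returns a set `R` of at most `β m` edges such that all connected
components of `G \ R` have (strong) diameter at most `A β⁻¹ log n`. -/
def IsLowDiamDecomp (β b A : ℝ) (D : DecompProc) : Prop :=
  ∀ (n m : ℕ) (G : MGraph n m), 1 ≤ n →
    (∀ x ∈ (D n m G).support, (x.time : ℝ) ≤ A * (n + m)) ∧
    ENNReal.ofReal (1 - (n : ℝ) ^ (-b)) ≤ (D n m G).toOuterMeasure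
      {x | ((Finset.univ.filter fun e => x.val e = true).card : ℝ) ≤ β * m ∧
        ∀ u v : Fin n, (G.simpleMinus x.val).Reachable u v →
          ((G.simpleMinus x.val).dist u v : ℝ) ≤ A * β⁻¹ * Real.log n}

/-- Let the cluster with center `v` grow layer by layer among the vertices that have no cluster
yet.  `w` is the number of edges between consecutive layers so far and `cut` the number of edges
that leave the cluster; it stops growing as soon as `cut ≤ (1 / (2k)) (m / n + w)`. -/
def growCluster {n m : ℕ} (k : ℕ) (adj : Fin n → List (Fin m × Fin n)) (v : Fin n) :
    ℕ → List (Fin n) → ℕ → (Fin n → Option (Fin n)) → Timed (Fin n → Option (Fin n))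
  | 0, _, _, cl => pure cl
  | fuel + 1, layer, w, cl => do
    tick 1
    let cut ← Timed.fold (fun x u =>
      Timed.fold (fun x (ew : Fin m × Fin n) =>
        pure (if cl ew.2 = none then x + 1 else x)) x (adj u)) 0 layer
    if 2 * k * n * cut ≤ m + n * w then pure cl
    else do
      let s ← Timed.fold (fun s u =>
        Timed.fold (fun (s : (Fin n → Option (Fin n)) × List (Fin n)) (ew : Fin m × Fin n) =>
          pure (if s.1 ew.2 = none then (Function.update s.1 ew.2 (some v), ew.2 :: s.2)
            else s)) s (adj u)) (cl, []) layer
      growCluster k adj v fuel s.2 (w + cut) s.1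

/-- Low diameter decomposition with `β = 1/k` by growing clusters: `R` consists of the edges
between different clusters. -/
def ballGrowing {n m : ℕ} (k : ℕ) (G : MGraph n m) : Timed (Fin m → Bool) := do
  let adj ← buildAdj G (List.finRange n) (List.finRange m)
  let cl ← Timed.tabulate n (fun _ : Fin n => (none : Option (Fin n)))
  let cl ← Timed.fold (fun cl v =>
    if cl v = none then growCluster k adj v n [v] 0 (Function.update cl v (some v))
    else pure cl) cl (List.finRange n)
  Timed.tabulate m (fun e => decide (cl (G e).1 ≠ cl (G e).2))

/-- An explicit low diameter decomposition procedure with `β = 1/12`. -/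
noncomputable def ballGrowingProc : DecompProc := fun _ _ G => PMF.pure (ballGrowing 12 G)

/-! ### The guarantee -/

/-- The guarantee of ImprovedShortCycle with the subroutine `D`: on every multigraph with `n ≥ 1`
vertices and `m = 10 n` edges, with probability at least `1 - n⁻ᵃ`, the algorithm ends within
`C m √n` steps and returns pairwise vertex-disjoint cycles of length at most `C log n` (for
`n ≥ 2`), which contain at least `m / (10 Δ)` vertices in total. -/
def ShortCycleGuarantee (a C : ℝ) (D : DecompProc) : Prop :=
  ∀ (n m : ℕ) (G : MGraph n m), 1 ≤ n → m = 10 * n →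
    ∃ fuel : ℕ, ENNReal.ofReal (1 - (n : ℝ) ^ (-a)) ≤
      (improvedShortCycle D fuel G).toOuterMeasure
        {out | (out.time : ℝ) ≤ C * m * Real.sqrt n ∧
          ∃ cycles : List (Cyc n m), out.val = some cycles ∧
            (∀ c ∈ cycles, G.IsCycle c ∧ (2 ≤ n → (c.length : ℝ) ≤ C * Real.log n)) ∧
            cycles.Pairwise (fun c d => Disjoint c.verts d.verts) ∧
            (m : ℝ) / (10 * G.maxDegree) ≤
              (((Finset.univ.filter fun v => ∃ c ∈ cycles, v ∈ c.verts).card : ℕ) : ℝ)}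

/-! A round of the main loop takes linear time apart from the decomposition, which is linear as
well. So it suffices that every good round covers about `n / (Δ √n)` new vertices: then `O(√n)`
rounds reach `m / (10 Δ)` vertices, at total cost `O(m √n)`.

Consider a connected graph with `n'` vertices, `m'` edges and distances at most `B`. If its spanning
tree is split into `k ≥ 2` parts, each part has degree sum at least `4 √m'`. All degrees add up to
`2 m'`, hence `4 k² ≤ m'` (`IsSplit.four_mul_sq_le`). On the other hand a vertex collects less than
the threshold from each uncut child, and a part contains at most two vertices at which collecting
ended. So its degree sum is at most `2 (Δ + t Δ)`, where `t` bounds the integers below the threshold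
(`treeSplit_spec`). After the greedy choice every edge is a tree edge of a part, or joins two unused
parts, or touches a used part. There are at most `n'` edges of the first kind. By maximality there
are at most `k² - k ≤ m' / 4` of the second kind. Since a chosen cycle uses at most two parts, `N`
cycles account for at most `4 N (Δ + t Δ)` of the third kind. This gives `3 m' ≤ 4 n' + 16 N (Δ + t
Δ)` (`oneRoundShortCycle_spec`). Tree paths inside the parts complete the chosen cycles to disjoint
cycles of length at most `8 B + 2` (`pullUpCycle_spec`).

As long as the main loop runs, the covered vertices have cost fewer than `n` of the `10 n` edges,
and `R` takes at most a twelfth of the rest. Summing over the components, a good round covers at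
least `n / ((1 + t) Δ)` vertices with `t = ⌊√(160 n)⌋`, so `1 + t` good rounds suffice
(`mainLoop_spec`). Each round fails with probability at most `n ^ (-(a + 2))`, and `1 + t ≤ n²`.

For `n ≤ 100` there are finitely many inputs, so only correctness matters. Vertices of degree at
most `2` take away at most `2 n` of the `10 n` edges, and the cycles must account for the others
(`naiveLoop_spec`).

Ball growing is region growing. While a cluster grows, its volume `m / n + w` gains a factor `25 /
24` per layer and stays below `(n + 1) m / n`, so the radius is logarithmic (`GrowInv.step`). When
it stops, its cut is at most `1 / 24` of its volume. All volumes together are at most `2 m`, so at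
most `m / 12` edges are cut (`GrowInv.clusterInv`). -/

/-! ### The cost monad -/

namespace Timed

variable {α β : Type}

@[simp] theorem pure_val (a : α) : (pure a : Timed α).val = a := rfl
@[simp] theorem pure_time (a : α) : (pure a : Timed α).time = 0 := rfl
@[simp] theorem bind_val (x : Timed α) (f : α → Timed β) : (x >>= f).val = (f x.val).val := rfl
@[simp] theorem bind_time (x : Timed α) (f : α → Timed β) :
    (x >>= f).time = x.time + (f x.val).time := rfl
@[simp] theorem tick_time (k : ℕ) : (tick k).time = k := rfl
@[simp] theorem tabulate_val (k : ℕ) (f : α) : (Timed.tabulate k f).val = f := rfl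
@[simp] theorem tabulate_time (k : ℕ) (f : α) : (Timed.tabulate k f).time = k := rfl

@[simp] theorem fold_val (f : β → α → Timed β) (b : β) (l : List α) :
    (Timed.fold f b l).val = l.foldl (fun b a => (f b a).val) b := by
  induction l generalizing b with
  | nil => rfl
  | cons a l ih => simp [Timed.fold, ih]

/-- The invariant rule for loops: `P done state time` relates the elements processed so far, the
current state and the time spent. -/
theorem fold_induction {f : β → α → Timed β} (P : List α → β → ℕ → Prop) {b : β} {l : List α}
    (h0 : P [] b 0)
    (hstep : ∀ d a r s t, l = d ++ a :: r → P d s t →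
      P (d ++ [a]) (f s a).val (t + 1 + (f s a).time)) :
    P l (Timed.fold f b l).val (Timed.fold f b l).time := by
  have key : ∀ (r d : List α) (s : β) (t : ℕ), l = d ++ r → P d s t →
      P l (Timed.fold f s r).val (t + (Timed.fold f s r).time) := by
    intro r
    induction r with
    | nil => intro d s t hl hP; simp at hl; subst hl; simpa [Timed.fold] using hP
    | cons a r ih =>
      intro d s t hl hP
      have := ih (d ++ [a]) (f s a).val (t + 1 + (f s a).time) (by simp [hl])
        (hstep d a r s t hl hP)
      simpa [Timed.fold, add_assoc] using this
  simpa using key l [] b 0 rfl h0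

/-- If the cost `g` of the body does not depend on the state, the time of a loop can be computed
without an invariant. -/
theorem fold_time_eq {f : β → α → Timed β} {g : α → ℕ} (h : ∀ s a, (f s a).time = g a) (b : β)
    (l : List α) : (Timed.fold f b l).time = (l.map fun a => 1 + g a).sum := by
  induction l generalizing b with
  | nil => simp [Timed.fold]
  | cons a l ih =>
    have h1 := h b a
    have h2 := ih (f b a).val
    simp only [Timed.fold, bind_time, tick_time, List.map_cons, List.sum_cons]
    omega

@[simp] theorem fold_pure_time (f : β → α → β) (b : β) (l : List α) :
    (Timed.fold (fun s a => (pure (f s a) : Timed β)) b l).time = l.length := by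
  rw [fold_time_eq (g := fun _ => 0) (by simp)]
  simp

@[simp] theorem filter_val (p : α → Bool) (l : List α) : (Timed.filter p l).val = l.filter p := by
  have : ∀ acc : List α, l.foldl (fun acc a => if p a then a :: acc else acc) acc
      = (l.filter p).reverse ++ acc := by
    induction l with
    | nil => simp
    | cons a l ih => intro acc; by_cases h : p a <;> simp [h, ih]
  simp [Timed.filter, this]

@[simp] theorem filter_time (p : α → Bool) (l : List α) :
    (Timed.filter p l).time = 2 * l.length := by
  simp [Timed.filter, two_mul]

end Timed

/-! ### Lists -/

/-- Turns a nested loop over vertices and their adjacency lists into one loop over pairs, so that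
breadth first search and ball growing need a single invariant per layer. -/
theorem List.foldl_foldl_flatMap {α β γ : Type} (f : γ → α → β → γ) (g : α → List β) (l : List α)
    (s : γ) : l.foldl (fun s a => (g a).foldl (fun s b => f s a b) s) s
      = (l.flatMap fun a => (g a).map (Prod.mk a)).foldl (fun s x => f s x.1 x.2) s := by
  induction l generalizing s with
  | nil => rfl
  | cons a l ih => simp [List.foldl_append, List.foldl_map, ih]

/-- The invariant rule for `List.foldl`. -/
theorem List.foldl_induction {α β : Type} {f : β → α → β} (P : List α → β → Prop) {b : β}
    {l : List α} (h0 : P [] b)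
    (hstep : ∀ d a r s, l = d ++ a :: r → P d s → P (d ++ [a]) (f s a)) :
    P l (l.foldl f b) := by
  have key : ∀ (r d : List α) (s : β), l = d ++ r → P d s → P l (r.foldl f s) := by
    intro r
    induction r with
    | nil => intro d s hl hP; simp at hl; subst hl; simpa using hP
    | cons a r ih =>
      intro d s hl hP
      exact ih (d ++ [a]) (f s a) (by simp [hl]) (hstep d a r s hl hP)
  exact key l [] b rfl h0

theorem List.sum_map_le_sum_univ {n : ℕ} {l : List (Fin n)} (f : Fin n → ℕ) (hl : l.Nodup) :
    (l.map f).sum ≤ ∑ v, f v := by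
  rw [← List.sum_toFinset _ hl]
  exact Finset.sum_le_sum_of_subset (Finset.subset_univ _)

theorem Finset.sum_list_sum_comm {ι α : Type} (s : Finset ι) (l : List α) (f : ι → α → ℕ) :
    ∑ i ∈ s, (l.map (f i)).sum = (l.map fun a => ∑ i ∈ s, f i a).sum := by
  induction l with
  | nil => simp
  | cons a l ih => simp [Finset.sum_add_distrib, ih]

/-! ### Adjacency lists and degrees -/

section Graph

variable {n m : ℕ}

theorem MGraph.Joins.symm {G : MGraph n m} {e : Fin m} {u v : Fin n} (h : G.Joins e u v) :
    G.Joins e v u := Or.symm h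

theorem MGraph.joins_self (G : MGraph n m) (e : Fin m) : G.Joins e (G e).1 (G e).2 := Or.inl rfl

theorem MGraph.Joins.cases_eq {G : MGraph n m} {e : Fin m} {u v x y : Fin n} (h : G.Joins e u v)
    (h' : G.Joins e x y) : (u = x ∧ v = y) ∨ (u = y ∧ v = x) := by
  rcases h with h | h <;> rcases h' with h' | h' <;> rw [h] at h' <;> simp at h' <;> tauto

/-- The adjacency list of `u` as it is produced by `buildAdj`. -/
def adjList (G : MGraph n m) (es : List (Fin m)) (u : Fin n) : List (Fin m × Fin n) :=
  es.reverse.flatMap fun e =>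
    (if (G e).2 = u then [(e, (G e).1)] else []) ++ (if (G e).1 = u then [(e, (G e).2)] else [])

/-- The degree of `u` in the subgraph with edges `es`. -/
def degIn (G : MGraph n m) (es : List (Fin m)) (u : Fin n) : ℕ :=
  (es.map fun e => (if (G e).1 = u then 1 else 0) + (if (G e).2 = u then 1 else 0)).sum

-- Entries are put in front of the lists built so far, so later edges come first, and the entry
-- written second for an edge precedes the other one. The reversal in `adjList` reflects this.
@[simp] theorem buildAdj_val (G : MGraph n m) (vs : List (Fin n)) (es : List (Fin m)) :
    (buildAdj G vs es).val = adjList G es := by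
  have key : ∀ (es : List (Fin m)) (adj : Fin n → List (Fin m × Fin n)),
      es.foldl (fun adj e =>
        (Function.update (Function.update adj (G e).1 ((e, (G e).2) :: adj (G e).1)) (G e).2
          ((e, (G e).1) :: (Function.update adj (G e).1 ((e, (G e).2) :: adj (G e).1)) (G e).2)))
        adj = fun u => adjList G es u ++ adj u := by
    intro es
    induction es with
    | nil => intro adj; simp [adjList]
    | cons e es ih =>
      intro adj
      rw [List.foldl_cons, ih]
      funext u
      simp only [adjList, List.reverse_cons, List.flatMap_append, List.flatMap_cons,
        List.flatMap_nil, List.append_nil, List.append_assoc, List.append_cancel_left_eq]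
      by_cases h1 : (G e).1 = u <;> by_cases h2 : (G e).2 = u
      · subst h1; simp [h2]
      · subst h1; simp [h2, Function.update_of_ne (Ne.symm h2)]
      · subst h2
        simp [h1, Function.update_of_ne (Ne.symm h1)]
      · simp [h1, h2, Function.update_of_ne (Ne.symm h1), Function.update_of_ne (Ne.symm h2)]
  simp only [buildAdj, Timed.bind_val, Timed.fold_val, Timed.pure_val, Timed.tabulate_val]
  rw [key]
  simp

@[simp] theorem buildAdj_time (G : MGraph n m) (vs : List (Fin n)) (es : List (Fin m)) :
    (buildAdj G vs es).time = vs.length + es.length := by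
  simp [buildAdj]

theorem mem_adjList {G : MGraph n m} {es : List (Fin m)} {u : Fin n} {x : Fin m × Fin n} :
    x ∈ adjList G es u ↔ x.1 ∈ es ∧ G.Joins x.1 u x.2 := by
  obtain ⟨e, w⟩ := x
  simp only [adjList, List.mem_flatMap, List.mem_reverse, List.mem_append, MGraph.Joins]
  constructor
  · rintro ⟨f, hf, h | h⟩
    · split_ifs at h with h'
      · simp at h; obtain ⟨rfl, rfl⟩ := h; exact ⟨hf, Or.inr (by ext <;> simp [h'])⟩
      · simp at h
    · split_ifs at h with h'
      · simp at h; obtain ⟨rfl, rfl⟩ := h; exact ⟨hf, Or.inl (by ext <;> simp [h'])⟩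
      · simp at h
  · rintro ⟨he, h | h⟩
    · exact ⟨e, he, Or.inr (by simp [h])⟩
    · exact ⟨e, he, Or.inl (by simp [h])⟩

/-- Double counting: a sum over an adjacency list becomes a sum over edges, in which a loop
contributes twice. Degrees, cut sizes and multiplicities of entries come from different choices of
`g`. -/
theorem sum_adjList (G : MGraph n m) (es : List (Fin m)) (u : Fin n) (g : Fin m × Fin n → ℕ) :
    ((adjList G es u).map g).sum = (es.map fun e => (if (G e).1 = u then g (e, (G e).2) else 0)
      + (if (G e).2 = u then g (e, (G e).1) else 0)).sum := by
  induction es with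
  | nil => simp [adjList]
  | cons e es ih =>
    simp only [adjList] at ih
    simp only [adjList, List.reverse_cons, List.flatMap_append, List.map_append, List.sum_append,
      ih, List.map_cons, List.sum_cons, List.flatMap_cons, List.flatMap_nil, List.append_nil]
    split_ifs <;> simp <;> omega

theorem length_adjList (G : MGraph n m) (es : List (Fin m)) (u : Fin n) :
    (adjList G es u).length = degIn G es u := by
  have := sum_adjList G es u (fun _ => 1)
  simpa [degIn] using this

@[simp] theorem degrees_val (G : MGraph n m) (vs : List (Fin n)) (es : List (Fin m)) :
    (degrees G vs es).val = degIn G es := by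
  have key : ∀ (es : List (Fin m)) (d : Fin n → ℕ),
      es.foldl (fun d e =>
        (Function.update (Function.update d (G e).1 (d (G e).1 + 1)) (G e).2
          ((Function.update d (G e).1 (d (G e).1 + 1)) (G e).2 + 1)))
        d = fun u => degIn G es u + d u := by
    intro es
    induction es with
    | nil => intro d; simp [degIn]
    | cons e es ih =>
      intro d
      rw [List.foldl_cons, ih]
      funext u
      simp only [degIn, List.map_cons, List.sum_cons]
      by_cases h1 : (G e).1 = u <;> by_cases h2 : (G e).2 = u
      · subst h1; simp [h2]; omega
      · subst h1; simp [h2, Function.update_of_ne (Ne.symm h2)]; omega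
      · subst h2
        simp [h1, Function.update_of_ne (Ne.symm h1)]; omega
      · simp [h1, h2, Function.update_of_ne (Ne.symm h1), Function.update_of_ne (Ne.symm h2)]
  simp only [degrees, Timed.bind_val, Timed.fold_val, Timed.pure_val, Timed.tabulate_val]
  rw [key]
  simp

@[simp] theorem degrees_time (G : MGraph n m) (vs : List (Fin n)) (es : List (Fin m)) :
    (degrees G vs es).time = vs.length + es.length := by
  simp [degrees]

theorem sum_degIn (G : MGraph n m) (es : List (Fin m)) : ∑ v, degIn G es v = 2 * es.length := by
  simp only [degIn, Finset.sum_list_sum_comm, Finset.sum_add_distrib, Finset.sum_ite_eq,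
    Finset.mem_univ, if_true]
  simp [mul_comm]

theorem sum_map_degIn_le (G : MGraph n m) (es : List (Fin m)) {vs : List (Fin n)}
    (hvs : vs.Nodup) : (vs.map (degIn G es)).sum ≤ 2 * es.length :=
  (List.sum_map_le_sum_univ _ hvs).trans (sum_degIn G es).le

theorem degIn_finRange (G : MGraph n m) (v : Fin n) :
    degIn G (List.finRange m) v = G.degree v := by
  rw [degIn, MGraph.degree, ← List.sum_toFinset _ (List.nodup_finRange m)]
  congr 1
  ext; simp

theorem degIn_le_degree (G : MGraph n m) {es : List (Fin m)} (hes : es.Nodup) (v : Fin n) :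
    degIn G es v ≤ G.degree v :=
  List.sum_map_le_sum_univ _ hes

theorem MGraph.degree_le_maxDegree (G : MGraph n m) (v : Fin n) : G.degree v ≤ G.maxDegree :=
  Finset.le_sup (Finset.mem_univ v)

/-- Deleting vertices removes at most as many edges as their degrees add up to. -/
theorem length_le_filter_add_degIn (G : MGraph n m) (es : List (Fin m)) (del : List (Fin n)) :
    es.length ≤ (es.filter fun e => !decide ((G e).1 ∈ del) && !decide ((G e).2 ∈ del)).length
      + (del.map (degIn G es)).sum := by
  induction es with
  | nil => simp
  | cons e es ih =>
    have h1 : ∀ v, degIn G (e :: es) v = ((if (G e).1 = v then 1 else 0) +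
      (if (G e).2 = v then 1 else 0)) + degIn G es v := fun v => by simp [degIn]
    have h2 : (del.map (degIn G (e :: es))).sum = (del.map fun v => ((if (G e).1 = v then 1 else 0)
        + (if (G e).2 = v then 1 else 0))).sum + (del.map (degIn G es)).sum := by
      rw [← List.sum_map_add]; exact congrArg List.sum (List.map_congr_left fun v _ => h1 v)
    have h3 : ∀ w ∈ del, w = (G e).1 ∨ w = (G e).2 → 1 ≤ (del.map fun v =>
        ((if (G e).1 = v then 1 else 0) + (if (G e).2 = v then 1 else 0))).sum := by
      intro w hw hwe
      have := List.single_le_sum (l := del.map fun v =>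
        ((if (G e).1 = v then 1 else 0) + (if (G e).2 = v then 1 else 0))) (by simp)
        ((if (G e).1 = w then 1 else 0) + (if (G e).2 = w then 1 else 0))
        (List.mem_map_of_mem hw)
      rcases hwe with rfl | rfl <;> simp at this ⊢ <;> omega
    rw [h2]
    by_cases h : (G e).1 ∈ del
    · have := h3 _ h (Or.inl rfl)
      rw [List.filter_cons_of_neg (by simp [h]), List.length_cons]; omega
    · by_cases h' : (G e).2 ∈ del
      · have := h3 _ h' (Or.inr rfl)
        rw [List.filter_cons_of_neg (by simp [h']), List.length_cons]; omega
      · rw [List.filter_cons_of_pos (by simp [h, h']), List.length_cons, List.length_cons]; omega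

theorem foldl_update_true {α : Type} [DecidableEq α] (del : List α) (mk : α → Bool) :
    del.foldl (fun mark v => Function.update mark v true) mk
      = fun v => decide (v ∈ del) || mk v := by
  induction del generalizing mk with
  | nil => simp
  | cons a l ih =>
    rw [List.foldl_cons, ih]
    funext v
    by_cases h : v = a
    · subst h; simp
    · simp [h]

theorem deleteVerts_val (G : MGraph n m) (del vs : List (Fin n)) (es : List (Fin m)) :
    (deleteVerts G del vs es).val = (vs.filter fun v => !decide (v ∈ del),
      es.filter fun e => !decide ((G e).1 ∈ del) && !decide ((G e).2 ∈ del)) := by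
  simp [deleteVerts, foldl_update_true]

@[simp] theorem deleteVerts_time (G : MGraph n m) (del vs : List (Fin n)) (es : List (Fin m)) :
    (deleteVerts G del vs es).time = n + del.length + 2 * vs.length + 2 * es.length := by
  simp [deleteVerts]; omega

end Graph

/-! ### Walks -/

section Walks

variable {n m : ℕ}

/-- `P` is a walk from `a` to `b`; it lists each vertex but the last with the edge that follows. -/
def MGraph.IsWalk (G : MGraph n m) : Fin n → Cyc n m → Fin n → Prop
  | a, [], b => a = b
  | a, x :: P, b => x.1 = a ∧ ∃ y, G.Joins x.2 a y ∧ G.IsWalk y P b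

theorem MGraph.IsWalk.append {G : MGraph n m} {P Q : Cyc n m} {a b c : Fin n}
    (hP : G.IsWalk a P b) (hQ : G.IsWalk b Q c) : G.IsWalk a (P ++ Q) c := by
  induction P generalizing a with
  | nil => cases hP; exact hQ
  | cons x P ih =>
    obtain ⟨rfl, y, hy, h⟩ := hP
    exact ⟨rfl, y, hy, ih h⟩

theorem MGraph.IsWalk.single {G : MGraph n m} {a b : Fin n} {e : Fin m} (h : G.Joins e a b) :
    G.IsWalk a [(a, e)] b := ⟨rfl, b, h, rfl⟩

theorem MGraph.IsWalk.joins_of_mem {G : MGraph n m} {P : Cyc n m} {a b : Fin n}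
    (h : G.IsWalk a P b) {z : Fin n} {e : Fin m} (hz : (z, e) ∈ P) :
    ∃ z', G.Joins e z z' ∧ z' ∈ P.map Prod.fst ++ [b] := by
  induction P generalizing a with
  | nil => simp at hz
  | cons x P ih =>
    obtain ⟨rfl, y, hy, h⟩ := h
    rcases List.mem_cons.1 hz with rfl | hz
    · refine ⟨y, hy, ?_⟩
      cases P with
      | nil => cases h; simp
      | cons x' P => obtain ⟨rfl, -⟩ := h; simp
    · obtain ⟨z', h1, h2⟩ := ih h hz
      exact ⟨z', h1, by simp at h2 ⊢; tauto⟩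

/-- If the first edge occurred again, both its ends, and with them the first vertex, would lie among
the later vertices. -/
theorem MGraph.IsWalk.snd_nodup {G : MGraph n m} {P : Cyc n m} {a b : Fin n}
    (h : G.IsWalk a P b) (hn : (P.map Prod.fst ++ [b]).Nodup) : (P.map Prod.snd).Nodup := by
  induction P generalizing a with
  | nil => simp
  | cons x P ih =>
    obtain ⟨rfl, y, hy, h⟩ := h
    simp only [List.map_cons, List.cons_append, List.nodup_cons] at hn ⊢
    refine ⟨fun hmem => ?_, ih h hn.2⟩
    obtain ⟨⟨z, e⟩, hz, he⟩ := List.mem_map.1 hmem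
    obtain ⟨z', hz', hz'm⟩ := h.joins_of_mem hz
    have hzm : z ∈ P.map Prod.fst ++ [b] :=
      List.mem_append_left _ (List.mem_map_of_mem (f := Prod.fst) hz)
    simp only at he
    subst he
    rcases hy.cases_eq hz' with ⟨h1, h2⟩ | ⟨h1, h2⟩
    · exact hn.1 (h1 ▸ hzm)
    · exact hn.1 (h1 ▸ hz'm)

/-- Only the vertex of the successor enters the relation, so the edge `f` attached to the last
vertex is arbitrary. For a closed walk, choosing its first edge makes the second list the rotation
required by `IsCycle`. -/
theorem MGraph.IsWalk.forall₂ {G : MGraph n m} {P : Cyc n m} {a b : Fin n} (h : G.IsWalk a P b)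
    (f : Fin m) : List.Forall₂ (fun x y => G.Joins x.2 x.1 y.1) P (P.tail ++
      (if P = [] then [] else [(b, f)])) := by
  induction P generalizing a with
  | nil => simp
  | cons x P ih =>
    obtain ⟨rfl, y, hy, h⟩ := h
    cases P with
    | nil => cases h; simpa using hy
    | cons x' P =>
      have := ih h
      obtain ⟨rfl, -⟩ := h
      simp only [List.tail_cons] at this ⊢
      simpa using ⟨hy, by simpa using this⟩

/-- A closed walk with distinct vertices is a cycle unless it uses one edge twice. -/
theorem MGraph.IsWalk.isCycle {G : MGraph n m} {P : Cyc n m} {a : Fin n} {e : Fin m}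
    (h : G.IsWalk a ((a, e) :: P) a) (hn : (((a, e) :: P).map Prod.fst).Nodup)
    (he : ∀ z, P ≠ [(z, e)]) : G.IsCycle ((a, e) :: P) := by
  have h' := h
  obtain ⟨-, y, hy, hP⟩ := h'
  simp only at hy
  refine ⟨by simp, hn, ?_, ?_⟩
  · simp only [List.map_cons, List.nodup_cons] at hn ⊢
    have hn2 : (P.map Prod.fst ++ [a]).Nodup := by
      rw [List.nodup_append]; simp [hn.2]; intro x f hx hxa; subst hxa
      exact hn.1 (List.mem_map_of_mem (f := Prod.fst) hx)
    refine ⟨fun hmem => ?_, hP.snd_nodup hn2⟩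
    obtain ⟨⟨z, f⟩, hz, hf⟩ := List.mem_map.1 hmem
    simp only at hf
    subst hf
    -- Suppose the first edge recurs at `z`. Then `z` is its other end, hence the second vertex, and
    -- the walk returns to its start at once; distinctness of the vertices leaves only the walk
    -- excluded by `he`.
    have hza : z ≠ a := by
      rintro rfl; exact hn.1 (List.mem_map_of_mem (f := Prod.fst) hz)
    cases P with
    | nil => simp at hz
    | cons x P =>
      obtain ⟨z', hz', -⟩ := hP.joins_of_mem hz
      obtain ⟨hx1, y', hy', hP'⟩ := hP
      have hzy : z = y := by
        rcases hy.cases_eq hz' with ⟨h1, -⟩ | ⟨-, h2⟩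
        · exact absurd h1.symm hza
        · exact h2.symm
      subst hzy
      have hzx : x = (z, f) := by
        rcases List.mem_cons.1 hz with hz | hz
        · exact hz.symm
        · have h3 := List.mem_map_of_mem (f := Prod.fst) hz
          simp only [List.map_cons, List.nodup_cons, hx1] at hn
          exact absurd h3 hn.2.1
      subst hzx
      have hya : y' = a := by
        rcases hy.cases_eq hy' with ⟨h1, -⟩ | ⟨h1, -⟩
        · exact absurd h1.symm hza
        · exact h1.symm
      subst hya
      cases P with
      | nil => exact he z rfl
      | cons x P =>
        obtain ⟨hx2, -⟩ := hP'
        simp [hx2] at hn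
  · have := h.forall₂ e
    simpa [List.rotate_cons_succ] using this

end Walks

/-! ### Rooted trees -/

section Trees

variable {n m : ℕ}

/-- The vertices of the tree of `T` with root `r`, listed with children before parents; its edges
belong to `es`. -/
inductive TreeOrder (G : MGraph n m) (es : List (Fin m)) (T : Forest n m) (r : Fin n) :
    List (Fin n) → Prop
  | root (hp : T.par r = none) (hd : T.dep r = 0) : TreeOrder G es T r [r]
  | child {l : List (Fin n)} {v p : Fin n} {e : Fin m} (h : TreeOrder G es T r l) (hv : v ∉ l)
      (hp : T.par v = some (p, e)) (hpl : p ∈ l) (he : e ∈ es) (hj : G.Joins e p v)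
      (hd : T.dep v = T.dep p + 1) : TreeOrder G es T r (v :: l)

namespace TreeOrder

variable {G : MGraph n m} {es : List (Fin m)} {T : Forest n m} {r : Fin n} {l : List (Fin n)}

theorem nodup (h : TreeOrder G es T r l) : l.Nodup := by
  induction h with
  | root => simp
  | child _ hv _ _ _ _ _ ih => exact List.nodup_cons.2 ⟨hv, ih⟩

theorem root_mem (h : TreeOrder G es T r l) : r ∈ l := by
  induction h with
  | root => simp
  | child _ _ _ _ _ _ _ ih => simp [ih]

theorem root_spec (h : TreeOrder G es T r l) : T.par r = none ∧ T.dep r = 0 := by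
  induction h with
  | root hp hd => exact ⟨hp, hd⟩
  | child _ _ _ _ _ _ _ ih => exact ih

theorem cases_mem (h : TreeOrder G es T r l) {v : Fin n} (hv : v ∈ l) :
    v = r ∨ ∃ p e, T.par v = some (p, e) ∧ p ∈ l ∧ e ∈ es ∧ G.Joins e p v ∧
      T.dep v = T.dep p + 1 := by
  induction h with
  | root => simp at hv; exact Or.inl hv
  | @child l v' p e h hv' hp hpl he hj hd ih =>
    rcases List.mem_cons.1 hv with rfl | hv
    · exact Or.inr ⟨p, e, hp, by simp [hpl], he, hj, hd⟩
    · rcases ih hv with h | ⟨p, e, h1, h2, h3⟩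
      · exact Or.inl h
      · exact Or.inr ⟨p, e, h1, by simp [h2], h3⟩

theorem of_par (h : TreeOrder G es T r l) {v p : Fin n} {e : Fin m} (hv : v ∈ l)
    (hp : T.par v = some (p, e)) :
    v ≠ r ∧ p ∈ l ∧ e ∈ es ∧ G.Joins e p v ∧ T.dep v = T.dep p + 1 := by
  rcases h.cases_mem hv with rfl | ⟨p', e', h1, h2⟩
  · rw [h.root_spec.1] at hp; simp at hp
  · refine ⟨?_, ?_⟩
    · rintro rfl; rw [h.root_spec.1] at hp; simp at hp
    · rw [h1] at hp; simp at hp; obtain ⟨rfl, rfl⟩ := hp; exact h2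

theorem eq_root_of_par_eq_none (h : TreeOrder G es T r l) {v : Fin n} (hv : v ∈ l)
    (hp : T.par v = none) : v = r := by
  rcases h.cases_mem hv with rfl | ⟨p', e', h1, h2⟩
  · rfl
  · rw [hp] at h1; simp at h1

/-- This makes a pass along the list an upward pass and a pass along its reverse a downward pass:
the parent always lies behind its child. -/
theorem par_mem_of_split (h : TreeOrder G es T r l) {l₁ l₂ : List (Fin n)} {v p : Fin n}
    {e : Fin m} (hl : l = l₁ ++ v :: l₂) (hp : T.par v = some (p, e)) : p ∈ l₂ := by
  induction h generalizing l₁ with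
  | root hp' hd =>
    cases l₁ with
    | nil => simp at hl; obtain ⟨rfl, -⟩ := hl; rw [hp'] at hp; simp at hp
    | cons => simp at hl
  | @child l v' p e h hv' hp' hpl he hj hd ih =>
    cases l₁ with
    | nil =>
      simp at hl; obtain ⟨rfl, rfl⟩ := hl
      rw [hp'] at hp; simp at hp; obtain ⟨rfl, rfl⟩ := hp; exact hpl
    | cons x l₁ =>
      simp at hl; exact ih hl.2

theorem congr {T' : Forest n m} (h : TreeOrder G es T r l) (hT : ∀ v ∈ l, T'.par v = T.par v)
    (hd : ∀ v ∈ l, T'.dep v = T.dep v) : TreeOrder G es T' r l := by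
  induction h with
  | root hp hd' => exact .root (by rw [hT _ (by simp), hp]) (by rw [hd _ (by simp), hd'])
  | @child l v' p e h hv' hp' hpl he hj hd' ih =>
    refine .child (ih (fun v hv => hT v (by simp [hv])) (fun v hv => hd v (by simp [hv]))) hv'
      (by rw [hT _ (by simp), hp']) hpl he hj ?_
    rw [hd _ (by simp), hd p (by simp [hpl]), hd']

theorem addRoot (T : Forest n m) : TreeOrder G es (T.addRoot r) r [r] :=
  .root (by simp [Forest.addRoot]) (by simp [Forest.addRoot])

theorem addChild (h : TreeOrder G es T r l) {u w : Fin n} {e : Fin m} (hu : u ∈ l) (hw : w ∉ l)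
    (he : e ∈ es) (hj : G.Joins e u w) : TreeOrder G es (T.addChild u e w) r (w :: l) := by
  have hne : ∀ v ∈ l, v ≠ w := fun v hv h => hw (h ▸ hv)
  refine .child (h.congr ?_ ?_) hw (p := u) (e := e) ?_ hu he hj ?_
  · intro v hv; simp [Forest.addChild, Function.update_of_ne (hne v hv)]
  · intro v hv; simp [Forest.addChild, Function.update_of_ne (hne v hv)]
  · simp [Forest.addChild]
  · simp [Forest.addChild, Function.update_of_ne (hne u hu)]

/-- The ancestors of a vertex, including itself. -/
theorem exists_ancestors (h : TreeOrder G es T r l) : ∃ A : Fin n → Finset (Fin n),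
    (∀ v ∈ l, v ∈ A v ∧ ∀ u ∈ A v, u ∈ l ∧ (u = v ∨ T.dep u < T.dep v)) ∧
    ∀ v ∈ l, ∀ p e, T.par v = some (p, e) → A v = insert v (A p) := by
  induction h with
  | root hp hd =>
    refine ⟨fun v => {v}, by simp, ?_⟩
    intro v hv p e hp'
    simp at hv; subst hv; rw [hp] at hp'; simp at hp'
  | @child l v' p e h hv' hp' hpl he hj hd' ih =>
    obtain ⟨A, h1, h2⟩ := ih
    have hne : ∀ v ∈ l, v ≠ v' := fun v hv h => hv' (h ▸ hv)
    refine ⟨Function.update A v' (insert v' (A p)), ?_, ?_⟩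
    · intro v hv
      rcases List.mem_cons.1 hv with rfl | hv
      · simp only [Function.update_self, Finset.mem_insert, true_or, true_and]
        rintro u (rfl | hu)
        · simp
        · obtain ⟨h3, h4⟩ := (h1 p hpl).2 u hu
          refine ⟨by simp [h3], Or.inr ?_⟩
          rcases h4 with rfl | h4 <;> omega
      · rw [Function.update_of_ne (hne v hv)]
        refine ⟨(h1 v hv).1, fun u hu => ?_⟩
        obtain ⟨h3, h4⟩ := (h1 v hv).2 u hu
        exact ⟨by simp [h3], h4⟩
    · intro v hv q f hq
      rcases List.mem_cons.1 hv with rfl | hv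
      · rw [hp'] at hq; simp at hq; obtain ⟨rfl, rfl⟩ := hq
        rw [Function.update_self, Function.update_of_ne (hne p hpl)]
      · rw [Function.update_of_ne (hne v hv), Function.update_of_ne (hne q (h.of_par hv hq).2.1)]
        exact h2 v hv q f hq

end TreeOrder

/-- The specification of `treePath` for two vertices in a part of the tree that is closed under
passing to the parent of the deeper of two vertices. -/
theorem treePath_spec {G : MGraph n m} {es : List (Fin m)} {T : Forest n m} {r : Fin n}
    {l : List (Fin n)} (h : TreeOrder G es T r l) {S Q : Fin n → Prop}
    (hS : ∀ a b, a ∈ l → b ∈ l → S a → S b → a ≠ b → T.dep b ≤ T.dep a →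
      Q a ∧ ∀ p e, T.par a = some (p, e) → S p)
    {fuel : ℕ} (hfuel : l.length ≤ fuel) {a b : Fin n} (ha : a ∈ l) (hb : b ∈ l) (hSa : S a)
    (hSb : S b) (acc : Cyc n m) :
    ∃ P : Cyc n m, (treePath T fuel a b acc).val = P ++ acc ∧ G.IsWalk a P b ∧
      (P.map Prod.fst ++ [b]).Nodup ∧ (∀ x ∈ P, x.1 ∈ l ∧ S x.1 ∧
        ∃ c p, c ∈ l ∧ S c ∧ Q c ∧ T.par c = some (p, x.2)) ∧
      P.length ≤ T.dep a + T.dep b ∧ (treePath T fuel a b acc).time ≤ P.length + 1 := by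
  obtain ⟨A, hA, hA'⟩ := h.exists_ancestors
  -- Each step removes the deeper end from the union of the two ancestor sets. The size of the union
  -- therefore bounds the fuel, and since the rest of the path stays in the smaller union, no vertex
  -- repeats. For a path inside a part, `S` is membership in the part and `Q` says that a vertex is
  -- not its top.
  have key : ∀ (fuel : ℕ) (a b : Fin n) (acc : Cyc n m), (A a ∪ A b).card ≤ fuel → a ∈ l →
      b ∈ l → S a → S b → ∃ P : Cyc n m, (treePath T fuel a b acc).val = P ++ acc ∧
      G.IsWalk a P b ∧ (P.map Prod.fst ++ [b]).Nodup ∧ (∀ x ∈ P, x.1 ∈ l ∧ S x.1 ∧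
        ∃ c p, c ∈ l ∧ S c ∧ Q c ∧ T.par c = some (p, x.2)) ∧
      P.length ≤ T.dep a + T.dep b ∧ (treePath T fuel a b acc).time ≤ P.length + 1 ∧
      ∀ x ∈ P.map Prod.fst ++ [b], x ∈ A a ∪ A b := by
    intro fuel
    induction fuel with
    | zero =>
      intro a b acc hc ha
      have := (hA a ha).1
      simp at hc
      simp [hc.1] at this
    | succ fuel ih =>
      intro a b acc hc ha hb hSa hSb
      by_cases hab : a = b
      · subst hab
        exact ⟨[], by simp [treePath], rfl, by simp, by simp, by simp, by simp [treePath],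
          by simp [(hA a ha).1]⟩
      by_cases hd : T.dep b ≤ T.dep a
      · rcases h.cases_mem ha with rfl | ⟨p, e, hp, hpl, he, hj, hdp⟩
        · exfalso
          rcases h.cases_mem hb with rfl | ⟨p, e, hp, hpl, he, hj, hdp⟩
          · exact hab rfl
          · have := h.root_spec.2; omega
        · obtain ⟨hQ, hSp⟩ := hS a b ha hb hSa hSb hab hd
          -- Proper ancestors are strictly less deep, so the end that is at least as deep is an
          -- ancestor neither of its own parent nor of the other end.
          have hna : a ∉ A p ∪ A b := by
            intro hmem
            rcases Finset.mem_union.1 hmem with h1 | h1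
            · rcases ((hA p hpl).2 a h1).2 with h2 | h2
              · subst h2; omega
              · omega
            · rcases ((hA b hb).2 a h1).2 with h2 | h2
              · exact hab h2
              · omega
          have hAa := hA' a ha p e hp
          have hu : A a ∪ A b = insert a (A p ∪ A b) := by rw [hAa, Finset.insert_union]
          obtain ⟨P, h1, h2, h3, h4, h5, h6, h7⟩ := ih p b acc (by
            rw [hu, Finset.card_insert_of_notMem hna] at hc; omega) hpl hb (hSp p e hp) hSb
          refine ⟨(a, e) :: P, ?_, ⟨rfl, p, hj.symm, h2⟩, ?_, ?_, ?_, ?_, ?_⟩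
          · simp [treePath, hab, hd, hp, h1]
          · simp only [List.map_cons, List.cons_append, List.nodup_cons]
            exact ⟨fun hm => hna (h7 a hm), h3⟩
          · intro x hx
            rcases List.mem_cons.1 hx with rfl | hx
            · exact ⟨ha, hSa, a, p, ha, hSa, hQ, hp⟩
            · exact h4 x hx
          · simp; omega
          · simp [treePath, hab, hd, hp]; omega
          · intro x hx
            rw [hu]
            simp only [List.map_cons, List.cons_append, List.mem_cons] at hx
            rcases hx with rfl | hx
            · simp
            · exact Finset.mem_insert_of_mem (h7 x hx)
      · rcases h.cases_mem hb with rfl | ⟨p, e, hp, hpl, he, hj, hdp⟩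
        · have := h.root_spec.2; omega
        · obtain ⟨hQ, hSp⟩ := hS b a hb ha hSb hSa (Ne.symm hab) (by omega)
          have hnb : b ∉ A a ∪ A p := by
            intro hmem
            rcases Finset.mem_union.1 hmem with h1 | h1
            · rcases ((hA a ha).2 b h1).2 with h2 | h2
              · exact hab h2.symm
              · omega
            · rcases ((hA p hpl).2 b h1).2 with h2 | h2
              · subst h2; omega
              · omega
          have hAb := hA' b hb p e hp
          have hu : A a ∪ A b = insert b (A a ∪ A p) := by rw [hAb, Finset.union_insert]
          obtain ⟨P, h1, h2, h3, h4, h5, h6, h7⟩ := ih a p ((p, e) :: acc) (by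
            rw [hu, Finset.card_insert_of_notMem hnb] at hc; omega) ha hpl hSa (hSp p e hp)
          refine ⟨P ++ [(p, e)], ?_, h2.append (.single hj), ?_, ?_, ?_, ?_, ?_⟩
          · simp [treePath, hab, hd, hp, h1]
          · rw [List.map_append, List.nodup_append]
            refine ⟨by simpa using h3, by simp, ?_⟩
            intro x hx y hy
            simp at hy; subst hy
            rintro rfl
            exact hnb (h7 x (by simpa using hx))
          · intro x hx
            rcases List.mem_append.1 hx with hx | hx
            · exact h4 x hx
            · simp at hx; subst hx
              exact ⟨hpl, hSp p e hp, b, p, hb, hSb, hQ, hp⟩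
          · simp; omega
          · simp [treePath, hab, hd, hp]; omega
          · intro x hx
            rw [hu]
            simp only [List.map_append, List.mem_append, List.map_cons, List.map_nil,
              List.mem_singleton] at hx
            rcases hx with hx | rfl
            · exact Finset.mem_insert_of_mem (h7 x (by simpa using hx))
            · simp
  have hcard : (A a ∪ A b).card ≤ fuel := by
    refine le_trans (le_trans (Finset.card_le_card (t := l.toFinset) ?_)
      (List.toFinset_card_le l)) hfuel
    intro x hx
    rw [List.mem_toFinset]
    rcases Finset.mem_union.1 hx with h1 | h1
    · exact ((hA a ha).2 x h1).1
    · exact ((hA b hb).2 x h1).1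
  obtain ⟨P, h1, h2, h3, h4, h5, h6, -⟩ := key fuel a b acc hcard ha hb hSa hSb
  exact ⟨P, h1, h2, h3, h4, h5, h6⟩

end Trees

/-! ### Breadth first search -/

section Bfs

variable {n m : ℕ}

/-- One step of a breadth first search: look at the entry `(e, w)` of the list of `u`. -/
def bfsStep (s : Forest n m × List (Fin n) × List (Fin n)) (x : Fin n × Fin m × Fin n) :
    Forest n m × List (Fin n) × List (Fin n) :=
  if s.1.seen x.2.2 then s
  else (s.1.addChild x.1 x.2.1 x.2.2, x.2.2 :: s.2.1, x.2.2 :: s.2.2)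

/-- The entries of the adjacency lists of the vertices in `l`, with these vertices. -/
def adjDarts (adj : Fin n → List (Fin m × Fin n)) (l : List (Fin n)) :
    List (Fin n × Fin m × Fin n) := l.flatMap fun u => (adj u).map (Prod.mk u)

theorem mem_adjDarts {adj : Fin n → List (Fin m × Fin n)} {l : List (Fin n)}
    {x : Fin n × Fin m × Fin n} : x ∈ adjDarts adj l ↔ x.1 ∈ l ∧ x.2 ∈ adj x.1 := by
  obtain ⟨u, y⟩ := x
  simp only [adjDarts, List.mem_flatMap, List.mem_map, Prod.mk.injEq]
  constructor
  · rintro ⟨a, ha, b, hb, rfl, rfl⟩; exact ⟨ha, hb⟩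
  · rintro ⟨h1, h2⟩; exact ⟨u, h1, y, h2, rfl, rfl⟩

/-- The state after scanning a layer `lay` of a breadth first search. -/
def bfsLayer (adj : Fin n → List (Fin m × Fin n)) (T : Forest n m) (lay order : List (Fin n)) :
    Forest n m × List (Fin n) × List (Fin n) :=
  (adjDarts adj lay).foldl bfsStep (T, [], order)

theorem bfsLoop_cons (adj : Fin n → List (Fin m × Fin n)) (fuel : ℕ) (T : Forest n m)
    (u : Fin n) (us order : List (Fin n)) :
    (bfsLoop adj (fuel + 1) T (u :: us) order).val =
      (bfsLoop adj fuel (bfsLayer adj T (u :: us) order).1 (bfsLayer adj T (u :: us) order).2.1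
        (bfsLayer adj T (u :: us) order).2.2).val ∧
    (bfsLoop adj (fuel + 1) T (u :: us) order).time =
      1 + ((u :: us).map fun v => 1 + (adj v).length).sum +
      (bfsLoop adj fuel (bfsLayer adj T (u :: us) order).1 (bfsLayer adj T (u :: us) order).2.1
        (bfsLayer adj T (u :: us) order).2.2).time := by
  have hv : (Timed.fold (fun s u =>
      Timed.fold (fun (s : Forest n m × List (Fin n) × List (Fin n)) (ew : Fin m × Fin n) =>
        pure (if s.1.seen ew.2 then s
          else (s.1.addChild u ew.1 ew.2, ew.2 :: s.2.1, ew.2 :: s.2.2))) s (adj u))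
      (T, [], order) (u :: us)).val = bfsLayer adj T (u :: us) order := by
    simp only [Timed.fold_val, Timed.pure_val]
    rw [bfsLayer, adjDarts]
    exact List.foldl_foldl_flatMap (fun s u ew => bfsStep s (u, ew)) adj (u :: us) (T, [], order)
  constructor
  · rw [bfsLoop]
    simp only [Timed.bind_val]
    rw [hv]
  · rw [bfsLoop]
    simp only [Timed.bind_time, tick]
    rw [hv, Timed.fold_time_eq (g := fun v => (adj v).length) (fun s a => by simp)]
    omega

/-- What a completed breadth first search from `r` outside of the closed set `S` returns. -/
structure IsBfsTree (G : MGraph n m) (es : List (Fin m)) (S : Fin n → Prop) (r : Fin n)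
    (T : Forest n m) (order : List (Fin n)) : Prop where
  tree : TreeOrder G es T r order
  seen : ∀ v, T.seen v = true ↔ v ∈ order ∨ S v
  notMem : ∀ v ∈ order, ¬ S v
  closed : ∀ u ∈ order, ∀ e w, e ∈ es → G.Joins e u w → w ∈ order ∧ T.dep w ≤ T.dep u + 1

/-- Depth grows by at most one along an edge. So the search reaches everything connected to the
root, and depths are bounded by lengths of walks; this is how a diameter bound becomes a bound on
depths. -/
theorem IsBfsTree.of_walk {G : MGraph n m} {es : List (Fin m)} {S : Fin n → Prop} {r : Fin n}
    {T : Forest n m} {order : List (Fin n)} (h : IsBfsTree G es S r T order) {P : Cyc n m}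
    {u v : Fin n} (hP : G.IsWalk u P v) (hes : ∀ x ∈ P, x.2 ∈ es) (hu : u ∈ order) :
    v ∈ order ∧ T.dep v ≤ T.dep u + P.length := by
  induction P generalizing u with
  | nil => cases hP; simp [hu]
  | cons x P ih =>
    obtain ⟨rfl, y, hy, hP⟩ := hP
    have h1 := h.closed x.1 hu x.2 y (hes x (by simp)) hy
    have h2 := ih hP (fun z hz => hes z (by simp [hz])) h1.1
    refine ⟨h2.1, ?_⟩
    have := h1.2
    have := h2.2
    simp; omega

/-- The invariant between two layers: `lay` is the current layer, all of depth `L`, and the edges at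
the scanned vertices `done` stay among reached vertices. Neighbours of `lay` satisfy the depth
condition because nothing reached is deeper than `L + 1`. The set `S` holds the vertices of earlier
searches, which by `hS` are never adjacent to new ones. -/
theorem bfsLayer_spec {G : MGraph n m} {es : List (Fin m)} {S : Fin n → Prop} {r : Fin n}
    (hS : ∀ u, ¬ S u → ∀ e w, e ∈ es → G.Joins e u w → ¬ S w)
    {T : Forest n m} {lay done : List (Fin n)} {L : ℕ}
    (hT : TreeOrder G es T r (lay ++ done))
    (hseen : ∀ v, T.seen v = true ↔ v ∈ lay ++ done ∨ S v)
    (hnS : ∀ v ∈ lay ++ done, ¬ S v)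
    (hdep : ∀ v ∈ lay ++ done, T.dep v ≤ L) (hlay : ∀ v ∈ lay, T.dep v = L)
    (hdone : ∀ u ∈ done, ∀ e w, e ∈ es → G.Joins e u w →
      w ∈ lay ++ done ∧ T.dep w ≤ T.dep u + 1) :
    ∃ T' lay', bfsLayer (adjList G es) T lay (lay ++ done) = (T', lay', lay' ++ (lay ++ done)) ∧
      TreeOrder G es T' r (lay' ++ (lay ++ done)) ∧
      (∀ v, T'.seen v = true ↔ v ∈ lay' ++ (lay ++ done) ∨ S v) ∧
      (∀ v ∈ lay' ++ (lay ++ done), ¬ S v) ∧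
      (∀ v ∈ lay' ++ (lay ++ done), T'.dep v ≤ L + 1) ∧ (∀ v ∈ lay', T'.dep v = L + 1) ∧
      (∀ u ∈ lay ++ done, ∀ e w, e ∈ es → G.Joins e u w →
        w ∈ lay' ++ (lay ++ done) ∧ T'.dep w ≤ T'.dep u + 1) := by
  have key := List.foldl_induction (f := bfsStep) (b := (T, [], lay ++ done))
    (l := adjDarts (adjList G es) lay)
    (fun d s => ∃ T' lay', s = (T', lay', lay' ++ (lay ++ done)) ∧
      TreeOrder G es T' r (lay' ++ (lay ++ done)) ∧
      (∀ v, T'.seen v = true ↔ v ∈ lay' ++ (lay ++ done) ∨ S v) ∧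
      (∀ v ∈ lay' ++ (lay ++ done), ¬ S v) ∧
      (∀ v ∈ lay ++ done, T'.dep v = T.dep v) ∧ (∀ v ∈ lay', T'.dep v = L + 1) ∧
      (∀ x ∈ d, x.2.2 ∈ lay' ++ (lay ++ done)))
    ⟨T, [], rfl, hT, hseen, hnS, by simp, by simp, by simp⟩ (by
      rintro d ⟨u, e, w⟩ rest s hl ⟨T', lay', rfl, h1, h2, h3, h4, h5, h6⟩
      have hx : (u, e, w) ∈ adjDarts (adjList G es) lay := by rw [hl]; simp
      obtain ⟨hu, hew⟩ := mem_adjDarts.1 hx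
      obtain ⟨he, hj⟩ := mem_adjList.1 hew
      simp only at hu he hj
      by_cases hsn : T'.seen w = true
      · refine ⟨T', lay', by simp [bfsStep, hsn], h1, h2, h3, h4, h5, ?_⟩
        intro x hx
        rcases List.mem_append.1 hx with hx | hx
        · exact h6 x hx
        · simp at hx; subst hx
          rcases (h2 w).1 hsn with h | h
          · exact h
          · exact absurd h (hS u (hnS u (by simp [hu])) e w he hj)
      · have hw : w ∉ lay' ++ (lay ++ done) := fun h => hsn ((h2 w).2 (Or.inl h))
        have hwS : ¬ S w := fun h => hsn ((h2 w).2 (Or.inr h))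
        have hne : ∀ v ∈ lay' ++ (lay ++ done), v ≠ w := fun v hv h => hw (h ▸ hv)
        refine ⟨T'.addChild u e w, w :: lay', by simp [bfsStep, hsn],
          h1.addChild (by simp [hu]) hw he hj, ?_, ?_, ?_, ?_, ?_⟩
        · intro v
          by_cases hvw : v = w
          · subst hvw; simp [Forest.addChild]
          · simp only [Forest.addChild, Function.update_of_ne hvw, h2 v, List.cons_append,
              List.mem_cons, hvw, false_or]
        · intro v hv
          rcases List.mem_cons.1 hv with rfl | hv
          · exact hwS
          · exact h3 v hv
        · intro v hv
          rw [← h4 v hv]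
          simp [Forest.addChild, Function.update_of_ne (hne v (List.mem_append_right _ hv))]
        · intro v hv
          rcases List.mem_cons.1 hv with rfl | hv
          · simp [Forest.addChild, h4 u (by simp [hu]), hlay u hu]
          · rw [← h5 v hv]
            simp [Forest.addChild, Function.update_of_ne (hne v (List.mem_append_left _ hv))]
        · intro x hx
          rcases List.mem_append.1 hx with hx | hx
          · exact List.mem_cons_of_mem _ (h6 x hx)
          · simp at hx; subst hx; simp)
  obtain ⟨T', lay', h0, h1, h2, h3, h4, h5, h6⟩ := key
  have hdep' : ∀ v ∈ lay' ++ (lay ++ done), T'.dep v ≤ L + 1 := by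
    intro v hv
    rcases List.mem_append.1 hv with hv | hv
    · exact (h5 v hv).le
    · rw [h4 v hv]; have := hdep v hv; omega
  refine ⟨T', lay', h0, h1, h2, h3, hdep', h5, ?_⟩
  intro u hu e w he hj
  by_cases hul : u ∈ lay
  · have hw : w ∈ lay' ++ (lay ++ done) := h6 (u, e, w) (mem_adjDarts.2
      ⟨hul, mem_adjList.2 ⟨he, hj⟩⟩)
    refine ⟨hw, ?_⟩
    rw [h4 u hu, hlay u hul]
    exact hdep' w hw
  · have hud : u ∈ done := by simpa [hul] using hu
    obtain ⟨hw, hd⟩ := hdone u hud e w he hj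
    refine ⟨List.mem_append_right _ hw, ?_⟩
    rw [h4 u hu, h4 w hw]; exact hd

/-- Every round moves a nonempty layer into `done`, and a tree has at most `N` vertices, so the fuel
lasts until the layer is empty. A vertex pays `2 + degree`: its own turn, the entries of its list,
and one unit towards the step charged for its layer. The additional `1` pays for the empty layer at
the end. -/
theorem bfsLoop_spec {G : MGraph n m} {es : List (Fin m)} {S : Fin n → Prop} {r : Fin n}
    (hS : ∀ u, ¬ S u → ∀ e w, e ∈ es → G.Joins e u w → ¬ S w) {N : ℕ}
    (hN : ∀ T l, TreeOrder G es T r l → l.length ≤ N) (fuel : ℕ)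
    {T : Forest n m} {lay done : List (Fin n)} {L : ℕ} (hfuel : N ≤ fuel + done.length)
    (hT : TreeOrder G es T r (lay ++ done))
    (hseen : ∀ v, T.seen v = true ↔ v ∈ lay ++ done ∨ S v)
    (hnS : ∀ v ∈ lay ++ done, ¬ S v)
    (hdep : ∀ v ∈ lay ++ done, T.dep v ≤ L) (hlay : ∀ v ∈ lay, T.dep v = L)
    (hdone : ∀ u ∈ done, ∀ e w, e ∈ es → G.Joins e u w →
      w ∈ lay ++ done ∧ T.dep w ≤ T.dep u + 1) :
    IsBfsTree G es S r (bfsLoop (adjList G es) fuel T lay (lay ++ done)).val.1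
      (bfsLoop (adjList G es) fuel T lay (lay ++ done)).val.2 ∧
    (bfsLoop (adjList G es) fuel T lay (lay ++ done)).time
      + (done.map fun v => 2 + degIn G es v).sum ≤
      1 + ((bfsLoop (adjList G es) fuel T lay (lay ++ done)).val.2.map
        fun v => 2 + degIn G es v).sum := by
  induction fuel generalizing T lay done L with
  | zero =>
    have := hN T _ hT
    have hl : lay = [] := by
      rw [List.length_append] at this
      exact List.length_eq_zero_iff.1 (by omega)
    subst hl
    simp only [List.nil_append] at *
    refine ⟨⟨hT, hseen, hnS, hdone⟩, ?_⟩
    simp [bfsLoop]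
  | succ fuel ih =>
    cases lay with
    | nil =>
      simp only [List.nil_append] at *
      refine ⟨⟨hT, hseen, hnS, hdone⟩, ?_⟩
      simp [bfsLoop]
    | cons u us =>
      obtain ⟨T', lay', h0, h1, h2, h3, h4, h5, h6⟩ :=
        bfsLayer_spec hS hT hseen hnS hdep hlay hdone
      have hl := bfsLoop_cons (adjList G es) fuel T u us (u :: us ++ done)
      rw [h0] at hl
      simp only at hl
      rw [hl.1, hl.2]
      obtain ⟨h7, h8⟩ := ih (by simp; omega) h1 h2 h3 h4 h5 h6
      refine ⟨h7, ?_⟩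
      have h9 : ((u :: us ++ done).map fun v => 2 + degIn G es v).sum =
          (u :: us).length + ((u :: us).map fun v => 1 + (adjList G es v).length).sum +
          (done.map fun v => 2 + degIn G es v).sum := by
        simp only [List.map_append, List.sum_append, length_adjList]
        congr 1
        rw [show (fun v => 2 + degIn G es v) = fun v => 1 + (1 + degIn G es v) by
          funext v; omega]
        generalize (u :: us) = l
        induction l with
        | nil => simp
        | cons a l ih => simp only [List.map_cons, List.sum_cons, ih, List.length_cons]; omega
      rw [h9] at h8
      rw [List.length_cons] at h8
      omega

theorem bfs_spec {G : MGraph n m} {es : List (Fin m)} {r : Fin n} {T : Forest n m}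
    (hS : ∀ u, ¬ T.seen u = true → ∀ e w, e ∈ es → G.Joins e u w → ¬ T.seen w = true)
    (hr : ¬ T.seen r = true) {N : ℕ} (hN : ∀ T l, TreeOrder G es T r l → l.length ≤ N) :
    IsBfsTree G es (fun v => T.seen v = true) r (bfs (adjList G es) N T r).val.1
      (bfs (adjList G es) N T r).val.2 ∧
    (bfs (adjList G es) N T r).time ≤
      1 + ((bfs (adjList G es) N T r).val.2.map fun v => 2 + degIn G es v).sum := by
  have := bfsLoop_spec (G := G) (es := es) (S := fun v => T.seen v = true) (r := r) hS hN N
    (T := T.addRoot r) (lay := [r]) (done := []) (L := 0) (by simp) (TreeOrder.addRoot T)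
    (by
      intro v
      by_cases hv : v = r
      · subst hv; simp [Forest.addRoot]
      · simp [Forest.addRoot, hv])
    (by simpa using hr) (by simp [Forest.addRoot]) (by simp [Forest.addRoot]) (by simp)
  simpa [bfs] using this

end Bfs

/-! ### Connected components -/

theorem List.eq_of_mem_of_pairwise_disjoint {α β : Type} {l : List α} {f : α → List β}
    (h : l.Pairwise fun c d => List.Disjoint (f c) (f d)) {c d : α} (hc : c ∈ l) (hd : d ∈ l)
    {x : β} (hxc : x ∈ f c) (hxd : x ∈ f d) : c = d := by
  induction h with
  | nil => simp at hc
  | cons ha _ ih =>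
    rcases List.mem_cons.1 hc with rfl | hc' <;> rcases List.mem_cons.1 hd with rfl | hd'
    · rfl
    · exact absurd hxd (ha _ hd' hxc)
    · exact absurd hxc (ha _ hc' hxd)
    · exact ih hc' hd'

theorem List.sum_map_flatMap {α β : Type} (l : List α) (f : α → List β) (g : β → ℕ) :
    ((l.flatMap f).map g).sum = (l.map fun a => ((f a).map g).sum).sum := by
  induction l with
  | nil => simp
  | cons a l ih => simp [ih]

section Components

variable {n m : ℕ}

/-- `comps` lists the connected components of the graph with all vertices and the edges `es`. -/
structure IsComponents (G : MGraph n m) (es : List (Fin m))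
    (comps : List (List (Fin n) × List (Fin m))) : Prop where
  nodup : ∀ c ∈ comps, c.1.Nodup
  disjoint : comps.Pairwise fun c d => List.Disjoint c.1 d.1
  cover : ∀ v, ∃ c ∈ comps, v ∈ c.1
  tree : ∀ c ∈ comps, ∃ T r, TreeOrder G es T r c.1
  closed : ∀ c ∈ comps, ∀ u ∈ c.1, ∀ e w, e ∈ es → G.Joins e u w → w ∈ c.1
  mem_edges : ∀ c ∈ comps, ∀ e, e ∈ c.2 ↔ e ∈ es ∧ (G e).1 ∈ c.1
  edges_nodup : ∀ c ∈ comps, c.2.Nodup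

namespace IsComponents

variable {G : MGraph n m} {es : List (Fin m)} {comps : List (List (Fin n) × List (Fin m))}

theorem ne_nil (h : IsComponents G es comps) {c : List (Fin n) × List (Fin m)} (hc : c ∈ comps) :
    c.1 ≠ [] := by
  obtain ⟨T, r, hT⟩ := h.tree c hc
  exact List.ne_nil_of_mem hT.root_mem

theorem sum_length_vertices (h : IsComponents G es comps) :
    (comps.map fun c => c.1.length).sum = n := by
  have h1 : (comps.flatMap Prod.fst).Nodup := List.nodup_flatMap.2 ⟨h.nodup, h.disjoint⟩
  rw [← List.length_flatMap, ← List.toFinset_card_of_nodup h1]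
  have : (comps.flatMap Prod.fst).toFinset = Finset.univ := by
    ext v
    simpa using h.cover v
  rw [this]; simp

theorem sum_length_edges (h : IsComponents G es comps) (hes : es.Nodup) :
    (comps.map fun c => c.2.length).sum = es.length := by
  have h1 : (comps.flatMap Prod.snd).Nodup := by
    refine List.nodup_flatMap.2 ⟨h.edges_nodup, ?_⟩
    refine h.disjoint.imp_of_mem ?_
    intro c d hc hd hcd e h1 h2
    exact hcd ((h.mem_edges c hc e).1 h1).2 ((h.mem_edges d hd e).1 h2).2
  rw [← List.length_flatMap, ← List.toFinset_card_of_nodup h1, ← List.toFinset_card_of_nodup hes]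
  congr 1
  ext e
  simp only [List.mem_toFinset, List.mem_flatMap]
  constructor
  · rintro ⟨c, hc, he⟩
    exact ((h.mem_edges c hc e).1 he).1
  · intro he
    obtain ⟨c, hc, hv⟩ := h.cover (G e).1
    exact ⟨c, hc, (h.mem_edges c hc e).2 ⟨he, hv⟩⟩

theorem snd_mem (h : IsComponents G es comps) {c : List (Fin n) × List (Fin m)} (hc : c ∈ comps)
    {e : Fin m} (he : e ∈ c.2) : (G e).1 ∈ c.1 ∧ (G e).2 ∈ c.1 := by
  obtain ⟨h1, h2⟩ := (h.mem_edges c hc e).1 he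
  exact ⟨h2, h.closed c hc _ h2 e _ h1 (G.joins_self e)⟩

theorem mem_of_joins (h : IsComponents G es comps) {c : List (Fin n) × List (Fin m)}
    (hc : c ∈ comps) {e : Fin m} (he : e ∈ es) {u w : Fin n} (hu : u ∈ c.1)
    (hj : G.Joins e u w) : e ∈ c.2 := by
  refine (h.mem_edges c hc e).2 ⟨he, ?_⟩
  have hw := h.closed c hc u hu e w he hj
  rcases hj with hj | hj <;> rw [hj] <;> assumption

end IsComponents

theorem foldl_bucket {α β : Type} [DecidableEq β] (f : α → β) (l : List α) (b : β → List α) :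
    l.foldl (fun b a => Function.update b (f a) (a :: b (f a))) b
      = fun x => (l.filter fun a => decide (f a = x)).reverse ++ b x := by
  induction l generalizing b with
  | nil => simp
  | cons a l ih =>
    rw [List.foldl_cons, ih]
    funext x
    by_cases h : f a = x
    · subst h; simp
    · simp [h, Function.update_of_ne (Ne.symm h)]

theorem foldl_update_const {α β : Type} [DecidableEq α] (l : List α) (c : β) (b : α → β) :
    l.foldl (fun b a => Function.update b a c) b = fun x => if x ∈ l then c else b x := by
  induction l generalizing b with
  | nil => simp
  | cons a l ih =>
    rw [List.foldl_cons, ih]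
    funext x
    by_cases h : x = a
    · subst h; simp
    · simp [h]

theorem foldl_cons_map {α β : Type} (f : α → β) (l : List α) (acc : List β) :
    l.foldl (fun acc a => f a :: acc) acc = (l.map f).reverse ++ acc := by
  induction l generalizing acc with
  | nil => simp
  | cons a l ih => simp [ih]

/-- Earlier searches produced sets closed under adjacency, so a new search stays among new vertices
and the components are disjoint. They have distinct roots, hence the bucket of a root holds exactly
the edges of its component. A vertex pays `2 + degree` for the search, one unit for writing its
root, and one towards the start of its search. -/
theorem components_spec (G : MGraph n m) {es : List (Fin m)} (hes : es.Nodup) :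
    IsComponents G es (components G es).val ∧
      (components G es).time ≤ 11 * n + 4 * es.length := by
  set F : Forest n m × (Fin n → Fin n) × List (Fin n × List (Fin n)) → Fin n →
      Timed (Forest n m × (Fin n → Fin n) × List (Fin n × List (Fin n))) := fun s v =>
      if s.1.seen v then pure s
      else do
        let t ← bfs (adjList G es) n s.1 v
        let root ← Timed.fold (fun root w => pure (Function.update root w v)) s.2.1 t.2
        return (t.1, root, (v, t.2) :: s.2.2) with hF
  have key := Timed.fold_induction (f := F) (b := (Forest.empty, fun v => v, []))
    (l := List.finRange n)
    (fun d s t =>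
      (∀ c ∈ s.2.2, (∃ T, TreeOrder G es T c.1 c.2) ∧
        (∀ u ∈ c.2, ∀ e w, e ∈ es → G.Joins e u w → w ∈ c.2) ∧ ∀ w ∈ c.2, s.2.1 w = c.1) ∧
      (∀ v, s.1.seen v = true ↔ ∃ c ∈ s.2.2, v ∈ c.2) ∧
      (s.2.2.Pairwise fun c c' => List.Disjoint c.2 c'.2) ∧
      (∀ v ∈ d, s.1.seen v = true) ∧
      t ≤ d.length + (s.2.2.map fun c => (c.2.map fun v => 4 + degIn G es v).sum).sum)
    ⟨by simp, by simp [Forest.empty], by simp, by simp, by simp⟩ (by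
      rintro d v rest ⟨T, root, cs⟩ t hl ⟨h1, h2, h3, h4, h5⟩
      simp only at h1 h2 h3 h4 h5
      by_cases hv : T.seen v = true
      · refine ⟨?_, ?_, ?_, ?_, ?_⟩ <;> simp only [hF, hv, if_true, Timed.pure_val,
          Timed.pure_time]
        · exact h1
        · exact h2
        · exact h3
        · intro w hw
          rcases List.mem_append.1 hw with hw | hw
          · exact h4 w hw
          · simp at hw; subst hw; exact hv
        · simp only [List.length_append, List.length_singleton]; omega
      · obtain ⟨hb, ht⟩ := bfs_spec (G := G) (es := es) (r := v) (T := T) (N := n) (by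
          intro u hu e w he hj hw
          obtain ⟨c, hc, hwc⟩ := (h2 w).1 hw
          exact hu ((h2 u).2 ⟨c, hc, (h1 c hc).2.1 w hwc e u he hj.symm⟩)) hv (by
          intro T l hl
          simpa using hl.nodup.length_le_card)
        have hv' : T.seen v = false := by simpa using hv
        set b := bfs (adjList G es) n T v with hbdef
        have hdis : ∀ c ∈ cs, List.Disjoint b.val.2 c.2 := by
          intro c hc u hu huc
          exact hb.notMem u hu ((h2 u).2 ⟨c, hc, huc⟩)
        refine ⟨?_, ?_, ?_, ?_, ?_⟩ <;> simp only [hF, hv', Timed.bind_val, Timed.bind_time,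
          Timed.pure_val, Timed.pure_time, Timed.fold_val, ← hbdef, foldl_update_const,
          Timed.fold_pure_time, Bool.false_eq_true, if_false]
        · intro c hc
          rcases List.mem_cons.1 hc with rfl | hc
          · refine ⟨⟨_, hb.tree⟩, fun u hu e w he hj => (hb.closed u hu e w he hj).1, ?_⟩
            intro w hw
            exact if_pos hw
          · refine ⟨(h1 c hc).1, (h1 c hc).2.1, fun w hw => ?_⟩
            rw [if_neg (fun hw' => hdis c hc hw' hw)]
            exact (h1 c hc).2.2 w hw
        · intro w
          rw [hb.seen w, h2 w]
          simp
        · exact List.pairwise_cons.2 ⟨fun c hc => hdis c hc, h3⟩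
        · intro w hw
          rw [hb.seen w]
          rcases List.mem_append.1 hw with hw | hw
          · exact Or.inr (h4 w hw)
          · simp at hw; subst hw; exact Or.inl hb.tree.root_mem
        · have h6 : (b.val.2.map fun v => 4 + degIn G es v).sum =
              2 * b.val.2.length + (b.val.2.map fun v => 2 + degIn G es v).sum := by
            generalize b.val.2 = l
            induction l with
            | nil => simp
            | cons a l ih => simp only [List.map_cons, List.sum_cons, ih, List.length_cons]; omega
          have h7 : 1 ≤ b.val.2.length := List.length_pos_of_mem hb.tree.root_mem
          simp only [List.map_cons, List.sum_cons, List.length_append, List.length_cons,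
            List.length_nil]
          omega)
  obtain ⟨h1, h2, h3, h4, h5⟩ := key
  have hval : (components G es).val = ((Timed.fold F (Forest.empty, fun v => v, [])
      (List.finRange n)).val.2.2.map fun c => (c.2, (es.filter fun e =>
        decide ((Timed.fold F (Forest.empty, fun v => v, [])
          (List.finRange n)).val.2.1 (G e).1 = c.1)).reverse)).reverse := by
    simp only [components, buildAdj_val, Timed.bind_val, Timed.tabulate_val, Timed.fold_val _ _ es,
      Timed.pure_val, ← hF]
    rw [foldl_bucket (fun e => (Timed.fold F (Forest.empty, fun v => v, [])
          (List.finRange n)).val.2.1 (G e).1)]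
    rw [Timed.fold_val]
    simp only [Timed.pure_val, foldl_cons_map]
    simp
  have htime : (components G es).time = 4 * n + 2 * es.length + (Timed.fold F (Forest.empty,
      fun v => v, []) (List.finRange n)).time + (Timed.fold F (Forest.empty, fun v => v, [])
      (List.finRange n)).val.2.2.length := by
    simp only [components, buildAdj_val, buildAdj_time, Timed.bind_time,
      Timed.tabulate_val, Timed.tabulate_time, Timed.fold_pure_time, ← hF, List.length_finRange]
    omega
  set s := Timed.fold F (Forest.empty, fun v => v, []) (List.finRange n) with hs
  have hcomp : IsComponents G es (components G es).val := by
    rw [hval]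
    refine ⟨?_, ?_, ?_, ?_, ?_, ?_, ?_⟩
    · intro c hc
      simp only [List.mem_reverse, List.mem_map] at hc
      obtain ⟨c', hc', rfl⟩ := hc
      obtain ⟨⟨T, hT⟩, -⟩ := h1 c' hc'
      exact hT.nodup
    · rw [List.pairwise_reverse, List.pairwise_map]
      exact h3.imp fun h => h.symm
    · intro v
      obtain ⟨c, hc, hv⟩ := (h2 v).1 (h4 v (by simp))
      exact ⟨_, List.mem_reverse.2 (List.mem_map_of_mem hc), hv⟩
    · intro c hc
      simp only [List.mem_reverse, List.mem_map] at hc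
      obtain ⟨c', hc', rfl⟩ := hc
      obtain ⟨⟨T, hT⟩, -⟩ := h1 c' hc'
      exact ⟨T, _, hT⟩
    · intro c hc
      simp only [List.mem_reverse, List.mem_map] at hc
      obtain ⟨c', hc', rfl⟩ := hc
      exact (h1 c' hc').2.1
    · intro c hc e
      simp only [List.mem_reverse, List.mem_map] at hc
      obtain ⟨c', hc', rfl⟩ := hc
      simp only [List.mem_reverse, List.mem_filter, decide_eq_true_eq]
      refine and_congr_right fun he => ⟨fun hr => ?_, fun hr => (h1 c' hc').2.2 _ hr⟩
      obtain ⟨c'', hc'', hv⟩ := (h2 (G e).1).1 (h4 (G e).1 (by simp))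
      have h6 := (h1 c'' hc'').2.2 _ hv
      rw [hr] at h6
      by_cases hcc : c' = c''
      · rw [hcc]; exact hv
      · exfalso
        obtain ⟨⟨T, hT⟩, -⟩ := h1 c' hc'
        obtain ⟨⟨T'', hT''⟩, -⟩ := h1 c'' hc''
        rw [← h6] at hT''
        exact hcc (List.eq_of_mem_of_pairwise_disjoint h3 hc' hc'' hT.root_mem hT''.root_mem)
    · intro c hc
      simp only [List.mem_reverse, List.mem_map] at hc
      obtain ⟨c', hc', rfl⟩ := hc
      exact List.nodup_reverse.2 (hes.filter _)
  refine ⟨hcomp, ?_⟩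
  rw [htime]
  have hnd : (s.val.2.2.flatMap Prod.snd).Nodup :=
    List.nodup_flatMap.2 ⟨fun c hc => by obtain ⟨⟨T, hT⟩, -⟩ := h1 c hc; exact hT.nodup, h3⟩
  have hlen : s.val.2.2.length ≤ n := by
    have h6 : s.val.2.2.length ≤ (s.val.2.2.flatMap Prod.snd).length := by
      rw [List.length_flatMap]
      have : ∀ l : List (Fin n × List (Fin n)), (∀ c ∈ l, c.2 ≠ []) →
          l.length ≤ (l.map fun c => c.2.length).sum := by
        intro l
        induction l with
        | nil => simp
        | cons a l ih =>
          intro h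
          have h7 := ih fun c hc => h c (by simp [hc])
          have h8 := List.length_pos_iff.2 (h a (by simp))
          simp only [List.map_cons, List.sum_cons, List.length_cons]; omega
      refine this _ fun c hc => ?_
      obtain ⟨⟨T, hT⟩, -⟩ := h1 c hc
      exact List.ne_nil_of_mem hT.root_mem
    have h7 := hnd.length_le_card
    rw [Fintype.card_fin] at h7
    omega
  have hsum : (s.val.2.2.map fun c => (c.2.map fun v => 4 + degIn G es v).sum).sum ≤
      4 * n + 2 * es.length := by
    rw [← List.sum_map_flatMap]
    refine (List.sum_map_le_sum_univ _ hnd).trans ?_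
    rw [Finset.sum_add_distrib, sum_degIn]
    simp [mul_comm]
  rw [List.length_finRange] at h5
  omega

end Components

/-! ### Splitting a tree -/

section Split

variable {n m : ℕ}

/-- One step of the upward pass of `treeSplit`. -/
def upStep (tsq : ℕ) (T : Forest n m) (s : (Fin n → ℕ) × (Fin n → Bool)) (v : Fin n) :
    (Fin n → ℕ) × (Fin n → Bool) :=
  if tsq ≤ s.1 v * s.1 v then (s.1, Function.update s.2 v true)
  else
    match T.par v with
    | none => s
    | some (p, _) => (Function.update s.1 p (s.1 p + s.1 v), s.2)

/-- One step of the downward pass of `treeSplit`. -/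
def downStep (T : Forest n m) (cut : Fin n → Bool) (q : ((Fin n → ℕ) × (Fin n → Bool) × ℕ) × Bool)
    (v : Fin n) : ((Fin n → ℕ) × (Fin n → Bool) × ℕ) × Bool :=
  match T.par v with
  | none => ((Function.update q.1.1 v q.1.2.2, Function.update q.1.2.1 v true, q.1.2.2 + 1),
      !cut v)
  | some (p, _) =>
    if cut v && !q.2 then
      ((Function.update q.1.1 v q.1.2.2, Function.update q.1.2.1 v true, q.1.2.2 + 1), q.2)
    else
      ((Function.update q.1.1 v (q.1.1 p), q.1.2.1, q.1.2.2), q.2 && !cut v)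

theorem treeSplit_eq (tsq : ℕ) (T : Forest n m) (rev : List (Fin n)) (c : Fin n → ℕ) :
    (treeSplit tsq T rev c).val = (rev.reverse.foldl (downStep T
      (rev.foldl (upStep tsq T) (c, fun _ => false)).2) ((fun _ => 0, fun _ => false, 0), false)).1 ∧
    (treeSplit tsq T rev c).time = 7 * rev.length := by
  have hup : Timed.fold (fun (s : (Fin n → ℕ) × (Fin n → Bool)) v =>
    let x := s.1 v
    if tsq ≤ x * x then (pure (s.1, Function.update s.2 v true) : Timed _)
    else
      match T.par v with
      | none => pure s
      | some (p, _) => pure (Function.update s.1 p (s.1 p + x), s.2)) (c, fun _ => false) rev =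
    Timed.fold (fun s v => pure (upStep tsq T s v)) (c, fun _ => false) rev := by
    congr 1
    funext s v
    simp only [upStep]
    split_ifs
    · rfl
    · cases T.par v <;> rfl
  have hdown : ∀ cut : Fin n → Bool,
      Timed.fold (fun (q : ((Fin n → ℕ) × (Fin n → Bool) × ℕ) × Bool) v =>
    let (label, top, k) := q.1
    match T.par v with
    | none => (pure ((Function.update label v k, Function.update top v true, k + 1), !cut v) :
        Timed _)
    | some (p, _) =>
      if cut v && !q.2 then
        pure ((Function.update label v k, Function.update top v true, k + 1), q.2)
      else
        pure ((Function.update label v (label p), top, k), q.2 && !cut v))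
    ((fun _ => 0, fun _ => false, 0), false) rev.reverse =
    Timed.fold (fun q v => pure (downStep T cut q v)) ((fun _ => 0, fun _ => false, 0), false)
      rev.reverse := by
    intro cut
    congr 1
    funext q v
    simp only [downStep]
    cases T.par v with
    | none => rfl
    | some x =>
      simp only
      split_ifs <;> rfl

  constructor
  · rw [treeSplit]
    simp only [Timed.bind_val, Timed.tabulate_val]
    erw [hup, hdown]
    simp
  · rw [treeSplit]
    simp only [Timed.bind_time, Timed.tabulate_val, Timed.tabulate_time,
      Timed.tick_time]
    erw [hup, hdown]
    simp
    omega

/-- Children come before parents, so the value of a vertex is final when the vertex is visited, and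
only uncut vertices have passed theirs on. The final array thus satisfies a recursion over the tree,
and the cuts are read off from the final values. -/
theorem upward_spec {G : MGraph n m} {es : List (Fin m)} {T : Forest n m} {r : Fin n}
    {rev : List (Fin n)} (h : TreeOrder G es T r rev) (tsq : ℕ) (c : Fin n → ℕ) :
    (∀ v ∈ rev, (rev.foldl (upStep tsq T) (c, fun _ => false)).2 v = true ↔
      tsq ≤ (rev.foldl (upStep tsq T) (c, fun _ => false)).1 v *
        (rev.foldl (upStep tsq T) (c, fun _ => false)).1 v) ∧
    ∀ u, (rev.foldl (upStep tsq T) (c, fun _ => false)).1 u = c u + (rev.map fun w =>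
      if (T.par w).map Prod.fst = some u ∧
        (rev.foldl (upStep tsq T) (c, fun _ => false)).2 w = false then
        (rev.foldl (upStep tsq T) (c, fun _ => false)).1 w else 0).sum := by
  have key := List.foldl_induction (f := upStep tsq T) (b := (c, fun _ => false)) (l := rev)
    (fun d s => (∀ v ∈ d, s.2 v = true ↔ tsq ≤ s.1 v * s.1 v) ∧ (∀ v, v ∉ d → s.2 v = false) ∧
      ∀ u, s.1 u = c u + (d.map fun w =>
        if (T.par w).map Prod.fst = some u ∧ s.2 w = false then s.1 w else 0).sum)
    (by simp) (by
      rintro d v rest ⟨ext, cut⟩ hl ⟨h1, h2, h3⟩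
      simp only at h1 h2 h3
      have hnd := h.nodup
      rw [hl] at hnd
      have hvd : v ∉ d := fun hv => by
        rw [List.nodup_append] at hnd
        exact hnd.2.2 v hv v (by simp) rfl
      have hne : ∀ w ∈ d, w ≠ v := fun w hw hwv => hvd (hwv ▸ hw)
      by_cases hc : tsq ≤ ext v * ext v
      · simp only [upStep, hc, if_true]
        refine ⟨?_, ?_, ?_⟩
        · intro w hw
          rcases List.mem_append.1 hw with hw | hw
          · rw [Function.update_of_ne (hne w hw)]; exact h1 w hw
          · simp at hw; subst hw; simp [hc]
        · intro w hw
          simp at hw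
          rw [Function.update_of_ne hw.2]; exact h2 w hw.1
        · intro u
          rw [h3 u, List.map_append, List.sum_append]
          simp only [List.map_cons, List.map_nil, List.sum_cons, List.sum_nil,
            Function.update_self]
          simp only [Bool.true_eq_false, and_false, if_false, add_zero]
          congr 2
          refine List.map_congr_left fun w hw => ?_
          rw [Function.update_of_ne (hne w hw)]
      · cases hp : T.par v with
        | none =>
          simp only [upStep, hc, if_false, hp]
          refine ⟨?_, ?_, ?_⟩
          · intro w hw
            rcases List.mem_append.1 hw with hw | hw
            · exact h1 w hw
            · simp at hw; subst hw; simp [hc, h2 w hvd]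
          · intro w hw
            simp at hw
            exact h2 w hw.1
          · intro u
            rw [List.map_append, List.sum_append, ← add_assoc, ← h3 u]
            simp [hp]
        | some x =>
          obtain ⟨p, e⟩ := x
          have hpr := h.par_mem_of_split hl hp
          have hpd : p ∉ d := fun hpd => by
            rw [List.nodup_append] at hnd
            exact hnd.2.2 p hpd p (by simp [hpr]) rfl
          have hpv : v ≠ p := fun hpv => by
            rw [List.nodup_append] at hnd
            exact (List.nodup_cons.1 hnd.2.1).1 (hpv ▸ hpr)
          have hnep : ∀ w ∈ d, w ≠ p := fun w hw hwv => hpd (hwv ▸ hw)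
          simp only [upStep, hc, if_false, hp]
          refine ⟨?_, ?_, ?_⟩
          · intro w hw
            rcases List.mem_append.1 hw with hw | hw
            · rw [Function.update_of_ne (hnep w hw)]
              exact h1 w hw
            · simp at hw; subst hw; simp [hc, h2 w hvd, Function.update_of_ne hpv]
          · intro w hw
            simp at hw
            exact h2 w hw.1
          · intro u
            have h4 : (d.map fun w => if (T.par w).map Prod.fst = some u ∧ cut w = false then
                (Function.update ext p (ext p + ext v)) w else 0) = d.map fun w =>
                if (T.par w).map Prod.fst = some u ∧ cut w = false then ext w else 0 := by
              refine List.map_congr_left fun w hw => ?_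
              rw [Function.update_of_ne (hnep w hw)]
            rw [List.map_append, List.sum_append, ← add_assoc, h4, ← h3 u]
            by_cases hpu : p = u
            · subst hpu
              simp [hp, h2 v hvd, Function.update_of_ne hpv]
            · simp [hp, Function.update_of_ne (Ne.symm hpu), hpu])
  exact ⟨key.1, key.2.2⟩

/-- The outcome of the downward pass of `treeSplit` for the cuts `cut`. -/
structure IsLabelling (T : Forest n m) (r : Fin n) (cut : Fin n → Bool) (d : List (Fin n))
    (label : Fin n → ℕ) (top : Fin n → Bool) (k : ℕ) : Prop where
  lt : ∀ v ∈ d, label v < k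
  top_inj : ∀ v ∈ d, ∀ w ∈ d, top v = true → top w = true → label v = label w → v = w
  par : ∀ v ∈ d, top v = false → ∃ p e, T.par v = some (p, e) ∧ p ∈ d ∧ label v = label p
  cut_of_top : ∀ v ∈ d, top v = true → cut v = true ∨ v = r
  merged : ∃ z, ∀ w ∈ d, cut w = true ∨ w = r → top w = true ∨ w = z

/-- While the flag is up, the part of the root is the only part and no other vertex met so far is
cut. The first cut vertex met then stays in the part of its parent and lowers the flag; it is the
exception in `merged`. Once the flag is down, every part contains a cut vertex. If it stays up there
is only one part, hence the condition `2 ≤ k`. -/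
theorem downward_spec {G : MGraph n m} {es : List (Fin m)} {T : Forest n m} {r : Fin n}
    {rev : List (Fin n)} (h : TreeOrder G es T r rev) (cut : Fin n → Bool) :
    ∃ label top k flag, rev.reverse.foldl (downStep T cut) ((fun _ => 0, fun _ => false, 0), false)
      = ((label, top, k), flag) ∧ IsLabelling T r cut rev label top k ∧
      (2 ≤ k → ∀ i < k, ∃ v ∈ rev, cut v = true ∧ label v = i) := by
  have key := List.foldl_induction (f := downStep T cut)
    (b := ((fun _ => 0, fun _ => false, 0), false)) (l := rev.reverse)
    (fun d s => ∃ label top k flag, s = ((label, top, k), flag) ∧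
      IsLabelling T r cut d label top k ∧ (∀ v, v ∉ d → top v = false) ∧ (d ≠ [] → r ∈ d) ∧
      (d = [] → k = 0) ∧ (flag = true → k = 1 ∧ ∀ w ∈ d, w ≠ r → cut w = false) ∧
      (flag = false → ∀ i < k, ∃ v ∈ d, cut v = true ∧ label v = i))
    ⟨_, _, _, _, rfl, ⟨by simp, by simp, by simp, by simp, ⟨r, by simp⟩⟩, by simp, by simp,
      by simp, by simp, by simp⟩ (by
      rintro d v rest s hl ⟨label, top, k, flag, rfl, ⟨h1, h2, h3, h4, z, h5⟩, h6, h7, h8, h9, h10⟩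
      have hl' : rev = rest.reverse ++ v :: d.reverse := by
        have := congrArg List.reverse hl
        simpa using this
      have hvr : v ∈ rev := by rw [hl']; simp
      have hnd := h.nodup
      rw [hl'] at hnd
      have hvd : v ∉ d := fun hv => by
        rw [List.nodup_append] at hnd
        exact (List.nodup_cons.1 hnd.2.1).1 (by simpa using hv)
      have hne : ∀ w ∈ d, w ≠ v := fun w hw hwv => hvd (hwv ▸ hw)
      have htr : r ∈ d → top r = true := fun hr => by
        by_contra ht
        obtain ⟨p, e, hp, -⟩ := h3 r hr (by simpa using ht)
        rw [h.root_spec.1] at hp; simp at hp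
      cases hp : T.par v with
      | none =>
        have hv : v = r := h.eq_root_of_par_eq_none hvr hp
        subst hv
        have hd : d = [] := by
          by_contra hd; exact hvd (h7 hd)
        subst hd
        have hk := h8 rfl
        subst hk
        refine ⟨_, _, _, _, by simp only [downStep, hp]; rfl, ⟨?_, ?_, ?_, ?_, ?_⟩, ?_, ?_, ?_, ?_, ?_⟩
        · simp
        · simp
        · simp
        · simp
        · exact ⟨v, by simp⟩
        · intro w hw
          simp at hw
          rw [Function.update_of_ne hw]; exact h6 w (by simp)
        · simp
        · simp
        · intro _; simp
        · intro hc i hi; simp at hc hi; simp [hc, hi]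
      | some x =>
        obtain ⟨p, e⟩ := x
        have hpd : p ∈ d := by simpa using h.par_mem_of_split hl' hp
        have hvr' : v ≠ r := (h.of_par hvr hp).1
        have hdn : d ≠ [] := List.ne_nil_of_mem hpd
        by_cases hc : (cut v && !flag) = true
        · have hc' := hc
          rw [Bool.and_eq_true, Bool.not_eq_true'] at hc'
          obtain ⟨hcv, hfl⟩ := hc'
          refine ⟨_, _, _, _, by simp only [downStep, hp, hc, if_true]; rfl, ⟨?_, ?_, ?_, ?_, z, ?_⟩,
            ?_, ?_, ?_, ?_, ?_⟩
          · intro w hw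
            rcases List.mem_append.1 hw with hw | hw
            · rw [Function.update_of_ne (hne w hw)]; have := h1 w hw; omega
            · simp at hw; subst hw; simp
          · intro w hw w' hw'
            rcases List.mem_append.1 hw with hw1 | hw1 <;>
              rcases List.mem_append.1 hw' with hw2 | hw2
            · simp only [Function.update_of_ne (hne w hw1), Function.update_of_ne (hne w' hw2)]
              exact h2 w hw1 w' hw2
            · simp at hw2; subst hw2
              simp only [Function.update_of_ne (hne w hw1), Function.update_self]
              have := h1 w hw1; omega
            · simp at hw1; subst hw1
              simp only [Function.update_of_ne (hne w' hw2), Function.update_self]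
              have := h1 w' hw2; omega
            · simp at hw1 hw2; rw [hw1, hw2]; simp
          · intro w hw ht
            rcases List.mem_append.1 hw with hw | hw
            · rw [Function.update_of_ne (hne w hw)] at ht
              obtain ⟨p', e', g1, g2, g3⟩ := h3 w hw ht
              refine ⟨p', e', g1, by simp [g2], ?_⟩
              rw [Function.update_of_ne (hne w hw), Function.update_of_ne (hne p' g2), g3]
            · simp at hw; subst hw; simp at ht
          · intro w hw ht
            rcases List.mem_append.1 hw with hw | hw
            · rw [Function.update_of_ne (hne w hw)] at ht
              exact h4 w hw ht
            · simp at hw; subst hw; exact Or.inl hcv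
          · intro w hw ht
            rcases List.mem_append.1 hw with hw | hw
            · rw [Function.update_of_ne (hne w hw)]
              exact h5 w hw ht
            · simp at hw; subst hw; simp
          · intro w hw
            simp at hw
            rw [Function.update_of_ne hw.2]; exact h6 w hw.1
          · intro _; simp [h7 hdn]
          · simp
          · intro hf; rw [hfl] at hf; simp at hf
          · intro _ i hi
            by_cases hik : i < k
            · obtain ⟨w, hw, g1, g2⟩ := h10 hfl i hik
              exact ⟨w, by simp [hw], g1, by rw [Function.update_of_ne (hne w hw), g2]⟩
            · exact ⟨v, by simp, hcv, by rw [Function.update_self]; omega⟩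
        · refine ⟨_, _, _, _, by simp only [downStep, hp, hc]; rfl, ⟨?_, ?_, ?_, ?_, ?_⟩,
            ?_, ?_, ?_, ?_, ?_⟩
          · intro w hw
            rcases List.mem_append.1 hw with hw | hw
            · rw [Function.update_of_ne (hne w hw)]; exact h1 w hw
            · simp at hw; subst hw; simp [h1 p hpd]
          · intro w hw w' hw' ht ht'
            rcases List.mem_append.1 hw with hw | hw
            · rcases List.mem_append.1 hw' with hw' | hw'
              · simp only [Function.update_of_ne (hne w hw), Function.update_of_ne (hne w' hw')]
                exact h2 w hw w' hw' ht ht'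
              · simp at hw'; subst hw'; rw [h6 w' hvd] at ht'; simp at ht'
            · simp at hw; subst hw; rw [h6 w hvd] at ht; simp at ht
          · intro w hw ht
            rcases List.mem_append.1 hw with hw | hw
            · obtain ⟨p', e', g1, g2, g3⟩ := h3 w hw ht
              refine ⟨p', e', g1, by simp [g2], ?_⟩
              rw [Function.update_of_ne (hne w hw), Function.update_of_ne (hne p' g2), g3]
            · simp at hw; subst hw
              exact ⟨p, e, hp, by simp [hpd], by
                rw [Function.update_self, Function.update_of_ne (hne p hpd)]⟩
          · intro w hw ht
            rcases List.mem_append.1 hw with hw | hw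
            · exact h4 w hw ht
            · simp at hw; subst hw; rw [h6 w hvd] at ht; simp at ht
          -- A cut vertex that does not start a part was met with the flag up; no earlier vertex but
          -- the root can be cut then, so `v` is the only exception.
          · by_cases hcv : cut v = true
            · have hfl : flag = true := by simpa [hcv] using hc
              refine ⟨v, fun w hw hor => ?_⟩
              rcases List.mem_append.1 hw with hw | hw
              · by_cases hwr : w = r
                · subst hwr; exact Or.inl (htr hw)
                · rw [(h9 hfl).2 w hw hwr] at hor; simp [hwr] at hor
              · simp at hw; exact Or.inr hw
            · refine ⟨z, fun w hw hor => ?_⟩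
              rcases List.mem_append.1 hw with hw | hw
              · exact h5 w hw hor
              · simp at hw; subst hw; simp [hcv, hvr'] at hor
          · intro w hw
            simp at hw
            exact h6 w hw.1
          · intro _; simp [h7 hdn]
          · simp
          · intro hf
            rw [Bool.and_eq_true, Bool.not_eq_true'] at hf
            refine ⟨(h9 hf.1).1, fun w hw hwr => ?_⟩
            rcases List.mem_append.1 hw with hw | hw
            · exact (h9 hf.1).2 w hw hwr
            · simp at hw; subst hw; exact hf.2
          · intro hf i hi
            by_cases hfl : flag = true
            · have hcv : cut v = true := by simpa [hfl] using hf
              have hk := (h9 hfl).1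
              refine ⟨v, by simp, hcv, ?_⟩
              have := h1 p hpd
              rw [Function.update_self]; omega
            · obtain ⟨w, hw, g1, g2⟩ := h10 (by simpa using hfl) i hi
              exact ⟨w, by simp [hw], g1, by rw [Function.update_of_ne (hne w hw), g2]⟩)
  obtain ⟨label, top, k, flag, h0, ⟨h1, h2, h3, h4, z, h5⟩, h6, h7, h8, h9, h10⟩ := key
  simp only [List.mem_reverse] at *
  refine ⟨label, top, k, flag, h0, ⟨h1, h2, h3, h4, z, h5⟩, fun hk => h10 ?_⟩
  by_contra hf
  have := (h9 (by simpa using hf)).1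
  omega

/-- The edges to the parent inject the children of `u` into the edges at `u`: two different children
on one edge would make `u` its own child, against the depths. -/
theorem card_children_le {G : MGraph n m} {es : List (Fin m)} {T : Forest n m} {r : Fin n}
    {rev : List (Fin n)} (h : TreeOrder G es T r rev) (u : Fin n) :
    (rev.toFinset.filter fun w => (T.par w).map Prod.fst = some u).card ≤ degIn G es u := by
  have hpar : ∀ w ∈ rev.toFinset.filter fun w => (T.par w).map Prod.fst = some u,
      ∃ e, T.par w = some (u, e) ∧ w ∈ rev := by
    intro w hw
    simp only [Finset.mem_filter, List.mem_toFinset] at hw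
    cases hp : T.par w with
    | none => simp [hp] at hw
    | some x =>
      obtain ⟨p, e⟩ := x
      simp [hp] at hw
      exact ⟨e, by rw [hw.2], hw.1⟩
  have h1 : (rev.toFinset.filter fun w => (T.par w).map Prod.fst = some u).card ≤
      ((es.toFinset.filter fun e => (G e).1 = u ∨ (G e).2 = u).image some).card := by
    refine Finset.card_le_card_of_injOn (fun w => (T.par w).map Prod.snd) ?_ ?_
    · intro w hw
      obtain ⟨e, he, hwr⟩ := hpar w hw
      obtain ⟨-, -, h2, h3, -⟩ := h.of_par hwr he
      have h4 : (G e).1 = u ∨ (G e).2 = u := by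
        rcases h3 with h3 | h3 <;> simp [h3]
      simpa [he] using ⟨h2, h4⟩
    · intro w hw w' hw' heq
      obtain ⟨e, he, hwr⟩ := hpar w hw
      obtain ⟨e', he', hwr'⟩ := hpar w' hw'
      simp [he, he'] at heq
      subst heq
      obtain ⟨-, -, h2, h3, h4⟩ := h.of_par hwr he
      obtain ⟨-, -, h2', h3', h4'⟩ := h.of_par hwr' he'
      rcases h3.cases_eq h3' with h5 | h5
      · exact h5.2
      · rw [h5.2] at h4; omega
  refine h1.trans (Finset.card_image_le.trans ?_)
  rw [Finset.card_filter, degIn]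
  calc ∑ e ∈ es.toFinset, (if (G e).1 = u ∨ (G e).2 = u then 1 else 0)
      ≤ ∑ e ∈ es.toFinset, ((if (G e).1 = u then 1 else 0) + (if (G e).2 = u then 1 else 0)) := by
        refine Finset.sum_le_sum fun e _ => ?_
        split_ifs <;> simp_all
    _ = (es.dedup.map fun e => (if (G e).1 = u then 1 else 0) +
          (if (G e).2 = u then 1 else 0)).sum := by
        rw [← List.sum_toFinset _ es.nodup_dedup]; congr 1; ext; simp
    _ ≤ _ := (es.dedup_sublist.map _).sum_le_sum (by simp)

/-- The parts of a tree that `treeSplit` returns. -/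
structure IsSplit (T : Forest n m) (rev : List (Fin n)) (c : Fin n → ℕ) (tsq : ℕ)
    (label : Fin n → ℕ) (top : Fin n → Bool) (k : ℕ) : Prop where
  lt : ∀ v ∈ rev, label v < k
  top_inj : ∀ v ∈ rev, ∀ w ∈ rev, top v = true → top w = true → label v = label w → v = w
  par : ∀ v ∈ rev, top v = false → ∃ p e, T.par v = some (p, e) ∧ p ∈ rev ∧ label v = label p
  large : 2 ≤ k → ∀ i < k, tsq ≤ (∑ v ∈ rev.toFinset with label v = i, c v) ^ 2
  small : ∀ t X, (∀ x, x * x < tsq → x ≤ t) → (∀ v ∈ rev, c v + t *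
    (rev.toFinset.filter fun w => (T.par w).map Prod.fst = some v).card ≤ X) →
    ∀ i, ∑ v ∈ rev.toFinset with label v = i, c v ≤ 2 * X
  nonempty : 2 ≤ k → ∀ i < k, ∃ v ∈ rev, label v = i

theorem treeSplit_spec {G : MGraph n m} {es : List (Fin m)} {T : Forest n m} {r : Fin n}
    {rev : List (Fin n)} (h : TreeOrder G es T r rev) (tsq : ℕ) (c : Fin n → ℕ) :
    IsSplit T rev c tsq (treeSplit tsq T rev c).val.1 (treeSplit tsq T rev c).val.2.1
      (treeSplit tsq T rev c).val.2.2 := by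
  rw [(treeSplit_eq tsq T rev c).1]
  obtain ⟨hcut, hext⟩ := upward_spec h tsq c
  set s := rev.foldl (upStep tsq T) (c, fun _ => false)
  obtain ⟨label, top, k, flag, h0, hlab, hlarge⟩ := downward_spec h s.2
  rw [h0]
  simp only
  have hext' : ∀ u, s.1 u = c u + ∑ w ∈ rev.toFinset,
      if (T.par w).map Prod.fst = some u ∧ s.2 w = false then s.1 w else 0 := by
    intro u
    rw [List.sum_toFinset _ h.nodup]
    exact hext u
  -- Sum the recursion of the upward pass over a part. An uncut vertex other than the root lies in
  -- the part of its parent, so its value appears on both sides and cancels. Only the values of cut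
  -- vertices and of the root remain.
  have hsum : ∀ i, ∑ v ∈ rev.toFinset with label v = i, c v =
      ∑ v ∈ rev.toFinset with label v = i ∧ (s.2 v = true ∨ v = r), s.1 v := by
    intro i
    have h1 : ∑ v ∈ rev.toFinset with label v = i, s.1 v =
        ∑ v ∈ rev.toFinset with label v = i, c v +
        ∑ v ∈ rev.toFinset with label v = i ∧ ¬ (s.2 v = true ∨ v = r), s.1 v := by
      rw [Finset.sum_congr rfl fun v _ => hext' v, Finset.sum_add_distrib, Finset.sum_comm]
      congr 1
      rw [Finset.sum_filter]
      refine Finset.sum_congr rfl fun w hw => ?_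
      rw [List.mem_toFinset] at hw
      by_cases hr : s.2 w = true ∨ w = r
      · rw [if_neg (by tauto)]
        refine Finset.sum_eq_zero fun v _ => if_neg ?_
        rintro ⟨hp, hc⟩
        rcases hr with hr | rfl
        · rw [hr] at hc; simp at hc
        · rw [h.root_spec.1] at hp; simp at hp
      · have htop : top w = false := by
          by_contra ht
          exact hr (hlab.cut_of_top w hw (by simpa using ht))
        obtain ⟨p, e, hp, hpr, hlp⟩ := hlab.par w hw htop
        have hcw : s.2 w = false := by
          by_contra hc; exact hr (Or.inl (by simpa using hc))
        by_cases hi : label w = i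
        · rw [if_pos ⟨hi, hr⟩, Finset.sum_eq_single p]
          · simp [hp, hcw]
          · intro v _ hvp
            simp [hp, Ne.symm hvp]
          · intro hn
            exfalso
            apply hn
            simp [hpr, ← hlp, hi]
        · rw [if_neg (by tauto)]
          refine Finset.sum_eq_zero fun v hv => if_neg ?_
          rintro ⟨hpv, -⟩
          simp [hp] at hpv
          subst hpv
          simp at hv
          exact hi (hlp.trans hv.2)
    have h2 : ∑ v ∈ rev.toFinset with label v = i, s.1 v =
        ∑ v ∈ rev.toFinset with label v = i ∧ (s.2 v = true ∨ v = r), s.1 v +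
        ∑ v ∈ rev.toFinset with label v = i ∧ ¬ (s.2 v = true ∨ v = r), s.1 v := by
      rw [← Finset.sum_filter_add_sum_filter_not _ (fun v => s.2 v = true ∨ v = r),
        Finset.filter_filter, Finset.filter_filter]
    omega
  refine ⟨hlab.lt, hlab.top_inj, hlab.par, ?_, ?_, ?_⟩
  -- The value of a single cut vertex already reaches the threshold.
  · intro hk i hi
    obtain ⟨v, hv, hcv, hvi⟩ := hlarge hk i hi
    rw [hsum i, sq]
    have h1 : s.1 v ≤ ∑ v ∈ rev.toFinset with label v = i ∧ (s.2 v = true ∨ v = r), s.1 v :=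
      Finset.single_le_sum (f := s.1) (fun _ _ => Nat.zero_le _) (by simp [hv, hcv, hvi])
    exact ((hcut v hv).1 hcv).trans (Nat.mul_le_mul h1 h1)
  · intro t X ht hX i
    -- A vertex collects its own label and, from each uncut child, a value below the threshold,
    -- hence at most `t`.
    have hle : ∀ v ∈ rev, s.1 v ≤ X := by
      intro v hv
      refine le_trans ?_ (hX v hv)
      rw [hext' v, ← Finset.sum_filter, mul_comm, ← smul_eq_mul]
      refine Nat.add_le_add_left ?_ _
      refine (Finset.sum_le_card_nsmul _ _ t ?_).trans ?_
      · intro w hw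
        simp only [Finset.mem_filter, List.mem_toFinset] at hw
        refine ht _ ?_
        by_contra hc
        have := (hcut w hw.1).2 (not_lt.1 hc)
        rw [hw.2.2] at this; simp at this
      · rw [smul_eq_mul, smul_eq_mul]
        refine Nat.mul_le_mul_right _ (Finset.card_le_card ?_)
        intro w hw
        simp only [Finset.mem_filter] at hw ⊢
        exact ⟨hw.1, hw.2.1⟩
    rw [hsum i]
    obtain ⟨z, hz⟩ := hlab.merged
    refine (Finset.sum_le_card_nsmul _ _ X ?_).trans ?_
    · intro v hv
      simp only [Finset.mem_filter, List.mem_toFinset] at hv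
      exact hle v hv.1
    · rw [smul_eq_mul]
      refine Nat.mul_le_mul_right _ ?_
      -- A part contains at most two cut vertices or roots: its top and the merged vertex `z`. This
      -- is the factor `2`.
      have hsub : (rev.toFinset.filter fun v => label v = i ∧ (s.2 v = true ∨ v = r)) ⊆
          insert z (rev.toFinset.filter fun v => label v = i ∧ top v = true) := by
        intro v hv
        simp only [Finset.mem_filter, List.mem_toFinset, Finset.mem_insert] at hv ⊢
        rcases hz v hv.1 hv.2.2 with h1 | h1
        · exact Or.inr ⟨hv.1, hv.2.1, h1⟩
        · exact Or.inl h1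
      refine (Finset.card_le_card hsub).trans ((Finset.card_insert_le _ _).trans ?_)
      have : (rev.toFinset.filter fun v => label v = i ∧ top v = true).card ≤ 1 := by
        rw [Finset.card_le_one]
        intro v hv w hw
        simp only [Finset.mem_filter, List.mem_toFinset] at hv hw
        exact hlab.top_inj v hv.1 w hw.1 hv.2.2 hw.2.2 (hv.2.1.trans hw.2.1.symm)
      omega
  · intro hk i hi
    obtain ⟨v, hv, -, hvi⟩ := hlarge hk i hi
    exact ⟨v, hv, hvi⟩

end Split

theorem Timed.bind_assoc {α β γ : Type} (x : Timed α) (f : α → Timed β) (g : β → Timed γ) :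
    (x >>= f) >>= g = x >>= fun a => f a >>= g := by
  change (⟨_, _⟩ : Timed γ) = ⟨_, _⟩
  congr 1
  change x.time + _ + _ = _
  rw [add_assoc]
  rfl

/-! ### The parts of OneRoundShortCycle -/

section Round

variable {n m : ℕ}

/-- The spanning tree that `oneRoundShortCycle` works with. -/
def spanningTree (G : MGraph n m) (vs : List (Fin n)) (es : List (Fin m)) (r : Fin n) :
    Timed (Forest n m × List (Fin n)) := do
  let adj ← buildAdj G vs es
  let T₀ ← Timed.tabulate vs.length (Forest.empty : Forest n m)
  let s ← bfs adj vs.length T₀ r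
  let treeEdges ← Timed.fold (fun acc v =>
    match s.1.par v with
    | none => pure acc
    | some (_, e) => pure (e :: acc)) [] s.2
  let treeAdj ← buildAdj G vs treeEdges
  let T₁ ← Timed.tabulate vs.length (Forest.empty : Forest n m)
  bfs treeAdj vs.length T₁ (s.2.headD r)

/-- The test for the edges of the spanning trees of the parts. -/
def isPartTreeEdge (T : Forest n m) (top : Fin n → Bool) (v : Fin n) (e : Fin m) : Bool :=
  !top v && decide ((T.par v).map Prod.snd = some e)

/-- The table of the edges of the contracted graph. -/
def contractParts (G : MGraph n m) (es : List (Fin m)) (T : Forest n m) (label : Fin n → ℕ)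
    (top : Fin n → Bool) (k : ℕ) : Timed (ℕ → ℕ → List (Dart n m)) := do
  let H ← Timed.tabulate (k * k) (fun _ _ : ℕ => ([] : List (Dart n m)))
  Timed.fold (fun (H : ℕ → ℕ → List (Dart n m)) e =>
    let u := (G e).1
    let v := (G e).2
    if isPartTreeEdge T top u e || isPartTreeEdge T top v e then pure H
    else
      let i := label u
      let j := label v
      if i ≤ j then
        pure (Function.update H i (Function.update (H i) j ((u, e, v) :: H i j)))
      else
        pure (Function.update H j (Function.update (H j) i ((v, e, u) :: H j i)))) H es

/-- The greedy choice of short cycles in the contracted graph. -/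
def greedyCycles (k : ℕ) (H : ℕ → ℕ → List (Dart n m)) :
    Timed ((ℕ → Bool) × List (List (Dart n m))) := do
  let used ← Timed.tabulate k (fun _ : ℕ => false)
  tick k
  let q ← Timed.fold (fun q i => do
    tick k
    Timed.fold (fun (q : (ℕ → Bool) × List (List (Dart n m))) j =>
      if i < j && !q.1 i && !q.1 j then
        match H i j with
        | d₁ :: d₂ :: _ =>
          pure (Function.update (Function.update q.1 i true) j true,
            [d₁, (d₂.2.2, d₂.2.1, d₂.1)] :: q.2)
        | _ => pure q
      else pure q) q (List.range k)) (used, []) (List.range k)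
  Timed.fold (fun (q : (ℕ → Bool) × List (List (Dart n m))) i =>
    if q.1 i then pure q
    else
      match H i i with
      | d :: _ => pure (Function.update q.1 i true, [d] :: q.2)
      | [] => pure q) q (List.range k)

theorem oneRoundShortCycle_cons (G : MGraph n m) (r : Fin n) (vs : List (Fin n))
    (es : List (Fin m)) :
    oneRoundShortCycle G (r :: vs) es = (do
      let t ← spanningTree G (r :: vs) es r
      let c ← degrees G (r :: vs) es
      tick es.length
      let p ← treeSplit (16 * es.length) t.1 t.2 c
      let H ← contractParts G es t.1 p.1 p.2.1 p.2.2
      let q ← greedyCycles p.2.2 H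
      pullUp t.1 ((r :: vs).length + 1) q.2) := by
  simp only [spanningTree, contractParts, greedyCycles, Timed.bind_assoc]
  rfl

theorem TreeOrder.subset {G : MGraph n m} {es : List (Fin m)} {T : Forest n m} {r : Fin n}
    {l vs : List (Fin n)} (h : TreeOrder G es T r l) (hr : r ∈ vs)
    (hes : ∀ e ∈ es, (G e).1 ∈ vs ∧ (G e).2 ∈ vs) : l ⊆ vs := by
  induction h with
  | root => simpa using hr
  | child _ _ _ _ he hj _ ih =>
    refine List.cons_subset.2 ⟨?_, ih⟩
    rcases hj with hj | hj
    · have := (hes _ he).2; rw [hj] at this; exact this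
    · have := (hes _ he).1; rw [hj] at this; exact this

/-- The first search tree has depth at most `B`. The second search runs inside this tree from
`leaf`, and the tree path from there to any vertex is at most twice as long, hence `2 * B`. A tree
with edges in `es` has at most `vs.length` vertices, which makes this number enough fuel for both
searches. -/
theorem spanningTree_spec {G : MGraph n m} {vs : List (Fin n)} {es : List (Fin m)} {r : Fin n}
    (hr : r ∈ vs) (hes : ∀ e ∈ es, (G e).1 ∈ vs ∧ (G e).2 ∈ vs) {B : ℕ}
    (hB : ∀ v ∈ vs, ∃ P, G.IsWalk r P v ∧ (∀ x ∈ P, x.2 ∈ es) ∧ P.length ≤ B) :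
    (∃ leaf, TreeOrder G es (spanningTree G vs es r).val.1 leaf (spanningTree G vs es r).val.2) ∧
      (∀ v, v ∈ (spanningTree G vs es r).val.2 ↔ v ∈ vs) ∧
      (∀ v ∈ vs, (spanningTree G vs es r).val.1.dep v ≤ 2 * B) ∧
      (spanningTree G vs es r).time ≤ 15 * vs.length + 3 * es.length := by
  have hlen : ∀ {es' : List (Fin m)} {r'}, es' ⊆ es → r' ∈ vs →
      ∀ T l, TreeOrder G es' T r' l → l.length ≤ vs.length := by
    intro es' r' hsub hr' T l hl
    exact (List.subperm_of_subset hl.nodup (hl.subset hr' fun e he => hes e (hsub he))).length_le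
  obtain ⟨h1, ht1⟩ := bfs_spec (G := G) (es := es) (r := r) (T := Forest.empty) (N := vs.length)
    (by simp [Forest.empty]) (by simp [Forest.empty]) (hlen (fun _ h => h) hr)
  set s := bfs (adjList G es) vs.length Forest.empty r with hs
  have hmem1 : ∀ v, v ∈ s.val.2 ↔ v ∈ vs := by
    intro v
    refine ⟨fun hv => h1.tree.subset hr hes hv, fun hv => ?_⟩
    obtain ⟨P, hP, hPe, -⟩ := hB v hv
    exact (h1.of_walk hP hPe h1.tree.root_mem).1
  have hdep1 : ∀ v ∈ vs, s.val.1.dep v ≤ B := by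
    intro v hv
    obtain ⟨P, hP, hPe, hPl⟩ := hB v hv
    have := (h1.of_walk hP hPe h1.tree.root_mem).2
    rw [h1.tree.root_spec.2] at this
    omega
  have hedges : ∀ (l : List (Fin n)) (acc : List (Fin m)), ∃ l' : List (Fin m),
      (Timed.fold (fun acc v =>
      match s.val.1.par v with
      | none => (pure acc : Timed (List (Fin m)))
      | some (_, e) => pure (e :: acc)) acc l).val = l' ++ acc ∧
      l'.length ≤ l.length ∧
      (∀ e, e ∈ l' ↔ ∃ v ∈ l, ∃ p, s.val.1.par v = some (p, e)) ∧
      (Timed.fold (fun acc v =>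
      match s.val.1.par v with
      | none => (pure acc : Timed (List (Fin m)))
      | some (_, e) => pure (e :: acc)) acc l).time = l.length := by
    intro l
    induction l with
    | nil => intro acc; exact ⟨[], by simp [Timed.fold]⟩
    | cons v l ih =>
      intro acc
      cases hp : s.val.1.par v with
      | none =>
        obtain ⟨l', g1, g2, g3, g4⟩ := ih acc
        refine ⟨l', ?_, ?_, ?_, ?_⟩
        · simpa [Timed.fold, hp] using g1
        · simp; omega
        · intro e; rw [g3]; simp [hp]
        · simp only [Timed.fold, Timed.bind_time, Timed.tick_time, hp, Timed.pure_time,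
            Timed.pure_val, g4, List.length_cons]; omega
      | some x =>
        obtain ⟨p, e⟩ := x
        obtain ⟨l', g1, g2, g3, g4⟩ := ih (e :: acc)
        refine ⟨l' ++ [e], ?_, ?_, ?_, ?_⟩
        · simpa [Timed.fold, hp] using g1
        · simp; omega
        · intro f
          rw [List.mem_append, g3]
          simp only [List.mem_cons, List.not_mem_nil, or_false, exists_eq_or_imp, hp, Option.some.injEq,
            Prod.mk.injEq]
          constructor
          · rintro (h | rfl)
            · exact Or.inr h
            · exact Or.inl ⟨p, rfl, rfl⟩
          · rintro (⟨-, -, rfl⟩ | h)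
            · exact Or.inr rfl
            · exact Or.inl h
        · simp only [Timed.fold, Timed.bind_time, Timed.tick_time, hp, Timed.pure_time,
            Timed.pure_val, g4, List.length_cons]; omega
  obtain ⟨te, g1, g2, g3, g4⟩ := hedges s.val.2 []
  rw [List.append_nil] at g1
  have hsub : te ⊆ es := by
    intro e he
    obtain ⟨v, hv, p, hp⟩ := (g3 e).1 he
    exact (h1.tree.of_par hv hp).2.2.1
  have hleaf : s.val.2.headD r ∈ vs := by
    rw [← hmem1]
    cases hs2 : s.val.2 with
    | nil => have := h1.tree.root_mem; rw [hs2] at this; simp at this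
    | cons a l => simp
  set leaf := s.val.2.headD r with hleafdef
  obtain ⟨h2, ht2⟩ := bfs_spec (G := G) (es := te) (r := leaf) (T := Forest.empty)
    (N := vs.length) (by simp [Forest.empty]) (by simp [Forest.empty]) (hlen hsub hleaf)
  have hval : (spanningTree G vs es r).val =
      (bfs (adjList G te) vs.length Forest.empty leaf).val := by
    simp only [spanningTree, Timed.bind_val, buildAdj_val, Timed.tabulate_val]
    erw [g1]
  have htime : (spanningTree G vs es r).time = 4 * vs.length + es.length + s.time + s.val.2.length
      + te.length + (bfs (adjList G te) vs.length Forest.empty leaf).time := by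
    simp only [spanningTree, Timed.bind_time, buildAdj_val, Timed.tabulate_val,
      buildAdj_time, Timed.tabulate_time]
    erw [g1, g4]
    rw [← hs, ← hleafdef]
    omega
  rw [hval, htime]
  have hpath : ∀ v ∈ vs, v ∈ (bfs (adjList G te) vs.length Forest.empty leaf).val.2 ∧
      (bfs (adjList G te) vs.length Forest.empty leaf).val.1.dep v ≤ 2 * B := by
    intro v hv
    obtain ⟨P, -, p2, -, p4, p5, -⟩ := treePath_spec h1.tree (S := fun _ => True)
      (Q := fun _ => True) (by simp) le_rfl ((hmem1 _).2 hleaf) ((hmem1 _).2 hv) trivial trivial []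
    have := h2.of_walk p2 (fun x hx => by
      obtain ⟨-, -, c, p, hc, -, -, hp⟩ := p4 x hx
      exact (g3 _).2 ⟨c, hc, p, hp⟩) h2.tree.root_mem
    refine ⟨this.1, ?_⟩
    have g5 := this.2
    have g6 := hdep1 v hv
    have g7 := hdep1 _ hleaf
    rw [h2.tree.root_spec.2] at g5
    omega
  have hsum : ∀ (es' : List (Fin m)) (l : List (Fin n)), l.Nodup →
      (l.map fun v => 2 + degIn G es' v).sum ≤ 2 * l.length + 2 * es'.length := by
    intro es' l hl
    have := sum_map_degIn_le G es' hl
    have h3 : (l.map fun v => 2 + degIn G es' v).sum = 2 * l.length + (l.map (degIn G es')).sum := by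
      rw [List.sum_map_add]; simp [mul_comm]
    omega
  refine ⟨⟨leaf, ?_⟩, ?_, fun v hv => (hpath v hv).2, ?_⟩
  · have : ∀ l, TreeOrder G te (bfs (adjList G te) vs.length Forest.empty leaf).val.1 leaf l →
        TreeOrder G es (bfs (adjList G te) vs.length Forest.empty leaf).val.1 leaf l := by
      intro l hl
      induction hl with
      | root hp hd => exact .root hp hd
      | child _ hv hp hpl he hj hd ih => exact .child ih hv hp hpl (hsub he) hj hd
    exact this _ h2.tree
  · intro v
    exact ⟨fun hv => h2.tree.subset hleaf (fun e he => hes e (hsub he)) hv, fun hv => (hpath v hv).1⟩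
  · have a1 := hsum es _ h1.tree.nodup
    have a2 := hsum te _ h2.tree.nodup
    have a3 := hlen (fun _ h => h) hr _ _ h1.tree
    have a4 := hlen hsub hleaf _ _ h2.tree
    have a5 : 1 ≤ vs.length := List.length_pos_of_mem hr
    omega

/-- The edge `e` as an edge of the contracted graph, oriented towards the larger label. -/
def orient (G : MGraph n m) (label : Fin n → ℕ) (e : Fin m) : Dart n m :=
  if label (G e).1 ≤ label (G e).2 then ((G e).1, e, (G e).2) else ((G e).2, e, (G e).1)

theorem orient_spec (G : MGraph n m) (label : Fin n → ℕ) (e : Fin m) :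
    (orient G label e).2.1 = e ∧ G.Joins e (orient G label e).1 (orient G label e).2.2 ∧
      label (orient G label e).1 ≤ label (orient G label e).2.2 := by
  unfold orient
  split_ifs with h
  · exact ⟨rfl, Or.inl rfl, h⟩
  · exact ⟨rfl, Or.inr rfl, by simp; omega⟩

/-- Every edge outside the part trees is filed once, under the labels of its oriented ends. In this
form it is visible that the edges in a cell are distinct. -/
theorem contractParts_val (G : MGraph n m) (es : List (Fin m)) (T : Forest n m)
    (label : Fin n → ℕ) (top : Fin n → Bool) (k : ℕ) (i j : ℕ) :
    (contractParts G es T label top k).val i j =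
      ((es.reverse.filter fun e => !(isPartTreeEdge T top (G e).1 e ||
        isPartTreeEdge T top (G e).2 e)).map (orient G label)).filter fun d =>
          decide (label d.1 = i) && decide (label d.2.2 = j) := by
  have key : ∀ (es : List (Fin m)) (H : ℕ → ℕ → List (Dart n m)),
      (Timed.fold (fun (H : ℕ → ℕ → List (Dart n m)) e =>
        let u := (G e).1
        let v := (G e).2
        if isPartTreeEdge T top u e || isPartTreeEdge T top v e then
          (pure H : Timed (ℕ → ℕ → List (Dart n m)))
        else
          let i := label u
          let j := label v
          if i ≤ j then
            pure (Function.update H i (Function.update (H i) j ((u, e, v) :: H i j)))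
          else
            pure (Function.update H j (Function.update (H j) i ((v, e, u) :: H j i)))) H es).val
        = fun i j => (((es.reverse.filter fun e => !(isPartTreeEdge T top (G e).1 e ||
        isPartTreeEdge T top (G e).2 e)).map (orient G label)).filter fun d =>
          decide (label d.1 = i) && decide (label d.2.2 = j)) ++ H i j := by
    intro es
    induction es with
    | nil => intro H; rfl
    | cons e es ih =>
      intro H
      simp only [Timed.fold, Timed.bind_val] at ih ⊢
      rw [ih]
      funext i j
      by_cases ht : (isPartTreeEdge T top (G e).1 e || isPartTreeEdge T top (G e).2 e) = true
      · simp only [ht, if_true, Timed.pure_val, List.reverse_cons, List.filter_append,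
          List.filter_cons, Bool.not_true, Bool.false_eq_true, if_false, List.filter_nil,
          List.append_nil]
      · have hstep : ∀ (a b : ℕ) (d : Dart n m), label d.1 = a → label d.2.2 = b →
            Function.update H a (Function.update (H a) b (d :: H a b)) i j =
            (if label d.1 = i ∧ label d.2.2 = j then [d] else []) ++ H i j := by
          rintro a b d rfl rfl
          by_cases h1 : label d.1 = i
          · subst h1
            by_cases h2 : label d.2.2 = j
            · subst h2; simp
            · simp [h2, Function.update_of_ne (Ne.symm h2)]
          · simp [h1, Function.update_of_ne (Ne.symm h1)]
        simp only [ht, Bool.false_eq_true, if_false, List.reverse_cons, List.filter_append,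
          List.map_append, List.append_assoc]
        congr 1
        have ht' : (!(isPartTreeEdge T top (G e).1 e || isPartTreeEdge T top (G e).2 e)) = true := by
          simpa using ht
        simp only [List.filter_cons, ht', if_true, List.filter_nil, List.map_cons, List.map_nil]
        by_cases hle : label (G e).1 ≤ label (G e).2
        · simp only [hle, if_true, Timed.pure_val]
          rw [hstep _ _ ((G e).1, e, (G e).2) rfl rfl]
          simp only [orient, hle, if_true]
          congr 1
          split_ifs <;> simp_all
        · simp only [hle, if_false, Timed.pure_val]
          rw [hstep _ _ ((G e).2, e, (G e).1) rfl rfl]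
          simp only [orient, hle, if_false]
          congr 1
          split_ifs <;> simp_all
  have := congrFun (congrFun (key es (fun _ _ => [])) i) j
  simpa only [contractParts, Timed.bind_val, Timed.tabulate_val, List.append_nil] using this

theorem contractParts_time (G : MGraph n m) (es : List (Fin m)) (T : Forest n m)
    (label : Fin n → ℕ) (top : Fin n → Bool) (k : ℕ) :
    (contractParts G es T label top k).time = k * k + es.length := by
  simp only [contractParts, Timed.bind_time, Timed.tabulate_time, Timed.tabulate_val]
  rw [Timed.fold_time_eq (g := fun _ => 0)]
  · simp
  · intro s a
    split_ifs <;> rfl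

end Round

/-! ### A maximal packing of cycles of length one and two in the contracted graph. -/

section Greedy

variable {n m : ℕ}

/-- The parts on a cycle of the contracted graph. -/
def cycleParts (label : Fin n → ℕ) (c : List (Dart n m)) : List ℕ := c.map fun d => label d.1

/-- `c` is a cycle of length `1` or `2` of the contracted graph with the edges `H`. -/
def IsShortCycle (k : ℕ) (H : ℕ → ℕ → List (Dart n m)) (c : List (Dart n m)) : Prop :=
  (∃ i j d₁ d₂, i < j ∧ j < k ∧ d₁ ∈ H i j ∧ d₂ ∈ H i j ∧ d₁.2.1 ≠ d₂.2.1 ∧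
    c = [d₁, (d₂.2.2, d₂.2.1, d₂.1)]) ∨ ∃ i d, i < k ∧ d ∈ H i i ∧ c = [d]

/-- The cycles in `q.2` are vertex-disjoint, and `q.1` marks their vertices. -/
structure IsPacking (label : Fin n → ℕ) (k : ℕ) (H : ℕ → ℕ → List (Dart n m))
    (q : (ℕ → Bool) × List (List (Dart n m))) : Prop where
  short : ∀ c ∈ q.2, IsShortCycle k H c
  disjoint : q.2.Pairwise fun c d => List.Disjoint (cycleParts label c) (cycleParts label d)
  used : ∀ x, q.1 x = true ↔ ∃ c ∈ q.2, x ∈ cycleParts label c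

theorem IsPacking.cons {label : Fin n → ℕ} {k : ℕ} {H : ℕ → ℕ → List (Dart n m)}
    {q : (ℕ → Bool) × List (List (Dart n m))} (h : IsPacking label k H q) {c : List (Dart n m)}
    (hc : IsShortCycle k H c) (hd : ∀ x ∈ cycleParts label c, q.1 x = false) {u : ℕ → Bool}
    (hu : ∀ x, u x = true ↔ x ∈ cycleParts label c ∨ q.1 x = true) :
    IsPacking label k H (u, c :: q.2) where
  short := by
    intro c' hc'
    rcases List.mem_cons.1 hc' with rfl | hc'
    · exact hc
    · exact h.short c' hc'
  disjoint := by
    refine List.pairwise_cons.2 ⟨fun c' hc' x hx hx' => ?_, h.disjoint⟩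
    have := (h.used x).2 ⟨c', hc', hx'⟩
    rw [hd x hx] at this
    simp at this
  used := by
    intro x
    rw [hu, h.used]
    simp

/-- One step of the search for cycles of length `2`. -/
def pairStep (H : ℕ → ℕ → List (Dart n m)) (q : (ℕ → Bool) × List (List (Dart n m)))
    (x : ℕ × ℕ) : (ℕ → Bool) × List (List (Dart n m)) :=
  if x.1 < x.2 && !q.1 x.1 && !q.1 x.2 then
    match H x.1 x.2 with
    | d₁ :: d₂ :: _ => (Function.update (Function.update q.1 x.1 true) x.2 true,
        [d₁, (d₂.2.2, d₂.2.1, d₂.1)] :: q.2)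
    | _ => q
  else q

/-- One step of the search for cycles of length `1`. -/
def loopStep (H : ℕ → ℕ → List (Dart n m)) (q : (ℕ → Bool) × List (List (Dart n m))) (i : ℕ) :
    (ℕ → Bool) × List (List (Dart n m)) :=
  if q.1 i then q
  else
    match H i i with
    | d :: _ => (Function.update q.1 i true, [d] :: q.2)
    | [] => q

theorem greedyCycles_eq (k : ℕ) (H : ℕ → ℕ → List (Dart n m)) :
    (greedyCycles k H).val = (List.range k).foldl (loopStep H)
      (((List.range k).flatMap fun i => (List.range k).map (Prod.mk i)).foldl (pairStep H)
        (fun _ => false, [])) ∧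
    (greedyCycles k H).time = 2 * (k * k) + 4 * k := by
  have h1 : ∀ (i : ℕ) (q : (ℕ → Bool) × List (List (Dart n m))),
      Timed.fold (fun (q : (ℕ → Bool) × List (List (Dart n m))) j =>
      if i < j && !q.1 i && !q.1 j then
        match H i j with
        | d₁ :: d₂ :: _ =>
          pure (Function.update (Function.update q.1 i true) j true,
            [d₁, (d₂.2.2, d₂.2.1, d₂.1)] :: q.2)
        | _ => pure q
      else (pure q : Timed _)) q (List.range k) =
      Timed.fold (fun q j => pure (pairStep H q (i, j))) q (List.range k) := by
    intro i q
    congr 1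
    funext q j
    simp only [pairStep]
    split_ifs
    · split <;> rfl
    · rfl
  have h2 : ∀ q : (ℕ → Bool) × List (List (Dart n m)),
      Timed.fold (fun (q : (ℕ → Bool) × List (List (Dart n m))) i =>
      if q.1 i then pure q
      else
        match H i i with
        | d :: _ => (pure (Function.update q.1 i true, [d] :: q.2) : Timed _)
        | [] => pure q) q (List.range k) =
      Timed.fold (fun q i => pure (loopStep H q i)) q (List.range k) := by
    intro q
    congr 1
    funext q i
    simp only [loopStep]
    split_ifs
    · rfl
    · split <;> rfl
  have hprog : greedyCycles k H = (do
      let used ← Timed.tabulate k (fun _ : ℕ => false)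
      tick k
      let q ← Timed.fold (fun q i => do
        tick k
        Timed.fold (fun q j => pure (pairStep H q (i, j))) q (List.range k)) (used, [])
          (List.range k)
      Timed.fold (fun q i => pure (loopStep H q i)) q (List.range k)) := by
    rw [greedyCycles]
    simp only [← h1, ← h2]
  rw [hprog]
  constructor
  · simp only [Timed.bind_val, Timed.tabulate_val, Timed.fold_val, Timed.pure_val]
    congr 1
    exact List.foldl_foldl_flatMap (fun q i j => pairStep H q (i, j)) (fun _ => List.range k)
      (List.range k) (fun _ => false, [])
  · simp only [Timed.bind_time, Timed.tabulate_time, Timed.tick_time, Timed.fold_pure_time]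
    rw [Timed.fold_time_eq (g := fun _ => k + k) (fun s a => by simp)]
    simp
    ring

/-- Marks are never removed, so what holds for a pair or a single part when it is visited still
holds at the end; this is the maximality of the packing. By `hnd` the two darts taken from a cell
belong to different edges. -/
theorem greedyCycles_spec {label : Fin n → ℕ} {k : ℕ} {H : ℕ → ℕ → List (Dart n m)}
    (hH : ∀ i j, ∀ d ∈ H i j, label d.1 = i ∧ label d.2.2 = j)
    (hnd : ∀ i j, ((H i j).map fun d => d.2.1).Nodup) :
    IsPacking label k H (greedyCycles k H).val ∧
    (∀ i j, i < j → j < k → (greedyCycles k H).val.1 i = true ∨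
      (greedyCycles k H).val.1 j = true ∨ (H i j).length ≤ 1) ∧
    ∀ i, i < k → (greedyCycles k H).val.1 i = true ∨ H i i = [] := by
  rw [(greedyCycles_eq k H).1]
  have h1 := List.foldl_induction (f := pairStep H) (b := (fun _ => false, []))
    (l := (List.range k).flatMap fun i => (List.range k).map (Prod.mk i))
    (fun d q => IsPacking label k H q ∧ ∀ x ∈ d, x.1 < x.2 →
      q.1 x.1 = true ∨ q.1 x.2 = true ∨ (H x.1 x.2).length ≤ 1)
    ⟨⟨by simp, by simp, by simp⟩, by simp⟩ (by
      rintro d ⟨i, j⟩ rest ⟨u, cs⟩ hl ⟨h1, h2⟩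
      have hx : (i, j) ∈ (List.range k).flatMap fun i => (List.range k).map (Prod.mk i) := by
        rw [hl]; simp
      have hjk : j < k := by simpa using (by simpa using hx : i < k ∧ j < k).2
      by_cases hc : (i < j && !u i && !u j) = true
      · have hc' := hc
        simp only [Bool.and_eq_true, decide_eq_true_eq, Bool.not_eq_true'] at hc'
        obtain ⟨⟨hij, hui⟩, huj⟩ := hc'
        rcases hh : H i j with _ | ⟨d₁, _ | ⟨d₂, ds⟩⟩
        · simp only [pairStep, hc, if_true, hh]
          refine ⟨h1, fun x hx hlt => ?_⟩
          rcases List.mem_append.1 hx with hx | hx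
          · exact h2 x hx hlt
          · simp at hx; subst hx; simp [hh]
        · simp only [pairStep, hc, if_true, hh]
          refine ⟨h1, fun x hx hlt => ?_⟩
          rcases List.mem_append.1 hx with hx | hx
          · exact h2 x hx hlt
          · simp at hx; subst hx; simp [hh]
        · simp only [pairStep, hc, if_true, hh]
          have hd₁ : d₁ ∈ H i j := by simp [hh]
          have hd₂ : d₂ ∈ H i j := by simp [hh]
          have hne : d₁.2.1 ≠ d₂.2.1 := by
            have := hnd i j
            rw [hh] at this
            simp at this
            exact this.1.1
          have hparts : cycleParts label [d₁, (d₂.2.2, d₂.2.1, d₂.1)] = [i, j] := by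
            simp [cycleParts, (hH i j d₁ hd₁).1, (hH i j d₂ hd₂).2]
          have hup : ∀ x, Function.update (Function.update u i true) j true x = true ↔
              x = i ∨ x = j ∨ u x = true := by
            intro x
            by_cases hxj : x = j
            · subst hxj; simp
            · by_cases hxi : x = i
              · subst hxi; simp [Function.update_of_ne hxj]
              · simp [hxi, hxj]
          refine ⟨h1.cons (Or.inl ⟨i, j, d₁, d₂, hij, hjk, hd₁, hd₂, hne, rfl⟩) ?_ ?_,
            fun x hx hlt => ?_⟩
          · intro x hx
            rw [hparts] at hx
            simp at hx
            rcases hx with rfl | rfl <;> assumption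
          · intro x
            rw [hparts, hup]
            simp [or_assoc]
          · simp only [hup]
            rcases List.mem_append.1 hx with hx | hx
            · have := h2 x hx hlt
              tauto
            · simp at hx; subst hx; simp
      · simp only [pairStep, hc]
        refine ⟨h1, fun x hx hlt => ?_⟩
        rcases List.mem_append.1 hx with hx | hx
        · exact h2 x hx hlt
        · simp at hx; subst hx
          simp at hlt
          simp [hlt] at hc
          by_cases hui : u i = true
          · exact Or.inl hui
          · exact Or.inr (Or.inl (hc (by simpa using hui))))
  set q₁ := ((List.range k).flatMap fun i => (List.range k).map (Prod.mk i)).foldl (pairStep H)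
        (fun _ => false, []) with hq₁
  have h2 := List.foldl_induction (f := loopStep H) (b := q₁) (l := List.range k)
    (fun d q => IsPacking label k H q ∧ (∀ x, q₁.1 x = true → q.1 x = true) ∧
      ∀ i ∈ d, q.1 i = true ∨ H i i = [])
    ⟨h1.1, by simp, by simp⟩ (by
      rintro d i rest ⟨u, cs⟩ hl ⟨g1, g2, g3⟩
      have hik : i < k := by
        have : i ∈ List.range k := by rw [hl]; simp
        simpa using this
      by_cases hu : u i = true
      · simp only [loopStep, hu, if_true]
        refine ⟨g1, g2, fun x hx => ?_⟩
        rcases List.mem_append.1 hx with hx | hx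
        · exact g3 x hx
        · simp at hx; subst hx; exact Or.inl hu
      · rcases hh : H i i with _ | ⟨d', ds⟩
        · simp only [loopStep, hu, hh]
          refine ⟨g1, g2, fun x hx => ?_⟩
          rcases List.mem_append.1 hx with hx | hx
          · exact g3 x hx
          · simp at hx; subst hx; exact Or.inr hh
        · simp only [loopStep, hu, hh]
          have hd' : d' ∈ H i i := by simp [hh]
          have hparts : cycleParts label [d'] = [i] := by
            simp [cycleParts, (hH i i d' hd').1]
          have hup : ∀ x, Function.update u i true x = true ↔ x = i ∨ u x = true := by
            intro x
            by_cases hxi : x = i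
            · subst hxi; simp
            · simp [hxi]
          refine ⟨g1.cons (Or.inr ⟨i, d', hik, hd', rfl⟩) ?_ ?_, fun x hx => ?_, fun x hx => ?_⟩
          · intro x hx
            rw [hparts] at hx
            simp at hx
            subst hx
            simpa using hu
          · intro x
            rw [hparts, hup]
            simp
          · exact (hup x).2 (Or.inr (g2 x hx))
          · refine Or.imp_left (hup x).2 ?_
            rcases List.mem_append.1 hx with hx | hx
            · have := g3 x hx
              tauto
            · simp at hx; subst hx; simp)
  refine ⟨h2.1, fun i j hij hjk => ?_, fun i hi => h2.2.2 i (by simpa using hi)⟩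
  rcases h1.2 (i, j) (by simp; omega) hij with h | h | h
  · exact Or.inl (h2.2.1 _ h)
  · exact Or.inr (Or.inl (h2.2.1 _ h))
  · exact Or.inr (Or.inr h)

theorem IsShortCycle.length_le {k : ℕ} {H : ℕ → ℕ → List (Dart n m)} {c : List (Dart n m)}
    (h : IsShortCycle k H c) : 1 ≤ c.length ∧ c.length ≤ 2 := by
  rcases h with ⟨i, j, d₁, d₂, -, -, -, -, -, rfl⟩ | ⟨i, d, -, -, rfl⟩ <;> simp

theorem IsPacking.card_used_le {label : Fin n → ℕ} {k : ℕ} {H : ℕ → ℕ → List (Dart n m)}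
    {q : (ℕ → Bool) × List (List (Dart n m))} (h : IsPacking label k H q) :
    ((Finset.range k).filter fun i => q.1 i = true).card ≤ 2 * q.2.length := by
  have h1 : ((Finset.range k).filter fun i => q.1 i = true) ⊆
      (q.2.flatMap (cycleParts label)).toFinset := by
    intro x hx
    simp only [Finset.mem_filter] at hx
    simpa using (h.used x).1 hx.2
  refine (Finset.card_le_card h1).trans ((List.toFinset_card_le _).trans ?_)
  rw [List.length_flatMap]
  have h2 : ∀ l : List (List (Dart n m)), (∀ c ∈ l, c.length ≤ 2) →
      (l.map fun c => (cycleParts label c).length).sum ≤ 2 * l.length := by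
    intro l
    induction l with
    | nil => simp
    | cons a l ih =>
      intro hl
      have h3 := ih fun c hc => hl c (by simp [hc])
      have h4 := hl a (by simp)
      simp only [List.map_cons, List.sum_cons, List.length_cons, cycleParts,
        List.length_map] at h3 ⊢
      omega
  exact h2 _ fun c hc => (h.short c hc).length_le.2

end Greedy

/-! ### Lifting cycles of the contracted graph through the trees of the parts. -/

section PullUp

variable {n m : ℕ}

theorem MGraph.IsWalk.isCycle' {G : MGraph n m} {P : Cyc n m} {a : Fin n} (h : G.IsWalk a P a)
    (hne : P ≠ []) (hn : (P.map Prod.fst).Nodup) (he : ∀ x y, P = [x, y] → x.2 ≠ y.2) :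
    G.IsCycle P := by
  cases P with
  | nil => exact absurd rfl hne
  | cons x P =>
    have h' := h
    obtain ⟨h1, -⟩ := h'
    obtain ⟨x1, e⟩ := x
    simp only at h1
    subst h1
    refine h.isCycle hn fun z hz => ?_
    exact he (x1, e) (z, e) (by rw [hz]) rfl

/-- Climbing to the parent keeps the label and lowers the depth until a top vertex is met. -/
theorem IsSplit.exists_top {T : Forest n m} {rev : List (Fin n)} {c : Fin n → ℕ} {tsq k : ℕ}
    {label : Fin n → ℕ} {top : Fin n → Bool} {G : MGraph n m} {es : List (Fin m)} {r : Fin n}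
    (hT : TreeOrder G es T r rev) (h : IsSplit T rev c tsq label top k) {w : Fin n}
    (hw : w ∈ rev) :
    ∃ t ∈ rev, top t = true ∧ label t = label w ∧ (t = w ∨ T.dep t < T.dep w) := by
  induction hd : T.dep w using Nat.strong_induction_on generalizing w with
  | _ d ih =>
    by_cases ht : top w = true
    · exact ⟨w, hw, ht, rfl, Or.inl rfl⟩
    · obtain ⟨p, e, hp, hpr, hlp⟩ := h.par w hw (by simpa using ht)
      have hdp := (hT.of_par hw hp).2.2.2.2
      obtain ⟨t, h1, h2, h3, h4⟩ := ih (T.dep p) (by omega) hpr rfl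
      refine ⟨t, h1, h2, h3.trans hlp.symm, Or.inr ?_⟩
      rcases h4 with rfl | h4 <;> omega

/-- The unique top of a part lies above all its other vertices, so of two different vertices of the
part one that is at least as deep as the other is not the top, and its parent belongs to the part.
Hence `treePath` stays inside and uses only part tree edges, which are not edges of the contracted
graph. -/
theorem IsSplit.path_spec {T : Forest n m} {rev : List (Fin n)} {c : Fin n → ℕ} {tsq k : ℕ}
    {label : Fin n → ℕ} {top : Fin n → Bool} {G : MGraph n m} {es : List (Fin m)} {r : Fin n}
    (h : IsSplit T rev c tsq label top k) (hT : TreeOrder G es T r rev) {D fuel : ℕ}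
    (hD : ∀ v ∈ rev, T.dep v ≤ D) (hfuel : rev.length ≤ fuel) {a b : Fin n} (ha : a ∈ rev)
    (hb : b ∈ rev) (hab : label a = label b) (acc : Cyc n m) :
    ∃ P : Cyc n m, (treePath T fuel a b acc).val = P ++ acc ∧ G.IsWalk a P b ∧
      (P.map Prod.fst ++ [b]).Nodup ∧ (∀ x ∈ P, x.1 ∈ rev ∧ label x.1 = label b ∧ x.2 ∈ es ∧
        ∃ v, isPartTreeEdge T top v x.2 = true ∧ ∃ p, G.Joins x.2 p v) ∧
      P.length ≤ 2 * D ∧ (treePath T fuel a b acc).time ≤ P.length + 1 := by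
  obtain ⟨P, h1, h2, h3, h4, h5, h6⟩ := treePath_spec hT (S := fun v => label v = label b)
    (Q := fun v => top v = false) (fun a' b' ha' hb' h1 h2 hne hd => by
      have htop : top a' = false := by
        by_contra ht
        obtain ⟨t, g1, g2, g3, g4⟩ := h.exists_top hT hb'
        have := h.top_inj t g1 a' ha' g2 (by simpa using ht) (g3.trans (h2.trans h1.symm))
        subst this
        rcases g4 with g4 | g4
        · exact hne g4
        · omega
      refine ⟨htop, fun p e hp => ?_⟩
      obtain ⟨p', e', hp', -, hl⟩ := h.par a' ha' htop
      rw [hp] at hp'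
      simp at hp'
      rw [hp'.1, ← hl, h1]) hfuel ha hb hab rfl acc
  refine ⟨P, h1, h2, h3, fun x hx => ?_, ?_, h6⟩
  · obtain ⟨g1, g2, v, p, g3, g4, g5, g6⟩ := h4 x hx
    obtain ⟨-, -, g7, g8, -⟩ := hT.of_par g3 g6
    exact ⟨g1, g2, g7, v, by simp [isPartTreeEdge, g5, g6], p, g8⟩
  · have := hD a ha
    have := hD b hb
    omega

/-- The darts in `H` are the edges in `es` between the parts that are no part tree edges. -/
def IsDartTable (G : MGraph n m) (es : List (Fin m)) (T : Forest n m) (rev : List (Fin n))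
    (label : Fin n → ℕ) (top : Fin n → Bool) (H : ℕ → ℕ → List (Dart n m)) : Prop :=
  ∀ i j, ∀ d ∈ H i j, label d.1 = i ∧ label d.2.2 = j ∧ d.2.1 ∈ es ∧ G.Joins d.2.1 d.1 d.2.2 ∧
    d.1 ∈ rev ∧ d.2.2 ∈ rev ∧ isPartTreeEdge T top d.1 d.2.1 = false ∧
    isPartTreeEdge T top d.2.2 d.2.1 = false

/-- The closed walk starts where the last dart enters its part. With two parts, the two inner paths
are disjoint because their labels differ; with one part, it is a tree path with one more edge. An
inner path has length at most `2 * D`, and there are at most two darts. -/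
theorem pullUpCycle_spec {T : Forest n m} {rev : List (Fin n)} {c : Fin n → ℕ} {tsq k : ℕ}
    {label : Fin n → ℕ} {top : Fin n → Bool} {G : MGraph n m} {es : List (Fin m)} {r : Fin n}
    (h : IsSplit T rev c tsq label top k) (hT : TreeOrder G es T r rev) {D fuel : ℕ}
    (hD : ∀ v ∈ rev, T.dep v ≤ D) (hfuel : rev.length ≤ fuel) {H : ℕ → ℕ → List (Dart n m)}
    (hH : IsDartTable G es T rev label top H) {C : List (Dart n m)} (hC : IsShortCycle k H C) :
    ∃ d, C.getLast? = some d ∧ G.IsCycle (pullUpCycle T fuel d.2.2 C).val ∧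
      (∀ x ∈ (pullUpCycle T fuel d.2.2 C).val, x.1 ∈ rev ∧ x.2 ∈ es ∧
        label x.1 ∈ cycleParts label C) ∧
      (pullUpCycle T fuel d.2.2 C).val.length ≤ 4 * D + 2 ∧
      (pullUpCycle T fuel d.2.2 C).time ≤ 2 * (pullUpCycle T fuel d.2.2 C).val.length := by
  rcases hC with ⟨i, j, ⟨a₁, e₁, b₁⟩, ⟨a₂, e₂, b₂⟩, hij, -, hd₁, hd₂, hne, rfl⟩ |
    ⟨i, ⟨a, e, b⟩, -, hd, rfl⟩
  · obtain ⟨p1, p2, p3, p4, p5, p6, -, -⟩ := hH i j _ hd₁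
    obtain ⟨q1, q2, q3, q4, q5, q6, -, -⟩ := hH i j _ hd₂
    simp only at p1 p2 p3 p4 p5 p6 q1 q2 q3 q4 q5 q6 hne
    obtain ⟨P₂, g1, g2, g3, g4, g5, g6⟩ := h.path_spec hT hD hfuel p6 q6 (p2.trans q2.symm)
      ([(b₂, e₂)] : Cyc n m)
    obtain ⟨P₁, f1, f2, f3, f4, f5, f6⟩ := h.path_spec hT hD hfuel q5 p5 (q1.trans p1.symm)
      ((a₁, e₁) :: (P₂ ++ [(b₂, e₂)]))
    have hval : (pullUpCycle T fuel a₂ [(a₁, e₁, b₁), (b₂, e₂, a₂)]).val =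
        P₁ ++ (a₁, e₁) :: (P₂ ++ [(b₂, e₂)]) := by
      simp [pullUpCycle, g1, f1]
    have htime : (pullUpCycle T fuel a₂ [(a₁, e₁, b₁), (b₂, e₂, a₂)]).time ≤
        P₁.length + P₂.length + 4 := by
      simp [pullUpCycle, g1]
      omega
    refine ⟨(b₂, e₂, a₂), rfl, ?_⟩
    simp only [hval]
    refine ⟨?_, ?_, ?_, ?_⟩
    · refine MGraph.IsWalk.isCycle' (a := a₂) ?_ (by simp) ?_ ?_
      · exact f2.append ⟨rfl, b₁, p4, g2.append (.single q4.symm)⟩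
      · have : (P₁ ++ (a₁, e₁) :: (P₂ ++ [(b₂, e₂)])).map Prod.fst =
            (P₁.map Prod.fst ++ [a₁]) ++ (P₂.map Prod.fst ++ [b₂]) := by simp
        rw [this, List.nodup_append]
        refine ⟨f3, g3, ?_⟩
        rintro x hx y hy rfl
        have h1 : label x = i := by
          rcases List.mem_append.1 hx with hx | hx
          · obtain ⟨z, hz, rfl⟩ := List.mem_map.1 hx
            rw [(f4 z hz).2.1, p1]
          · simp at hx; rw [hx, p1]
        have h2 : label x = j := by
          rcases List.mem_append.1 hy with hy | hy
          · obtain ⟨z, hz, rfl⟩ := List.mem_map.1 hy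
            rw [(g4 z hz).2.1, q2]
          · simp at hy; rw [hy, q2]
        omega
      · intro x y hxy
        have hlen := congrArg List.length hxy
        simp at hlen
        -- In a closed walk of length two both inner paths are empty, and what remains are the two
        -- different edges of the contracted cycle.
        have h1 : P₁ = [] := List.length_eq_zero_iff.1 (by omega)
        have h2 : P₂ = [] := List.length_eq_zero_iff.1 (by omega)
        subst h1 h2
        simp at hxy
        rw [← hxy.1, ← hxy.2]
        exact hne
    · intro x hx
      have hparts : cycleParts label [((a₁, e₁, b₁) : Dart n m), (b₂, e₂, a₂)] = [i, j] := by
        simp [cycleParts, p1, q2]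
      rw [hparts]
      simp only [List.mem_append, List.mem_cons, List.not_mem_nil, or_false] at hx ⊢
      rcases hx with hx | rfl | hx | rfl
      · obtain ⟨z1, z2, z3, -⟩ := f4 x hx
        exact ⟨z1, z3, Or.inl (z2.trans p1)⟩
      · exact ⟨p5, p3, Or.inl p1⟩
      · obtain ⟨z1, z2, z3, -⟩ := g4 x hx
        exact ⟨z1, z3, Or.inr (z2.trans q2)⟩
      · exact ⟨q6, q3, Or.inr q2⟩
    · simp; omega
    · simp; omega
  · obtain ⟨p1, p2, p3, p4, p5, p6, p7, p8⟩ := hH i i _ hd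
    simp only at p1 p2 p3 p4 p5 p6 p7 p8
    obtain ⟨P, g1, g2, g3, g4, g5, g6⟩ := h.path_spec hT hD hfuel p6 p5 (p2.trans p1.symm)
      ([(a, e)] : Cyc n m)
    have hval : (pullUpCycle T fuel b [(a, e, b)]).val = P ++ [(a, e)] := by
      simp [pullUpCycle, g1]
    have htime : (pullUpCycle T fuel b [(a, e, b)]).time ≤ P.length + 2 := by
      simp [pullUpCycle]
      omega
    refine ⟨(a, e, b), rfl, ?_⟩
    simp only [hval]
    refine ⟨?_, ?_, ?_, ?_⟩
    · refine MGraph.IsWalk.isCycle' (a := b) (g2.append (.single p4)) (by simp) (by simpa using g3) ?_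
      intro x y hxy hee
      have hlen := congrArg List.length hxy
      simp at hlen
      -- The inner path is a single part tree edge, whereas `e` comes from the table and is none; so
      -- they differ.
      obtain ⟨z, rfl⟩ := List.length_eq_one_iff.1 hlen
      simp at hxy
      obtain ⟨rfl, rfl⟩ := hxy
      simp only at hee
      obtain ⟨-, -, -, v, g7, p, g8⟩ := g4 z (by simp)
      rw [hee] at g7 g8
      rcases p4.cases_eq g8 with ⟨-, rfl⟩ | ⟨rfl, -⟩
      · rw [g7] at p8; simp at p8
      · rw [g7] at p7; simp at p7
    · intro x hx
      have hparts : cycleParts label [((a, e, b) : Dart n m)] = [i] := by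
        simp [cycleParts, p1]
      rw [hparts]
      simp only [List.mem_append, List.mem_cons, List.not_mem_nil, or_false] at hx ⊢
      rcases hx with hx | rfl
      · obtain ⟨z1, z2, z3, -⟩ := g4 x hx
        exact ⟨z1, z3, z2.trans p1⟩
      · exact ⟨p5, p3, p1⟩
    · simp; omega
    · simp; omega

/-- Lifted cycles are disjoint because they stay in the parts of their contracted cycles. A lifted
cycle of length `ℓ ≥ 1` costs at most `3 + 2 * ℓ` steps: the loop, the length of the contracted
cycle, and the lifting. This is at most `5 * ℓ`. -/
theorem pullUp_spec {T : Forest n m} {rev : List (Fin n)} {c : Fin n → ℕ} {tsq k : ℕ}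
    {label : Fin n → ℕ} {top : Fin n → Bool} {G : MGraph n m} {es : List (Fin m)} {r : Fin n}
    (h : IsSplit T rev c tsq label top k) (hT : TreeOrder G es T r rev) {D fuel : ℕ}
    (hD : ∀ v ∈ rev, T.dep v ≤ D) (hfuel : rev.length ≤ fuel) {H : ℕ → ℕ → List (Dart n m)}
    (hH : IsDartTable G es T rev label top H) {q : (ℕ → Bool) × List (List (Dart n m))}
    (hq : IsPacking label k H q) :
    (∀ C ∈ (pullUp T fuel q.2).val, G.IsCycle C ∧ (∀ x ∈ C, x.1 ∈ rev ∧ x.2 ∈ es) ∧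
      C.length ≤ 4 * D + 2) ∧
    ((pullUp T fuel q.2).val.Pairwise fun C C' =>
      List.Disjoint (C.map Prod.fst) (C'.map Prod.fst)) ∧
    (pullUp T fuel q.2).val.length = q.2.length ∧
    (pullUp T fuel q.2).time ≤ 5 * ((pullUp T fuel q.2).val.map List.length).sum := by
  have key := Timed.fold_induction (f := fun acc (c : List (Dart n m)) => (do
      tick c.length
      match c.getLast? with
      | none => pure acc
      | some d => do
        let c' ← pullUpCycle T fuel d.2.2 c
        return c' :: acc : Timed (List (Cyc n m)))) (b := []) (l := q.2)
    (fun done acc t => (∀ C ∈ acc, G.IsCycle C ∧ (∀ x ∈ C, x.1 ∈ rev ∧ x.2 ∈ es) ∧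
        C.length ≤ 4 * D + 2) ∧
      (∀ C ∈ acc, ∃ c ∈ done, ∀ x ∈ C, label x.1 ∈ cycleParts label c) ∧
      (acc.Pairwise fun C C' => List.Disjoint (C.map Prod.fst) (C'.map Prod.fst)) ∧
      acc.length = done.length ∧ t ≤ 5 * (acc.map List.length).sum)
    (by simp) (by
      rintro done a rest acc t hl ⟨h1, h2, h3, h4, h5⟩
      have ha : a ∈ q.2 := by rw [hl]; simp
      obtain ⟨d, hd, g1, g2, g3, g4⟩ := pullUpCycle_spec h hT hD hfuel hH (hq.short a ha)
      have hlen := (hq.short a ha).length_le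
      simp only [Timed.bind_val, Timed.bind_time, hd, Timed.pure_val, Timed.pure_time,
        Timed.tick_time]
      set C := (pullUpCycle T fuel d.2.2 a).val with hC
      have hpos : 1 ≤ C.length := List.length_pos_iff.2 g1.1
      have hdis := hq.disjoint
      rw [hl, List.pairwise_append] at hdis
      refine ⟨?_, ?_, ?_, ?_, ?_⟩
      · intro C' hC'
        rcases List.mem_cons.1 hC' with rfl | hC'
        · exact ⟨g1, fun x hx => ⟨(g2 x hx).1, (g2 x hx).2.1⟩, g3⟩
        · exact h1 C' hC'
      · intro C' hC'
        rcases List.mem_cons.1 hC' with rfl | hC'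
        · exact ⟨a, by simp, fun x hx => (g2 x hx).2.2⟩
        · obtain ⟨c, hc, hx⟩ := h2 C' hC'
          exact ⟨c, by simp [hc], hx⟩
      · refine List.pairwise_cons.2 ⟨fun C' hC' v hv hv' => ?_, h3⟩
        obtain ⟨c, hc, hx⟩ := h2 C' hC'
        obtain ⟨x, hx1, rfl⟩ := List.mem_map.1 hv
        obtain ⟨y, hy1, hxy⟩ := List.mem_map.1 hv'
        have h6 := hx y hy1
        rw [hxy] at h6
        exact hdis.2.2 c hc a (by simp) h6 (g2 x hx1).2.2
      · simp [h4]
      · simp only [List.map_cons, List.sum_cons]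
        omega)
  exact ⟨key.1, key.2.2.1, key.2.2.2.1, key.2.2.2.2⟩

end PullUp

/-! ### Counting the edges and the steps of one round on a connected graph. -/

section OneRound

variable {n m : ℕ}

/-- The number of parts is small compared with the square root of the number of edges. -/
theorem IsSplit.four_mul_sq_le {T : Forest n m} {rev : List (Fin n)} {tsq k : ℕ}
    {label : Fin n → ℕ} {top : Fin n → Bool} {G : MGraph n m} {es : List (Fin m)} {r : Fin n}
    (h : IsSplit T rev (degIn G es) tsq label top k) (hT : TreeOrder G es T r rev)
    (htsq : tsq = 16 * es.length) (hk : 2 ≤ k) : 4 * (k * k) ≤ es.length := by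
  -- Two parts need two vertices, and a tree with two vertices has an edge.
  have hpos : 0 < es.length := by
    by_contra hes
    have hes : es = [] := List.length_eq_zero_iff.1 (by omega)
    subst hes
    obtain ⟨v, hv, hv0⟩ := h.nonempty hk 0 (by omega)
    obtain ⟨w, hw, hw1⟩ := h.nonempty hk 1 (by omega)
    have : ∀ v ∈ rev, v = r := by
      intro v hv
      rcases hT.cases_mem hv with h | ⟨p, e, -, -, he, -⟩
      · exact h
      · simp at he
    rw [this v hv] at hv0
    rw [this w hw] at hw1
    omega
  have hsum : ∑ i ∈ Finset.range k, ∑ v ∈ rev.toFinset with label v = i, degIn G es v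
      ≤ 2 * es.length := by
    rw [Finset.sum_fiberwise_of_maps_to (fun v hv => by
      simpa using h.lt v (by simpa using hv))]
    rw [List.sum_toFinset _ hT.nodup]
    exact sum_map_degIn_le G es hT.nodup
  -- The smallest degree sum `S` of a part satisfies `k * S ≤ 2 * es.length` and `16 * es.length ≤ S
  -- ^ 2`; squaring the first inequality avoids square roots.
  obtain ⟨i, hi, hmin⟩ := Finset.exists_min_image (Finset.range k)
    (fun i => ∑ v ∈ rev.toFinset with label v = i, degIn G es v) ⟨0, by simp; omega⟩
  set S := ∑ v ∈ rev.toFinset with label v = i, degIn G es v with hS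
  have h1 : k * S ≤ 2 * es.length := by
    refine le_trans ?_ hsum
    have := Finset.card_nsmul_le_sum (Finset.range k)
      (fun i => ∑ v ∈ rev.toFinset with label v = i, degIn G es v) S hmin
    simpa using this
  have h2 : 16 * es.length ≤ S ^ 2 := by
    rw [← htsq]
    exact h.large hk i (by simpa using hi)
  have h3 : (k * S) ^ 2 ≤ (2 * es.length) ^ 2 := Nat.pow_le_pow_left h1 2
  have h4 : (k * k) * (16 * es.length) ≤ (k * S) ^ 2 := by
    calc (k * k) * (16 * es.length) ≤ (k * k) * S ^ 2 := Nat.mul_le_mul_left _ h2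
      _ = (k * S) ^ 2 := by ring
  have h5 : (4 * (k * k)) * (4 * es.length) ≤ es.length * (4 * es.length) := by
    calc (4 * (k * k)) * (4 * es.length) = (k * k) * (16 * es.length) := by ring
      _ ≤ (2 * es.length) ^ 2 := h4.trans h3
      _ = es.length * (4 * es.length) := by ring
  exact Nat.le_of_mul_le_mul_right h5 (by omega)

/-- Edges between unused parts that survive in a maximal packing. -/
theorem length_le_of_maximal {T : Forest n m} {rev : List (Fin n)} {tsq k : ℕ} {c : Fin n → ℕ}
    {label : Fin n → ℕ} {top : Fin n → Bool} {G : MGraph n m} {es : List (Fin m)}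
    (h : IsSplit T rev c tsq label top k) (hes : es.Nodup)
    (hends : ∀ e ∈ es, (G e).1 ∈ rev ∧ (G e).2 ∈ rev) {used : ℕ → Bool}
    (h2 : ∀ i j, i < j → j < k → used i = true ∨ used j = true ∨
      ((contractParts G es T label top k).val i j).length ≤ 1)
    (h1 : ∀ i, i < k → used i = true ∨ (contractParts G es T label top k).val i i = []) :
    (es.filter fun e => !used (label (G e).1) && !used (label (G e).2)).length ≤
      rev.length + (k * k - k) := by
  set F := es.filter fun e => !used (label (G e).1) && !used (label (G e).2) with hF
  have hFn : F.Nodup := hes.filter _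
  set nt : Fin m → Bool := fun e => !(isPartTreeEdge T top (G e).1 e ||
        isPartTreeEdge T top (G e).2 e) with hnt
  have hsplit : F.toFinset.card = (F.toFinset.filter fun e => nt e = true).card +
      (F.toFinset.filter fun e => ¬ nt e = true).card :=
    (Finset.card_filter_add_card_filter_not _).symm
  rw [← List.toFinset_card_of_nodup hFn, hsplit, add_comm]
  have hFmem : ∀ e ∈ F, e ∈ es ∧ used (label (G e).1) = false ∧ used (label (G e).2) = false := by
    intro e he
    rw [hF, List.mem_filter] at he
    simpa using he
  refine Nat.add_le_add ?_ ?_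
  -- A part tree edge is the edge from one of its ends to the parent, so there are at most as many
  -- as vertices.
  · have : (F.toFinset.filter fun e => ¬ nt e = true).image some ⊆
        rev.toFinset.image fun v => (T.par v).map Prod.snd := by
      intro x hx
      simp only [Finset.mem_image, Finset.mem_filter, List.mem_toFinset] at hx
      obtain ⟨e, ⟨he, hne⟩, rfl⟩ := hx
      have hh := hends e (hFmem e he).1
      simp only [hnt, Bool.not_eq_true, Bool.not_eq_false', Bool.or_eq_true, isPartTreeEdge,
        Bool.and_eq_true, decide_eq_true_eq] at hne
      simp only [Finset.mem_image, List.mem_toFinset]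
      rcases hne with hne | hne
      · exact ⟨_, hh.1, hne.2⟩
      · exact ⟨_, hh.2, hne.2⟩
    have h3 := Finset.card_le_card this
    rw [Finset.card_image_of_injective _ (Option.some_injective _)] at h3
    exact h3.trans (Finset.card_image_le.trans (List.toFinset_card_le _))
  -- Any other edge is sent to its pair of labels. Maximality rules out equal labels and two edges
  -- with the same pair.
  · have hoff : ((Finset.range k).offDiag).card = k * k - k := by simp [Finset.offDiag_card]
    rw [← hoff]
    have hor : ∀ e ∈ F, nt e = true → orient G label e ∈ (contractParts G es T label top k).val
        (label (orient G label e).1) (label (orient G label e).2.2) := by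
      intro e he hne
      rw [contractParts_val, List.mem_filter]
      refine ⟨List.mem_map_of_mem (List.mem_filter.2 ⟨by simpa using (hFmem e he).1, hne⟩), ?_⟩
      simp
    have hlab : ∀ e ∈ F, label (orient G label e).1 < k ∧ label (orient G label e).2.2 < k ∧
        used (label (orient G label e).1) = false ∧
        used (label (orient G label e).2.2) = false := by
      intro e he
      obtain ⟨g1, g2, g3⟩ := hFmem e he
      obtain ⟨g4, g5⟩ := hends e g1
      have g6 := h.lt _ g4
      have g7 := h.lt _ g5
      unfold orient
      split_ifs <;> simp_all
    have hltF : ∀ e ∈ F, nt e = true →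
        label (orient G label e).1 < label (orient G label e).2.2 := by
      intro e he hne
      obtain ⟨g1, g2, g3, g4⟩ := hlab e he
      have g5 := hor e he hne
      refine lt_of_le_of_ne (orient_spec G label e).2.2 fun heq => ?_
      rw [← heq] at g5
      rcases h1 _ g1 with g6 | g6
      · rw [g3] at g6; simp at g6
      · rw [g6] at g5; simp at g5
    refine Finset.card_le_card_of_injOn
      (fun e => (label (orient G label e).1, label (orient G label e).2.2)) ?_ ?_
    · intro e he
      simp only [Finset.coe_filter, List.mem_toFinset, Set.mem_ofPred_eq] at he
      obtain ⟨g1, g2, -⟩ := hlab e he.1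
      have := hltF e he.1 he.2
      simp [g1, g2]
      omega
    · intro e he e' he' heq
      simp only [Finset.coe_filter, List.mem_toFinset, Set.mem_ofPred_eq] at he he'
      simp only [Prod.mk.injEq] at heq
      have g5 := hor e he.1 he.2
      have g6 := hor e' he'.1 he'.2
      rw [← heq.1, ← heq.2] at g6
      obtain ⟨g1, g2, g3, g4⟩ := hlab e he.1
      rcases h2 _ _ (hltF e he.1 he.2) g2 with g7 | g7 | g7
      · rw [g3] at g7; simp at g7
      · rw [g4] at g7; simp at g7
      · have g8 : orient G label e = orient G label e' := by
          set l := (contractParts G es T label top k).val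
            (label (orient G label e).1) (label (orient G label e).2.2)
          rcases l with _ | ⟨x, _ | ⟨y, l⟩⟩
          · simp at g5
          · simp at g5 g6; rw [g5, g6]
          · simp at g7
        rw [← (orient_spec G label e).1, g8, (orient_spec G label e').1]

theorem isDartTable_contractParts {T : Forest n m} {rev : List (Fin n)}
    {label : Fin n → ℕ} {top : Fin n → Bool} {G : MGraph n m} {es : List (Fin m)} (k : ℕ)
    (hends : ∀ e ∈ es, (G e).1 ∈ rev ∧ (G e).2 ∈ rev) :
    IsDartTable G es T rev label top (contractParts G es T label top k).val := by
  intro i j d hd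
  rw [contractParts_val] at hd
  simp only [List.mem_filter, List.mem_map, List.mem_reverse, Bool.and_eq_true,
    decide_eq_true_eq, Bool.not_eq_true', Bool.or_eq_false_iff] at hd
  obtain ⟨⟨e, ⟨he, hn1, hn2⟩, rfl⟩, hi, hj⟩ := hd
  obtain ⟨h1, h2⟩ := hends e he
  refine ⟨hi, hj, ?_, ?_, ?_⟩
  · rw [(orient_spec G label e).1]; exact he
  · rw [(orient_spec G label e).1]; exact (orient_spec G label e).2.1
  · unfold orient
    split_ifs
    · exact ⟨h1, h2, hn1, hn2⟩
    · exact ⟨h2, h1, hn2, hn1⟩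

/-- For the last claim, deleting the used parts leaves at most `vs.length` part tree edges and at
most `k * k - k ≤ es.length / 4` edges between unused parts. With `N` cycles it removes at most `2 *
N * (2 * (Δ + t * Δ))` edges; multiply by four. The number `t` is left free so that one value serves
all components. In the length bound, `8 * B + 2` is `4 * D + 2` for tree depth `D = 2 * B`. -/
theorem oneRoundShortCycle_spec {G : MGraph n m} {vs : List (Fin n)} {es : List (Fin m)}
    (hne : vs ≠ []) (hvs : vs.Nodup) (hes : es.Nodup)
    (hends : ∀ e ∈ es, (G e).1 ∈ vs ∧ (G e).2 ∈ vs) {B : ℕ}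
    (hB : ∀ u ∈ vs, ∀ v ∈ vs, ∃ P, G.IsWalk u P v ∧ (∀ x ∈ P, x.2 ∈ es) ∧ P.length ≤ B) :
    (∀ C ∈ (oneRoundShortCycle G vs es).val, G.IsCycle C ∧ (∀ x ∈ C, x.1 ∈ vs ∧ x.2 ∈ es) ∧
      C.length ≤ 8 * B + 2) ∧
    ((oneRoundShortCycle G vs es).val.Pairwise fun C C' =>
      List.Disjoint (C.map Prod.fst) (C'.map Prod.fst)) ∧
    (oneRoundShortCycle G vs es).time ≤ 35 * vs.length + 8 * es.length ∧
    ∀ t Δ, (∀ x, x * x < 16 * es.length → x ≤ t) → (∀ v, degIn G es v ≤ Δ) →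
      3 * es.length ≤ 4 * vs.length +
        16 * ((oneRoundShortCycle G vs es).val.length * (Δ + t * Δ)) := by
  obtain ⟨r, vs', rfl⟩ := List.exists_cons_of_ne_nil hne
  obtain ⟨⟨leaf, hT⟩, hmem, hdep, htime⟩ := spanningTree_spec (r := r) (by simp) hends
    (hB r (by simp))
  have hsplit := treeSplit_spec hT (16 * es.length) (degIn G es)
  have hsplitTime := (treeSplit_eq (16 * es.length) (spanningTree G (r :: vs') es r).val.1
    (spanningTree G (r :: vs') es r).val.2 (degIn G es)).2
  rw [oneRoundShortCycle_cons]
  simp only [Timed.bind_val, Timed.bind_time, degrees_val, degrees_time, Timed.tick_time,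
    contractParts_time, hsplitTime, (greedyCycles_eq _ _).2]
  generalize (treeSplit (16 * es.length) (spanningTree G (r :: vs') es r).val.1
    (spanningTree G (r :: vs') es r).val.2 (degIn G es)).val = p at hsplit ⊢
  obtain ⟨label, top, k⟩ := p
  simp only at hsplit ⊢
  generalize htm : (spanningTree G (r :: vs') es r).time = tm at htime ⊢
  generalize (spanningTree G (r :: vs') es r).val = x at hT hmem hdep hsplit ⊢
  obtain ⟨T, rev⟩ := x
  simp only at hT hmem hdep hsplit ⊢
  generalize hvseq : r :: vs' = vs at *
  have hperm : rev.length = vs.length :=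
    ((List.perm_ext_iff_of_nodup hT.nodup hvs).2 hmem).length_eq
  have hends' : ∀ e ∈ es, (G e).1 ∈ rev ∧ (G e).2 ∈ rev := fun e he =>
    ⟨(hmem _).2 (hends e he).1, (hmem _).2 (hends e he).2⟩
  have hdart := isDartTable_contractParts (T := T) (label := label) (top := top) k hends'
  obtain ⟨hpack, hmax2, hmax1⟩ := greedyCycles_spec (label := label) (k := k)
    (H := (contractParts G es T label top k).val)
    (fun i j d hd => ⟨(hdart i j d hd).1, (hdart i j d hd).2.1⟩) (fun i j => by
      rw [contractParts_val]
      refine List.Nodup.sublist (l₂ := ((es.reverse.filter _).map (orient G label)).map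
        fun d => d.2.1) (List.filter_sublist.map _) ?_
      rw [List.map_map]
      have : ((fun d : Dart n m => d.2.1) ∘ orient G label) = id := by
        funext e; exact (orient_spec G label e).1
      rw [this, List.map_id]
      exact (List.nodup_reverse.2 hes).filter _)
  obtain ⟨hp1, hp2, hp3, hp4⟩ := pullUp_spec (D := 2 * B) (fuel := vs.length + 1) hsplit hT
    (fun v hv => hdep v ((hmem v).1 hv)) (by omega) hdart hpack
  generalize hq : (greedyCycles k (contractParts G es T label top k).val).val = q at *
  -- With at most one part the threshold says nothing, but then `k * k - k = 0` and the table has at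
  -- most one cell.
  have hk4 : k ≤ 1 ∨ 4 * (k * k) ≤ es.length := by
    rcases Nat.lt_or_ge k 2 with hk | hk
    · exact Or.inl (by omega)
    · exact Or.inr (hsplit.four_mul_sq_le hT rfl hk)
  refine ⟨fun C hC => ?_, hp2, ?_, ?_⟩
  · obtain ⟨h1, h2, h3⟩ := hp1 C hC
    exact ⟨h1, fun x hx => ⟨(hmem _).1 (h2 x hx).1, (h2 x hx).2⟩, by omega⟩
  · have hlen : ((pullUp T (vs.length + 1) q.2).val.map List.length).sum ≤ vs.length := by
      have hnd : ((pullUp T (vs.length + 1) q.2).val.flatMap fun C => C.map Prod.fst).Nodup :=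
        List.nodup_flatMap.2 ⟨fun C hC => (hp1 C hC).1.2.1, hp2⟩
      have hsub : ((pullUp T (vs.length + 1) q.2).val.flatMap fun C => C.map Prod.fst) ⊆ vs := by
        intro v hv
        obtain ⟨C, hC, hv⟩ := List.mem_flatMap.1 hv
        obtain ⟨x, hx, rfl⟩ := List.mem_map.1 hv
        exact (hmem _).1 ((hp1 C hC).2.1 x hx).1
      have := (List.subperm_of_subset hnd hsub).length_le
      rw [List.length_flatMap] at this
      simpa using this
    have hpos : 1 ≤ vs.length := List.length_pos_iff.2 hne
    -- The quadratic cost of the table and of the search through all pairs is paid by the edges,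
    -- through `hk4`.
    have hkk : 3 * (k * k) + 4 * k ≤ 7 * vs.length + 2 * es.length := by
      have : k ≤ k * k := Nat.le_mul_self k
      rcases hk4 with h | h
      · interval_cases k <;> omega
      · omega
    omega
  · intro t Δ ht hΔ
    have hX : ∀ v ∈ rev, degIn G es v + t *
        (rev.toFinset.filter fun w => (T.par w).map Prod.fst = some v).card ≤ Δ + t * Δ := by
      intro v hv
      have := card_children_le hT v
      exact Nat.add_le_add (hΔ v) (Nat.mul_le_mul_left _ (this.trans (hΔ v)))
    have hsmall := hsplit.small t (Δ + t * Δ) ht hX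
    have hdel := length_le_filter_add_degIn G es (rev.filter fun v => q.1 (label v))
    have hfil : (es.filter fun e => !decide ((G e).1 ∈ rev.filter fun v => q.1 (label v)) &&
        !decide ((G e).2 ∈ rev.filter fun v => q.1 (label v))) =
        es.filter fun e => !q.1 (label (G e).1) && !q.1 (label (G e).2) := by
      refine List.filter_congr fun e he => ?_
      simp [List.mem_filter, (hends' e he).1, (hends' e he).2]
    have hmaxl := length_le_of_maximal hsplit hes hends' (used := q.1) hmax2 hmax1
    rw [hfil] at hdel
    have hdeg : ((rev.filter fun v => q.1 (label v)).map (degIn G es)).sum ≤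
        (2 * q.2.length) * (2 * (Δ + t * Δ)) := by
      rw [← List.sum_toFinset _ (hT.nodup.filter _)]
      have h1 : ∑ v ∈ (rev.filter fun v => q.1 (label v)).toFinset, degIn G es v =
          ∑ i ∈ (Finset.range k).filter (fun i => q.1 i = true),
            ∑ v ∈ (rev.filter fun v => q.1 (label v)).toFinset with label v = i, degIn G es v := by
        rw [Finset.sum_fiberwise_of_maps_to]
        intro v hv
        simp only [List.mem_toFinset, List.mem_filter] at hv
        simp [hsplit.lt v hv.1, hv.2]
      rw [h1]
      refine (Finset.sum_le_card_nsmul _ _ (2 * (Δ + t * Δ)) fun i hi => ?_).trans ?_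
      · refine le_trans (Finset.sum_le_sum_of_subset ?_) (hsmall i)
        intro v hv
        simp only [Finset.mem_filter, List.mem_toFinset, List.mem_filter] at hv ⊢
        exact ⟨hv.1.1, hv.2⟩
      · rw [smul_eq_mul]
        exact Nat.mul_le_mul_right _ hpack.card_used_le
    have hkk : 4 * (k * k - k) ≤ es.length := by
      rcases hk4 with h | h
      · interval_cases k <;> simp
      · omega
    rw [hp3]
    have : 2 * q.2.length * (2 * (Δ + t * Δ)) = 4 * (q.2.length * (Δ + t * Δ)) := by ring
    omega

end OneRound

/-! ### One round of the main loop -/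

section MainLoop

variable {n m : ℕ}

theorem MGraph.IsCycle.joins_of_mem {G : MGraph n m} {c : Cyc n m} (h : G.IsCycle c)
    {x : Fin n × Fin m} (hx : x ∈ c) : ∃ y, G.Joins x.2 x.1 y := by
  have key : ∀ l l' : Cyc n m, List.Forall₂ (fun x y => G.Joins x.2 x.1 y.1) l l' →
      ∀ x ∈ l, ∃ y, G.Joins x.2 x.1 y := by
    intro l l' hl
    induction hl with
    | nil => simp
    | cons h _ ih =>
      intro x hx
      rcases List.mem_cons.1 hx with rfl | hx
      · exact ⟨_, h⟩
      · exact ih x hx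
  exact key _ _ h.2.2.2 x hx

theorem TreeOrder.reachable {G : MGraph n m} {es : List (Fin m)} {T : Forest n m} {r : Fin n}
    {l : List (Fin n)} (h : TreeOrder G es T r l) {H : SimpleGraph (Fin n)}
    (hH : ∀ e ∈ es, ∀ u v, G.Joins e u v → u ≠ v → H.Adj u v) : ∀ v ∈ l, H.Reachable r v := by
  induction h with
  | root => intro v hv; simp at hv; subst hv; exact .refl _
  | @child l v' p e h hv' hp hpl he hj hd ih =>
    intro v hv
    rcases List.mem_cons.1 hv with rfl | hv
    · exact (ih p hpl).trans (hH e he p v hj (fun h => hv' (h ▸ hpl))).reachable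
    · exact ih v hv

/-- The edges of the current graph that are not in `R`. -/
def keptEdges (s : LoopState n m) (R : Fin s.edges.length → Bool) : List (Fin m) :=
  ((List.finRange s.edges.length).filter fun i => !R i).map s.edges.get

theorem keptEdges_subset (s : LoopState n m) (R : Fin s.edges.length → Bool) :
    keptEdges s R ⊆ s.edges := by
  intro e he
  obtain ⟨i, -, rfl⟩ := List.mem_map.1 he
  exact List.get_mem _ _

theorem nodup_keptEdges {s : LoopState n m} (hs : s.edges.Nodup) (R : Fin s.edges.length → Bool) :
    (keptEdges s R).Nodup :=
  ((List.nodup_finRange _).filter _).map (List.nodup_iff_injective_get.1 hs)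

theorem length_keptEdges (s : LoopState n m) (R : Fin s.edges.length → Bool) :
    s.edges.length = (keptEdges s R).length +
      (Finset.univ.filter fun i => R i = true).card := by
  have h1 : (keptEdges s R).length = (Finset.univ.filter fun i => ¬ R i = true).card := by
    rw [keptEdges, List.length_map, ← List.toFinset_card_of_nodup
      ((List.nodup_finRange _).filter _)]
    congr 1
    ext i
    simp
  have h2 := Finset.card_filter_add_card_filter_not (s := (Finset.univ : Finset (Fin s.edges.length)))
    (fun i => R i = true)
  rw [Finset.card_univ, Fintype.card_fin] at h2
  omega

/-- Diameters are measured in a simple graph on renumbered edges; this carries its walks back to the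
original multigraph without changing their lengths. -/
theorem exists_isWalk_of_walk {G : MGraph n m} {s : LoopState n m}
    {R : Fin s.edges.length → Bool} {u v : Fin n}
    (p : ((s.graph G).simpleMinus R).Walk u v) :
    ∃ P, G.IsWalk u P v ∧ (∀ x ∈ P, x.2 ∈ keptEdges s R) ∧ P.length = p.length := by
  induction p with
  | nil => exact ⟨[], rfl, by simp, rfl⟩
  | @cons u w v h p ih =>
    obtain ⟨P, h1, h2, h3⟩ := ih
    have : ∃ e ∈ keptEdges s R, G.Joins e u w := by
      rw [MGraph.simpleMinus, SimpleGraph.fromRel_adj] at h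
      rcases h.2 with ⟨i, hi, hj⟩ | ⟨i, hi, hj⟩
      · exact ⟨s.edges.get i, List.mem_map_of_mem (by simp [hi]), hj⟩
      · exact ⟨s.edges.get i, List.mem_map_of_mem (by simp [hi]), hj.symm⟩
    obtain ⟨e, he, hj⟩ := this
    refine ⟨(u, e) :: P, ⟨rfl, w, hj, h1⟩, ?_, by simp [h3]⟩
    intro x hx
    rcases List.mem_cons.1 hx with rfl | hx
    · exact he
    · exact h2 x hx

theorem IsComponents.walk_edges {G : MGraph n m} {es : List (Fin m)}
    {comps : List (List (Fin n) × List (Fin m))} (h : IsComponents G es comps)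
    {c : List (Fin n) × List (Fin m)} (hc : c ∈ comps) {P : Cyc n m} {u v : Fin n}
    (hP : G.IsWalk u P v) (hes : ∀ x ∈ P, x.2 ∈ es) (hu : u ∈ c.1) : ∀ x ∈ P, x.2 ∈ c.2 := by
  induction P generalizing u with
  | nil => simp
  | cons x P ih =>
    obtain ⟨rfl, y, hy, hP⟩ := hP
    intro z hz
    rcases List.mem_cons.1 hz with rfl | hz
    · exact h.mem_of_joins hc (hes z (by simp)) hu hy
    · exact ih hP (fun z hz => hes z (by simp [hz]))
        (h.closed c hc _ hu _ _ (hes x (by simp)) hy) z hz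

/-- The invariant of the main loop; `L` bounds the lengths of the cycles. -/
structure LoopInv (G : MGraph n m) (L : ℕ) (s : LoopState n m) : Prop where
  nodup : s.edges.Nodup
  cycles : ∀ c ∈ s.cycles, G.IsCycle c ∧ c.length ≤ L
  disjoint : s.cycles.Pairwise fun c d => List.Disjoint (c.map Prod.fst) (d.map Prod.fst)
  deleted : ∀ c ∈ s.cycles, ∀ v ∈ c.map Prod.fst, ∀ e ∈ s.edges, (G e).1 ≠ v ∧ (G e).2 ≠ v
  covered : s.covered = (s.cycles.map List.length).sum
  edges : m ≤ s.edges.length + G.maxDegree * s.covered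

/-- The loop over the connected components in a round of the main loop. -/
def roundCycles (G : MGraph n m) (comps : List (List (Fin n) × List (Fin m))) :
    Timed (List (Cyc n m)) :=
  Timed.fold (fun (acc : List (Cyc n m)) comp => do
    let C ← oneRoundShortCycle G comp.1 comp.2
    tick C.length
    return C ++ acc) [] comps

/-- Components share no vertices, so their cycles are disjoint and the bounds of
`oneRoundShortCycle_spec` add up. The coefficient `36 = 35 + 1` charges the loop step of a component
to one of its vertices. A value of `t` for all edges also serves each component, which has no more
edges. -/
theorem roundCycles_spec {G : MGraph n m} {es : List (Fin m)} (hes : es.Nodup)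
    {comps : List (List (Fin n) × List (Fin m))} (h : IsComponents G es comps) {B : ℕ}
    (hB : ∀ c ∈ comps, ∀ u ∈ c.1, ∀ v ∈ c.1, ∃ P, G.IsWalk u P v ∧ (∀ x ∈ P, x.2 ∈ c.2) ∧
      P.length ≤ B) :
    (∀ C ∈ (roundCycles G comps).val, G.IsCycle C ∧ (∀ x ∈ C, x.2 ∈ es) ∧ C.length ≤ 8 * B + 2) ∧
    ((roundCycles G comps).val.Pairwise fun C C' =>
      List.Disjoint (C.map Prod.fst) (C'.map Prod.fst)) ∧
    (roundCycles G comps).time ≤ 36 * n + 8 * es.length + (roundCycles G comps).val.length ∧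
    ∀ t, (∀ x, x * x < 16 * es.length → x ≤ t) →
      3 * es.length ≤ 4 * n +
        16 * ((roundCycles G comps).val.length * (G.maxDegree + t * G.maxDegree)) := by
  have hsum1 := h.sum_length_vertices
  have hsum2 := h.sum_length_edges hes
  have hone : ∀ c ∈ comps, _ := fun c hc => oneRoundShortCycle_spec (G := G) (h.ne_nil hc) (h.nodup c hc)
    (h.edges_nodup c hc) (fun e he => h.snd_mem hc he) (hB c hc)
  have key := Timed.fold_induction (f := fun (acc : List (Cyc n m)) comp => (do
      let C ← oneRoundShortCycle G comp.1 comp.2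
      tick C.length
      return C ++ acc : Timed (List (Cyc n m)))) (b := []) (l := comps)
    (fun done acc t => (∀ C ∈ acc, G.IsCycle C ∧ (∀ x ∈ C, x.2 ∈ es) ∧ C.length ≤ 8 * B + 2) ∧
      (∀ C ∈ acc, ∃ c ∈ done, ∀ x ∈ C, x.1 ∈ c.1) ∧
      (acc.Pairwise fun C C' => List.Disjoint (C.map Prod.fst) (C'.map Prod.fst)) ∧
      t ≤ 36 * (done.map fun c => c.1.length).sum + 8 * (done.map fun c => c.2.length).sum
        + acc.length ∧
      ∀ t, (∀ x, x * x < 16 * es.length → x ≤ t) →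
        3 * (done.map fun c => c.2.length).sum ≤ 4 * (done.map fun c => c.1.length).sum +
          16 * (acc.length * (G.maxDegree + t * G.maxDegree)))
    (by simp) (by
      rintro done c rest acc t hl ⟨h1, h2, h3, h4, h5⟩
      have hc : c ∈ comps := by rw [hl]; simp
      obtain ⟨g1, g2, g3, g4⟩ := hone c hc
      have hpos : 1 ≤ c.1.length := List.length_pos_iff.2 (h.ne_nil hc)
      have hdis := h.disjoint
      rw [hl, List.pairwise_append] at hdis
      simp only [Timed.bind_val, Timed.bind_time, Timed.pure_val, Timed.pure_time,
        Timed.tick_time, List.map_append, List.map_cons, List.map_nil, List.sum_append,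
        List.sum_cons, List.sum_nil, List.length_append]
      refine ⟨?_, ?_, ?_, ?_, ?_⟩
      · intro C hC
        rcases List.mem_append.1 hC with hC | hC
        · obtain ⟨f1, f2, f3⟩ := g1 C hC
          exact ⟨f1, fun x hx => ((h.mem_edges c hc _).1 (f2 x hx).2).1, f3⟩
        · exact h1 C hC
      · intro C hC
        rcases List.mem_append.1 hC with hC | hC
        · exact ⟨c, by simp, fun x hx => ((g1 C hC).2.1 x hx).1⟩
        · obtain ⟨c', hc', hx⟩ := h2 C hC
          exact ⟨c', by simp [hc'], hx⟩
      · refine List.pairwise_append.2 ⟨g2, h3, fun C hC C' hC' v hv hv' => ?_⟩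
        obtain ⟨c', hc', hx⟩ := h2 C' hC'
        obtain ⟨x, hx1, rfl⟩ := List.mem_map.1 hv
        obtain ⟨y, hy1, hxy⟩ := List.mem_map.1 hv'
        have h6 := hx y hy1
        rw [hxy] at h6
        exact hdis.2.2 c' hc' c (by simp) h6 ((g1 C hC).2.1 x hx1).1
      · omega
      · intro t' ht'
        have f1 := h5 t' ht'
        have hle : c.2.length ≤ es.length := by
          rw [← hsum2]
          exact List.single_le_sum (by simp) _ (List.mem_map_of_mem hc)
        have f2 := g4 t' G.maxDegree (fun x hx => ht' x (by omega)) (fun v =>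
          (degIn_le_degree G (h.edges_nodup c hc) v).trans (G.degree_le_maxDegree v))
        rw [Nat.add_mul]
        omega)
  obtain ⟨h1, -, h3, h4, h5⟩ := key
  rw [hsum1, hsum2] at h4 h5
  exact ⟨h1, h3, h4, h5⟩

theorem round_verts (l : List (Cyc n m)) :
    let x := Timed.fold (fun (acc : List (Fin n)) (c : Cyc n m) => (do
      tick c.length
      return c.map Prod.fst ++ acc : Timed (List (Fin n)))) [] l
    x.val.length = (l.map List.length).sum ∧ x.time = l.length + (l.map List.length).sum ∧
      (∀ v, v ∈ x.val ↔ ∃ c ∈ l, v ∈ c.map Prod.fst) := by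
  intro x
  have h := Timed.fold_induction (f := fun (acc : List (Fin n)) (c : Cyc n m) => (do
      tick c.length
      return c.map Prod.fst ++ acc : Timed (List (Fin n)))) (b := []) (l := l)
    (fun d acc t => acc.length = (d.map List.length).sum ∧
      t = d.length + (d.map List.length).sum ∧ (∀ v, v ∈ acc ↔ ∃ c ∈ d, v ∈ c.map Prod.fst))
    (by simp) (by
      rintro d a r s t - ⟨h1, h2, h3⟩
      simp only [Timed.bind_val, Timed.bind_time, Timed.pure_val, Timed.pure_time,
        Timed.tick_time, List.map_append, List.map_cons, List.map_nil, List.sum_append,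
        List.sum_cons, List.sum_nil, List.length_append, List.length_map, List.length_singleton]
      refine ⟨by omega, by omega, fun v => ?_⟩
      rw [List.mem_append, h3]
      constructor
      · rintro (h | ⟨c, hc, h⟩)
        · exact ⟨a, by simp, h⟩
        · exact ⟨c, by simp [hc], h⟩
      · rintro ⟨c, hc, h⟩
        rcases List.mem_append.1 hc with hc | hc
        · exact Or.inr ⟨c, hc, h⟩
        · simp at hc; subst hc; exact Or.inl h)
  exact h

theorem sum_length_le_of_disjoint {G : MGraph n m} {l : List (Cyc n m)}
    (hl : ∀ c ∈ l, G.IsCycle c)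
    (hd : l.Pairwise fun c d => List.Disjoint (c.map Prod.fst) (d.map Prod.fst)) :
    (l.flatMap fun c => c.map Prod.fst).Nodup ∧
    (l.map List.length).sum ≤ n ∧ l.length ≤ (l.map List.length).sum := by
  have h1 : (l.flatMap fun c => c.map Prod.fst).Nodup :=
    List.nodup_flatMap.2 ⟨fun c hc => (hl c hc).2.1, hd⟩
  refine ⟨h1, ?_, ?_⟩
  · have := h1.length_le_card
    rw [List.length_flatMap, Fintype.card_fin] at this
    simpa using this
  · clear h1 hd
    induction l with
    | nil => simp
    | cons a l ih =>
      have h2 := ih fun c hc => hl c (by simp [hc])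
      have h3 := List.length_pos_iff.2 (hl a (by simp)).1
      simp only [List.map_cons, List.sum_cons, List.length_cons]
      omega

/-- At least `11 / 12` of the edges are kept. Inserting this into `3 * kept ≤ 4 * n + 16 * ...` and
multiplying by four gives the constants `11`, `16` and `64`. Here `N` counts the vertices on the new
cycles, which are at least as many as the cycles. -/
theorem roundAfterDecomp_spec {G : MGraph n m} {B : ℕ} {s : LoopState n m}
    (hs : LoopInv G (8 * B + 2) s) {R : Fin s.edges.length → Bool}
    (hR : 12 * (Finset.univ.filter fun i => R i = true).card ≤ s.edges.length)
    (hB : ∀ u v, ((s.graph G).simpleMinus R).Reachable u v →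
      ((s.graph G).simpleMinus R).dist u v ≤ B) :
    LoopInv G (8 * B + 2) (roundAfterDecomp G s R).val ∧
    (roundAfterDecomp G s R).time ≤ 60 * n + 20 * s.edges.length ∧
    ∃ N, (roundAfterDecomp G s R).val.covered = s.covered + N ∧
      (roundAfterDecomp G s R).val.edges.length ≤ s.edges.length ∧
      ∀ t, (∀ x, x * x < 16 * s.edges.length → x ≤ t) →
        11 * s.edges.length ≤ 16 * n + 64 * (N * (G.maxDegree + t * G.maxDegree)) := by
  have hkn := nodup_keptEdges hs.nodup R
  have hkl := length_keptEdges s R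
  obtain ⟨hcomp, hct⟩ := components_spec G hkn
  have hadj : ∀ e ∈ keptEdges s R, ∀ u v, G.Joins e u v → u ≠ v →
      ((s.graph G).simpleMinus R).Adj u v := by
    intro e he u v hj huv
    obtain ⟨i, hi, rfl⟩ := List.mem_map.1 he
    rw [MGraph.simpleMinus, SimpleGraph.fromRel_adj]
    exact ⟨huv, Or.inl ⟨i, by simpa using hi, hj⟩⟩
  have hwalk : ∀ c ∈ (components G (keptEdges s R)).val, ∀ u ∈ c.1, ∀ v ∈ c.1,
      ∃ P, G.IsWalk u P v ∧ (∀ x ∈ P, x.2 ∈ c.2) ∧ P.length ≤ B := by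
    intro c hc u hu v hv
    obtain ⟨T, r, hT⟩ := hcomp.tree c hc
    have huv := (hT.reachable hadj u hu).symm.trans (hT.reachable hadj v hv)
    obtain ⟨p, hp⟩ := huv.exists_walk_length_eq_dist
    obtain ⟨P, h1, h2, h3⟩ := exists_isWalk_of_walk p
    refine ⟨P, h1, hcomp.walk_edges hc h1 h2 hu, ?_⟩
    rw [h3, hp]
    exact hB u v huv
  obtain ⟨n1, n2, n3, n4⟩ := roundCycles_spec hkn hcomp hwalk
  obtain ⟨v1, v2, v3⟩ := round_verts (roundCycles G (components G (keptEdges s R)).val).val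
  obtain ⟨-, w2, w3⟩ := sum_length_le_of_disjoint (fun C hC => (n1 C hC).1) n2
  have hval : (roundAfterDecomp G s R).val =
      ⟨s.edges.filter fun e =>
        !decide ((G e).1 ∈ (Timed.fold (fun (acc : List (Fin n)) (c : Cyc n m) => (do
      tick c.length
      return c.map Prod.fst ++ acc : Timed (List (Fin n)))) []
        (roundCycles G (components G (keptEdges s R)).val).val).val) &&
        !decide ((G e).2 ∈ (Timed.fold (fun (acc : List (Fin n)) (c : Cyc n m) => (do
      tick c.length
      return c.map Prod.fst ++ acc : Timed (List (Fin n)))) []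
        (roundCycles G (components G (keptEdges s R)).val).val).val),
      (roundCycles G (components G (keptEdges s R)).val).val ++ s.cycles,
      s.covered + (Timed.fold (fun (acc : List (Fin n)) (c : Cyc n m) => (do
      tick c.length
      return c.map Prod.fst ++ acc : Timed (List (Fin n)))) []
        (roundCycles G (components G (keptEdges s R)).val).val).val.length⟩ := by
    simp only [roundAfterDecomp, Timed.bind_val, Timed.pure_val, Timed.filter_val,
      deleteVerts_val]
    rfl
  have htime : (roundAfterDecomp G s R).time = 2 * s.edges.length + ((keptEdges s R).length +
      ((components G (keptEdges s R)).time +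
      ((roundCycles G (components G (keptEdges s R)).val).time +
      ((Timed.fold (fun (acc : List (Fin n)) (c : Cyc n m) => (do
      tick c.length
      return c.map Prod.fst ++ acc : Timed (List (Fin n)))) []
        (roundCycles G (components G (keptEdges s R)).val).val).time +
      ((n + (Timed.fold (fun (acc : List (Fin n)) (c : Cyc n m) => (do
      tick c.length
      return c.map Prod.fst ++ acc : Timed (List (Fin n)))) []
        (roundCycles G (components G (keptEdges s R)).val).val).val.length +
        2 * ([] : List (Fin n)).length + 2 * s.edges.length) +
      (((roundCycles G (components G (keptEdges s R)).val).val.length +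
        (Timed.fold (fun (acc : List (Fin n)) (c : Cyc n m) => (do
      tick c.length
      return c.map Prod.fst ++ acc : Timed (List (Fin n)))) []
        (roundCycles G (components G (keptEdges s R)).val).val).val.length) + 0)))))) := by
    have hk : ((List.finRange s.edges.length).filter fun i => !R i).length =
        (keptEdges s R).length := by simp [keptEdges]
    simp only [roundAfterDecomp, Timed.bind_time, Timed.pure_time, Timed.filter_val,
      Timed.filter_time, deleteVerts_time, Timed.tick_time, List.length_finRange, hk]
    rfl
  generalize hx : Timed.fold (fun (acc : List (Fin n)) (c : Cyc n m) => (do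
      tick c.length
      return c.map Prod.fst ++ acc : Timed (List (Fin n)))) []
        (roundCycles G (components G (keptEdges s R)).val).val = x at *
  generalize roundCycles G (components G (keptEdges s R)).val = y at *
  rw [hval, htime]
  refine ⟨⟨hs.nodup.filter _, ?_, ?_, ?_, ?_, ?_⟩, ?_, x.val.length, rfl, ?_, ?_⟩
  · intro c hc
    rcases List.mem_append.1 hc with hc | hc
    · exact ⟨(n1 c hc).1, (n1 c hc).2.2⟩
    · exact hs.cycles c hc
  -- A vertex on a new cycle is incident to an edge of the current graph, and a vertex on an old
  -- cycle is not.
  · refine List.pairwise_append.2 ⟨n2, hs.disjoint, fun C hC C' hC' v hv hv' => ?_⟩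
    obtain ⟨z, hz, rfl⟩ := List.mem_map.1 hv
    have h1 := hs.deleted C' hC' _ hv' z.2 (keptEdges_subset s R ((n1 C hC).2.1 z hz))
    obtain ⟨w, hw⟩ := (n1 C hC).1.joins_of_mem hz
    rcases hw with hw | hw <;> simp [hw] at h1
  · intro c hc v hv e he
    rw [List.mem_filter] at he
    obtain ⟨he1, he2⟩ := he
    rcases List.mem_append.1 hc with hc | hc
    · have hvx := (v3 v).2 ⟨c, hc, hv⟩
      simp only [Bool.and_eq_true, Bool.not_eq_true', decide_eq_false_iff_not] at he2
      exact ⟨fun h => he2.1 (h ▸ hvx), fun h => he2.2 (h ▸ hvx)⟩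
    · exact hs.deleted c hc v hv e he1
  · simp only [List.map_append, List.sum_append]
    rw [hs.covered, v1, add_comm]
  · have h1 := length_le_filter_add_degIn G s.edges x.val
    have h2 : (x.val.map (degIn G s.edges)).sum ≤ G.maxDegree * x.val.length := by
      have := List.sum_le_card_nsmul (x.val.map (degIn G s.edges)) G.maxDegree (by
        intro d hd
        obtain ⟨v, -, rfl⟩ := List.mem_map.1 hd
        exact (degIn_le_degree G hs.nodup v).trans (G.degree_le_maxDegree v))
      rw [List.length_map, smul_eq_mul] at this
      rwa [mul_comm]
    have h3 := hs.edges
    simp only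
    rw [Nat.mul_add]
    omega
  · simp only [List.length_nil]
    omega
  · exact List.length_filter_le _ _
  · intro t ht
    have h1 := n4 t fun z hz => ht z (by omega)
    have h2 : y.val.length * (G.maxDegree + t * G.maxDegree) ≤
        x.val.length * (G.maxDegree + t * G.maxDegree) := Nat.mul_le_mul_right _ (by omega)
    omega

end MainLoop

/-! ### The main loop -/

/-! ### Conditioning on a random choice, and the union bound. -/

section Probability

/-- Outcomes outside `s` are simply given up. The restriction to the support is there because the
time bound of a decomposition procedure holds only there. -/
theorem PMF.mul_le_toOuterMeasure_bind {α β : Type} (p : PMF α) (f : α → PMF β) {s : Set α}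
    {t : Set β} {c : ENNReal} (h : ∀ a ∈ s, a ∈ p.support → c ≤ (f a).toOuterMeasure t) :
    c * p.toOuterMeasure s ≤ (p.bind f).toOuterMeasure t := by
  rw [PMF.toOuterMeasure_bind_apply, PMF.toOuterMeasure_apply, ← ENNReal.tsum_mul_left]
  refine ENNReal.tsum_le_tsum fun a => ?_
  by_cases ha : a ∈ s
  · rw [Set.indicator_of_mem ha, mul_comm]
    by_cases hp : p a = 0
    · simp [hp]
    · exact mul_le_mul_right (h a ha ((PMF.mem_support_iff p a).2 hp)) _
  · simp [Set.indicator_of_notMem ha]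

/-- The union bound for two successive stages, valid also where the subtraction is truncated. -/
theorem ENNReal.one_sub_add_le_mul (x y : ENNReal) : 1 - (x + y) ≤ (1 - x) * (1 - y) := by
  rw [← tsub_tsub, ENNReal.mul_sub (fun _ _ => (tsub_le_self.trans_lt ENNReal.one_lt_top).ne),
    mul_one]
  refine tsub_le_tsub_left ?_ _
  calc (1 - x) * y ≤ 1 * y := by gcongr; exact tsub_le_self
    _ = y := one_mul y

end Probability

section Loop

variable {n m : ℕ}

/-- A valid output of ImprovedShortCycle whose cycles have length at most `L`. -/
structure IsOutput (G : MGraph n m) (L : ℕ) (C : List (Cyc n m)) : Prop where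
  cycles : ∀ c ∈ C, G.IsCycle c ∧ c.length ≤ L
  disjoint : C.Pairwise fun c d => List.Disjoint (c.map Prod.fst) (d.map Prod.fst)
  covered : m ≤ 10 * G.maxDegree * (C.map List.length).sum

/-- For disjoint cycles the sum of the lengths is the number of covered vertices, which turns the
inequality between integers into the quotient of the guarantee. -/
theorem IsOutput.guarantee {G : MGraph n m} {L : ℕ} {cycles : List (Cyc n m)}
    (h : IsOutput G L cycles) {C : ℝ} (hC : 2 ≤ n → (L : ℝ) ≤ C * Real.log n) :
    (∀ c ∈ cycles, G.IsCycle c ∧ (2 ≤ n → (c.length : ℝ) ≤ C * Real.log n)) ∧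
      cycles.Pairwise (fun c d => Disjoint c.verts d.verts) ∧
      (m : ℝ) / (10 * G.maxDegree) ≤
        (((Finset.univ.filter fun v => ∃ c ∈ cycles, v ∈ c.verts).card : ℕ) : ℝ) := by
  refine ⟨fun c hc => ⟨(h.cycles c hc).1, fun hn => le_trans ?_ (hC hn)⟩, ?_, ?_⟩
  · exact_mod_cast (h.cycles c hc).2
  · refine h.disjoint.imp fun hcd => ?_
    rw [Finset.disjoint_left]
    intro v hv hv'
    exact hcd (by simpa [Cyc.verts] using hv) (by simpa [Cyc.verts] using hv')
  · obtain ⟨h1, -, -⟩ := sum_length_le_of_disjoint (fun c hc => (h.cycles c hc).1) h.disjoint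
    have h2 : (cycles.map List.length).sum =
        (Finset.univ.filter fun v => ∃ c ∈ cycles, v ∈ c.verts).card := by
      have h3 : (cycles.map List.length).sum = (cycles.flatMap fun c => c.map Prod.fst).length := by
        rw [List.length_flatMap]; simp
      rw [h3, ← List.toFinset_card_of_nodup h1]
      congr 1
      ext v
      simp [Cyc.verts]
    rw [← h2]
    refine div_le_of_le_mul₀ (by positivity) (by positivity) ?_
    have := h.covered
    have h4 : (m : ℝ) ≤ 10 * G.maxDegree * (cycles.map List.length).sum := by exact_mod_cast this
    linarith

/-- The number of steps of a round of the main loop with a decomposition procedure that takes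
`A (n + m)` steps. -/
noncomputable def roundCost (A : ℝ) (n : ℕ) : ℝ := 1 + 10 * n + |A| * (11 * n) + 260 * n

/-- Hypothesis `hq` says that `q` further rounds, each raising `Δ * covered` by at least `n / (1 +
t)`, bring it to `n`, which is the stopping condition. Induction on `q` then multiplies the success
probabilities of the rounds. The fuel is `q + 1` because the last call only tests that the loop has
ended. -/
theorem mainLoop_spec {A b : ℝ} {D : DecompProc} (hD : IsLowDiamDecomp (1 / 12) b A D)
    {G : MGraph n m} (hn : 1 ≤ n) (hm : m = 10 * n) {B t : ℕ}
    (hB : 12 * |A| * Real.log n < B + 1) (ht : ∀ x, x * x < 160 * n → x ≤ t) (q : ℕ)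
    {s : LoopState n m} (hs : LoopInv G (8 * B + 2) s) (hsm : s.edges.length ≤ m)
    (hq : (1 + t) * n ≤ (1 + t) * (G.maxDegree * s.covered) + q * n) :
    1 - q * ENNReal.ofReal ((n : ℝ) ^ (-b)) ≤
      (mainLoop D G G.maxDegree (q + 1) s).toOuterMeasure
        {out | (out.time : ℝ) ≤ 1 + q * roundCost A n ∧
          ∃ cycles, out.val = some cycles ∧ IsOutput G (8 * B + 2) cycles} := by
  induction q generalizing s with
  | zero =>
    have hcov : n ≤ G.maxDegree * s.covered :=
      Nat.le_of_mul_le_mul_left (by simpa using hq) (by omega : 0 < 1 + t)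
    have hdone : m ≤ 10 * G.maxDegree * s.covered := by rw [mul_assoc]; omega
    rw [mainLoop, if_pos hdone]
    refine tsub_le_self.trans (le_of_eq ?_)
    symm
    rw [PMF.toOuterMeasure_apply_eq_one_iff]
    intro out hout
    rw [PMF.mem_support_pure_iff] at hout
    subst hout
    exact ⟨by simp, _, rfl, hs.cycles, hs.disjoint, by rw [← hs.covered]; exact hdone⟩
  | succ q ih =>
    by_cases hdone : m ≤ 10 * G.maxDegree * s.covered
    · rw [mainLoop, if_pos hdone]
      refine tsub_le_self.trans (le_of_eq ?_)
      symm
      rw [PMF.toOuterMeasure_apply_eq_one_iff]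
      intro out hout
      rw [PMF.mem_support_pure_iff] at hout
      subst hout
      refine ⟨?_, _, rfl, hs.cycles, hs.disjoint, by rw [← hs.covered]; exact hdone⟩
      have : 0 ≤ ((q + 1 : ℕ) : ℝ) * roundCost A n := by unfold roundCost; positivity
      simpa using this
    · rw [mainLoop, if_neg hdone]
      obtain ⟨htime, hprob⟩ := hD n s.edges.length (s.graph G) hn
      have h1 : ENNReal.ofReal (1 - (n : ℝ) ^ (-b)) =
          1 - ENNReal.ofReal ((n : ℝ) ^ (-b)) := by
        rw [ENNReal.ofReal_sub _ (by positivity), ENNReal.ofReal_one]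
      rw [h1] at hprob
      rw [Nat.cast_succ, add_mul, one_mul]
      refine (ENNReal.one_sub_add_le_mul _ _).trans ?_
      refine (mul_le_mul_right hprob _).trans ?_
      refine PMF.mul_le_toOuterMeasure_bind _ _ ?_
      rintro R ⟨hR1, hR2⟩ hRs
      have hR1' : 12 * (Finset.univ.filter fun i => R.val i = true).card ≤ s.edges.length := by
        have : (12 * (Finset.univ.filter fun i => R.val i = true).card : ℝ) ≤ s.edges.length := by
          linarith
        exact_mod_cast this
      have hR2' : ∀ u v, ((s.graph G).simpleMinus R.val).Reachable u v →
          ((s.graph G).simpleMinus R.val).dist u v ≤ B := by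
        intro u v huv
        have h2 := hR2 u v huv
        have hlog : 0 ≤ Real.log n := Real.log_natCast_nonneg n
        have h3 : A * (1 / 12 : ℝ)⁻¹ * Real.log n ≤ 12 * |A| * Real.log n := by
          refine mul_le_mul_of_nonneg_right ?_ hlog
          have := le_abs_self A
          norm_num
          linarith
        have h4 : (((s.graph G).simpleMinus R.val).dist u v : ℝ) < ((B + 1 : ℕ) : ℝ) := by
          push_cast
          linarith
        have h5 : ((s.graph G).simpleMinus R.val).dist u v < B + 1 := by exact_mod_cast h4
        omega
      obtain ⟨g1, g2, N, g3, g4, g5⟩ := roundAfterDecomp_spec hs hR1' hR2'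
      -- The loop has not ended, so `Δ * covered < n` and more than `9 * n` edges are left. From `11
      -- * edges ≤ 16 * n + 64 * X` it follows that `83 * n ≤ 64 * X`, where `X` is the right-hand
      -- side.
      have hprog : n ≤ (1 + t) * (G.maxDegree * N) := by
        have f1 := g5 t fun x hx => ht x (by omega)
        have f2 := hs.edges
        have f3 : N * (G.maxDegree + t * G.maxDegree) = (1 + t) * (G.maxDegree * N) := by ring
        have f4 : G.maxDegree * s.covered < n := by
          rw [mul_assoc] at hdone
          omega
        rw [f3] at f1
        omega
      have hq' : (1 + t) * n ≤ (1 + t) * (G.maxDegree * (roundAfterDecomp G s R.val).val.covered)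
          + q * n := by
        rw [g3, Nat.mul_add, Nat.mul_add]
        rw [add_mul q 1 n] at hq
        omega
      refine (ih g1 (g4.trans hsm) hq').trans ?_
      rw [PMF.toOuterMeasure_map_apply]
      refine (PMF.toOuterMeasure _).mono ?_
      rintro out ⟨ho1, ho2⟩
      refine ⟨?_, ho2⟩
      -- The cost of the round matches `roundCost`: one step for the test, at most `10 * n` for
      -- copying the edges, at most `|A| * (11 * n)` for the decomposition, and at most `60 * n + 20
      -- * (10 * n)` for the rest.
      have f1 := htime R hRs
      have f2 : ((roundAfterDecomp G s R.val).time : ℝ) ≤ 60 * n + 20 * s.edges.length := by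
        exact_mod_cast g2
      have f3 : (s.edges.length : ℝ) ≤ 10 * n := by
        have : s.edges.length ≤ 10 * n := by omega
        exact_mod_cast this
      have f4 : A * ((n : ℝ) + s.edges.length) ≤ |A| * (11 * n) := by
        refine (mul_le_mul_of_nonneg_right (le_abs_self A) (by positivity)).trans ?_
        refine mul_le_mul_of_nonneg_left ?_ (abs_nonneg A)
        linarith
      push_cast
      have f5 : roundCost A n = 1 + 10 * n + |A| * (11 * n) + 260 * n := rfl
      rw [add_mul, one_mul]
      linarith

theorem foldl_max_eq_sup {α : Type} [DecidableEq α] (f : α → ℕ) (l : List α) (x : ℕ) :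
    l.foldl (fun x v => max x (f v)) x = max x (l.toFinset.sup f) := by
  induction l generalizing x with
  | nil => simp
  | cons a l ih =>
    rw [List.foldl_cons, ih, List.toFinset_cons, Finset.sup_insert]
    exact max_assoc x (f a) _

theorem improvedShortCycle_of_large {a A : ℝ} {D : DecompProc}
    (hD : IsLowDiamDecomp (1 / 12) (a + 2) A D) {G : MGraph n m} (hn : 100 < n)
    (hm : m = 10 * n) :
    ENNReal.ofReal (1 - (n : ℝ) ^ (-a)) ≤
      (improvedShortCycle D (2 + Nat.sqrt (160 * n)) G).toOuterMeasure
        {out | (out.time : ℝ) ≤ 24 * n + (1 + Nat.sqrt (160 * n) : ℕ) * roundCost A n ∧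
          ∃ cycles, out.val = some cycles ∧
            IsOutput G (8 * ⌊12 * |A| * Real.log n⌋₊ + 2) cycles} := by
  set B := ⌊12 * |A| * Real.log n⌋₊ with hBdef
  set t := Nat.sqrt (160 * n) with htdef
  have hB : 12 * |A| * Real.log n < B + 1 := Nat.lt_floor_add_one _
  have ht : ∀ x, x * x < 160 * n → x ≤ t := fun x hx => Nat.le_sqrt.2 hx.le
  have hinit : LoopInv G (8 * B + 2) ⟨List.finRange m, [], 0⟩ :=
    ⟨List.nodup_finRange m, by simp, by simp, by simp, by simp, by simp⟩
  -- With nothing covered yet, `q = 1 + t` makes the hypothesis on `q` an equality.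
  have key := mainLoop_spec hD (by omega) hm hB ht (1 + t) hinit (by simp) (by simp)
  have hΔ : (do
      let d ← degrees G (List.finRange n) (List.finRange m)
      Timed.fold (fun x v => pure (max x (d v))) 0 (List.finRange n) : Timed ℕ).val =
      G.maxDegree := by
    simp only [Timed.bind_val, degrees_val, Timed.fold_val, Timed.pure_val]
    rw [foldl_max_eq_sup, MGraph.maxDegree, List.toFinset_finRange, Nat.zero_max]
    exact congrArg _ (funext fun v => degIn_finRange G v)
  have hΔt : (do
      let d ← degrees G (List.finRange n) (List.finRange m)
      Timed.fold (fun x v => pure (max x (d v))) 0 (List.finRange n) : Timed ℕ).time =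
      n + m + n := by
    simp
  rw [improvedShortCycle, if_neg (by omega)]
  simp only [hΔ, hΔt]
  rw [PMF.toOuterMeasure_map_apply]
  have hfuel : 2 + t = 1 + t + 1 := by omega
  rw [hfuel]
  -- This is where the exponent `a + 2` is needed: there are `1 + t ≤ n ^ 2` rounds, each failing
  -- with probability at most `n ^ (-(a + 2))`.
  have hε : ENNReal.ofReal (1 - (n : ℝ) ^ (-a)) ≤
      1 - ((1 + t : ℕ) : ENNReal) * ENNReal.ofReal ((n : ℝ) ^ (-(a + 2))) := by
    rw [ENNReal.ofReal_sub _ (by positivity), ENNReal.ofReal_one]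
    refine tsub_le_tsub_left ?_ _
    rw [← ENNReal.ofReal_natCast, ← ENNReal.ofReal_mul (by positivity)]
    refine ENNReal.ofReal_le_ofReal ?_
    have hnpos : (0 : ℝ) < n := by exact_mod_cast (by omega : 0 < n)
    have h1 : (n : ℝ) ^ (-a) = (n : ℝ) ^ 2 * (n : ℝ) ^ (-(a + 2)) := by
      rw [← Real.rpow_natCast, ← Real.rpow_add hnpos]
      congr 1
      push_cast
      ring
    rw [h1]
    refine mul_le_mul_of_nonneg_right ?_ (by positivity)
    have h2 : t ≤ 2 * n := by
      refine (Nat.sqrt_le_sqrt (by nlinarith : 160 * n ≤ (2 * n) * (2 * n))).trans ?_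
      rw [Nat.sqrt_eq]
    have h3 : 1 + t ≤ n ^ 2 := by nlinarith
    exact_mod_cast h3
  refine hε.trans (key.trans ((PMF.toOuterMeasure _).mono ?_))
  rintro out ⟨ho1, ho2⟩
  refine ⟨?_, ho2⟩
  -- Outside the rounds there are `m` steps for the list of edges, `2 * n + m` for the maximum
  -- degree and two single steps, together `22 * n + 2`.
  have : (m : ℝ) = 10 * n := by rw [hm]; push_cast; ring
  push_cast at ho1 ⊢
  have hn' : (100 : ℝ) < n := by exact_mod_cast hn
  linarith

/-- For `n ≤ 100` there are finitely many multigraphs with `10 * n` edges, so some number `T` bounds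
the time of `naiveShortCycle` on all of them. -/
theorem shortCycleGuarantee_of_naive {a A : ℝ}
    (hnaive : ∀ n (G : MGraph n (10 * n)), 1 ≤ n → n ≤ 100 →
      IsOutput G 100 (naiveShortCycle G).val) :
    ∃ C : ℝ, ∀ D : DecompProc, IsLowDiamDecomp (1 / 12) (a + 2) A D →
      ShortCycleGuarantee a C D := by
  have hT : ∃ T : ℕ, ∀ n ≤ 100, ∀ G : MGraph n (10 * n), (naiveShortCycle G).time ≤ T := by
    refine ⟨(Finset.range 101).sup fun n => (Finset.univ : Finset (MGraph n (10 * n))).sup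
      fun G => (naiveShortCycle G).time, fun n hn G => ?_⟩
    refine le_trans ?_ (Finset.le_sup (f := fun n => (Finset.univ :
      Finset (MGraph n (10 * n))).sup fun G => (naiveShortCycle G).time)
      (Finset.mem_range.2 (by omega : n < 101)))
    exact Finset.le_sup (f := fun G : MGraph n (10 * n) => (naiveShortCycle G).time)
      (Finset.mem_univ G)
  obtain ⟨T, hT⟩ := hT
  -- The four summands serve, in this order, the time and the cycle length for `n ≤ 100`, and the
  -- time and the cycle length for `n > 100`.
  refine ⟨(1 + T) + 200 + (24 + 14 * (271 + 11 * |A|)) + (96 * |A| + 2), fun D hD n m G hn hm => ?_⟩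
  subst hm
  set C : ℝ := (1 + T) + 200 + (24 + 14 * (271 + 11 * |A|)) + (96 * |A| + 2) with hC
  have hA := abs_nonneg A
  have hTn : (0 : ℝ) ≤ T := Nat.cast_nonneg T
  have hn1 : (1 : ℝ) ≤ n := by exact_mod_cast hn
  have hsq : 1 ≤ Real.sqrt n := Real.one_le_sqrt.2 hn1
  by_cases hsmall : n ≤ 100
  · refine ⟨0, ?_⟩
    rw [improvedShortCycle, if_pos hsmall]
    have hone : (PMF.pure (⟨some (naiveShortCycle G).val, 1 + (naiveShortCycle G).time⟩ :
        Timed (Option (List (Cyc n (10 * n)))))).toOuterMeasure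
        {out | (out.time : ℝ) ≤ C * ((10 * n : ℕ) : ℝ) * Real.sqrt n ∧
          ∃ cycles : List (Cyc n (10 * n)), out.val = some cycles ∧
            (∀ c ∈ cycles, G.IsCycle c ∧ (2 ≤ n → (c.length : ℝ) ≤ C * Real.log n)) ∧
            cycles.Pairwise (fun c d => Disjoint c.verts d.verts) ∧
            ((10 * n : ℕ) : ℝ) / (10 * G.maxDegree) ≤
              (((Finset.univ.filter fun v => ∃ c ∈ cycles, v ∈ c.verts).card : ℕ) : ℝ)} = 1 := by
      rw [PMF.toOuterMeasure_apply_eq_one_iff]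
      intro out hout
      rw [PMF.mem_support_pure_iff] at hout
      subst hout
      refine ⟨?_, _, rfl, (hnaive n G hn hsmall).guarantee fun hn2 => ?_⟩
      · have h1 : (((1 + (naiveShortCycle G).time : ℕ)) : ℝ) ≤ 1 + T := by
          push_cast
          have := hT n hsmall G
          have : ((naiveShortCycle G).time : ℝ) ≤ T := by exact_mod_cast this
          linarith
        refine h1.trans ?_
        have h2 : (1 + T : ℝ) ≤ C := by rw [hC]; linarith
        have h3 : (1 : ℝ) ≤ ((10 * n : ℕ) : ℝ) := by push_cast; linarith
        have hC0 : 0 ≤ C := by linarith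
        calc (1 + T : ℝ) ≤ C * 1 * 1 := by linarith
          _ ≤ C * ((10 * n : ℕ) : ℝ) * Real.sqrt n := by gcongr
      -- Cycles have length at most `100`, and `log 2 > 1 / 2`.
      · have h1 : Real.log 2 ≤ Real.log n :=
          Real.log_le_log (by norm_num) (by exact_mod_cast hn2)
        have h2 := Real.log_two_gt_d9
        have h3 : (200 : ℝ) ≤ C := by rw [hC]; linarith
        push_cast
        nlinarith
    refine le_trans ?_ (le_of_eq hone.symm)
    rw [← ENNReal.ofReal_one]
    refine ENNReal.ofReal_le_ofReal ?_
    have : 0 ≤ (n : ℝ) ^ (-a) := by positivity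
    linarith
  · refine ⟨_, (improvedShortCycle_of_large hD (G := G) (by omega) rfl).trans
      ((PMF.toOuterMeasure _).mono ?_)⟩
    rintro out ⟨ho1, cycles, ho2, ho3⟩
    have hs0 : Real.sqrt n * Real.sqrt n = n := Real.mul_self_sqrt (by positivity)
    refine ⟨ho1.trans ?_, cycles, ho2, ho3.guarantee fun hn2 => ?_⟩
    -- As `160 < 13 ^ 2`, the number of rounds is at most `14 * √n`; a round costs at most `271 + 11
    -- * |A|` steps per vertex.
    · have h1 : ((1 + Nat.sqrt (160 * n) : ℕ) : ℝ) ≤ 14 * Real.sqrt n := by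
        have h2 : ((Nat.sqrt (160 * n) : ℕ) : ℝ) ≤ 13 * Real.sqrt n := by
          refine (Real.nat_sqrt_le_real_sqrt).trans ?_
          rw [Real.sqrt_le_left (by positivity)]
          push_cast
          nlinarith
        push_cast
        linarith
      have h2 : roundCost A n ≤ (271 + 11 * |A|) * n := by
        unfold roundCost
        nlinarith
      have h3 : ((1 + Nat.sqrt (160 * n) : ℕ) : ℝ) * roundCost A n ≤
          14 * Real.sqrt n * ((271 + 11 * |A|) * n) :=
        mul_le_mul h1 h2 (by unfold roundCost; positivity) (by positivity)
      have h4 : (24 + 14 * (271 + 11 * |A|) : ℝ) ≤ C := by rw [hC]; linarith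
      have h5 : (24 * n : ℝ) ≤ 24 * (n * Real.sqrt n) := by nlinarith
      calc 24 * (n : ℝ) + ((1 + Nat.sqrt (160 * n) : ℕ) : ℝ) * roundCost A n
          ≤ (24 + 14 * (271 + 11 * |A|)) * (n * Real.sqrt n) := by linarith
        _ ≤ C * (n * Real.sqrt n) := by gcongr
        _ ≤ C * ((10 * n : ℕ) : ℝ) * Real.sqrt n := by
          push_cast
          have : 0 ≤ C * (n * Real.sqrt n) := by
            have : 0 ≤ C := by rw [hC]; positivity
            positivity
          linarith
    -- Since `log n ≥ 1`, the constant `2` in `8 * B + 2` is absorbed.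
    · have hlog : 1 ≤ Real.log n := by
        rw [Real.le_log_iff_exp_le (by linarith)]
        have := Real.exp_one_lt_d9
        have h3 : (100 : ℝ) < n := by exact_mod_cast (by omega : 100 < n)
        linarith
      have h1 : (⌊12 * |A| * Real.log n⌋₊ : ℝ) ≤ 12 * |A| * Real.log n :=
        Nat.floor_le (by positivity)
      push_cast
      have h2 : (96 * |A| + 2 : ℝ) ≤ C := by rw [hC]; linarith
      have h3 : (96 * |A| + 2) * Real.log n ≤ C * Real.log n := by gcongr
      linarith

end Loop

/-! ### NaiveShortCycle -/

section Naive

variable {n m : ℕ}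

theorem count_fst_adjList_le (G : MGraph n m) {es : List (Fin m)} (hes : es.Nodup) (u : Fin n)
    (e : Fin m) : ((adjList G es u).map fun x => if x.1 = e then 1 else 0).sum ≤ 2 := by
  rw [sum_adjList, ← List.sum_toFinset _ hes]
  calc _ ≤ ∑ f ∈ es.toFinset, if f = e then 2 else 0 := by
        refine Finset.sum_le_sum fun f _ => ?_
        simp only
        split_ifs <;> simp
    _ ≤ 2 := by
        rw [Finset.sum_ite_eq']
        split_ifs <;> simp

/-- One edge fills at most two entries of an adjacency list, so three entries contain another edge.
With the parent edge as `e`, this keeps the search for a cycle from getting stuck. -/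
theorem exists_mem_adjList_ne (G : MGraph n m) {es : List (Fin m)} (hes : es.Nodup) {u : Fin n}
    (hu : 3 ≤ degIn G es u) (e : Option (Fin m)) : ∃ x ∈ adjList G es u, e ≠ some x.1 := by
  by_contra! h
  rw [← length_adjList] at hu
  obtain ⟨y, hy⟩ := List.exists_mem_of_length_pos (by omega : 0 < (adjList G es u).length)
  have h1 := count_fst_adjList_le G hes u y.1
  have h2 : ((adjList G es u).map fun x => if x.1 = y.1 then 1 else 0) =
      (adjList G es u).map fun _ => 1 := by
    refine List.map_congr_left fun x hx => ?_
    have := (h x hx).symm.trans (h y hy)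
    rw [if_pos (Option.some.inj this)]
  rw [h2] at h1
  simp at h1
  omega

/-- An edge that is not a loop is listed only once. -/
theorem not_mem_of_adjList_eq (G : MGraph n m) {es : List (Fin m)} (hes : es.Nodup) {u w : Fin n}
    {e : Fin m} (huw : u ≠ w) {d l : List (Fin m × Fin n)}
    (h : adjList G es u = d ++ (e, w) :: l) : (e, w) ∉ d := by
  intro hmem
  have h1 : ((adjList G es u).map fun x => if x = (e, w) then 1 else 0).sum ≤ 1 := by
    rw [sum_adjList, ← List.sum_toFinset _ hes]
    calc _ ≤ ∑ f ∈ es.toFinset, if f = e then 1 else 0 := by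
          refine Finset.sum_le_sum fun f _ => ?_
          by_cases hf : f = e
          · subst hf
            simp only [Prod.mk.injEq, true_and, if_true]
            split_ifs with h1 h2 h3 h4 h5 h6 <;> omega
          · simp [hf]
      _ ≤ 1 := by
          rw [Finset.sum_ite_eq']
          split_ifs <;> simp
  have h2 : 1 ≤ (d.map fun x => if x = (e, w) then 1 else 0).sum := by
    have := List.single_le_sum (l := d.map fun x => if x = (e, w) then 1 else 0) (by simp) 1
      (List.mem_map.2 ⟨(e, w), hmem, by simp⟩)
    exact this
  rw [h, List.map_append, List.sum_append, List.map_cons, List.sum_cons, if_pos rfl] at h1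
  omega

/-- The state of the search for a cycle from `r`: `l₀` lists the vertices reached before the current
layer was scanned, `next` those reached since then, and `us` those of the layer that are not scanned
yet. -/
structure SearchInv (G : MGraph n m) (es : List (Fin m)) (r : Fin n) (T : Forest n m)
    (next l₀ us : List (Fin n)) : Prop where
  tree : TreeOrder G es T r (next ++ l₀)
  seen : ∀ v, T.seen v = true ↔ v ∈ next ++ l₀
  par : ∀ w p e, w ∈ next ++ l₀ → T.par w = some (p, e) → p ∈ l₀ ∧ p ∉ us
  subset : us ⊆ l₀
  nodup : us.Nodup

/-- The edge `e = uw` closes a cycle with edges of the tree of `T` on `l`. -/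
structure IsClosing (G : MGraph n m) (es : List (Fin m)) (r : Fin n) (T : Forest n m)
    (l : List (Fin n)) (u : Fin n) (e : Fin m) (w : Fin n) : Prop where
  tree : TreeOrder G es T r l
  left_mem : u ∈ l
  right_mem : w ∈ l
  joins : G.Joins e u w
  par_ne : u ≠ w → ∀ c ∈ l, ∀ p, T.par c ≠ some (p, e)

/-- The list `d` is the part of the adjacency list already scanned, and by `hd` it contains all tree
edges from `u` to its children. If an entry `(e, w)` meets a reached vertex, `e` is no tree edge. As
an edge from `u` to a child it would be listed in `d` already, and as the edge from `u` to its
parent it would have been skipped. -/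
theorem scanForCycle_spec {G : MGraph n m} {es : List (Fin m)} (hes : es.Nodup) {r u : Fin n}
    {l₀ us : List (Fin n)} (hu : u ∈ l₀) (hus : u ∉ us) {d rest : List (Fin m × Fin n)}
    (hadj : adjList G es u = d ++ rest) {T : Forest n m} {next : List (Fin n)}
    (h : SearchInv G es r T next l₀ us)
    (hd : ∀ w e, w ∈ next ++ l₀ → T.par w = some (u, e) → (e, w) ∈ d) :
    ∃ T' next', SearchInv G es r T' next' l₀ us ∧
      (((scanForCycle u rest (T, next)).val = ((T', next'), none) ∧
          ((next ≠ [] ∨ ∃ x ∈ rest, (T.par u).map Prod.snd ≠ some x.1) → next' ≠ [])) ∨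
        ∃ e w, (scanForCycle u rest (T, next)).val = ((T', next'), some (u, e, w)) ∧
          IsClosing G es r T' (next' ++ l₀) u e w) := by
  induction rest generalizing d T next with
  | nil => exact ⟨T, next, h, Or.inl ⟨rfl, by simp⟩⟩
  | cons x rest ih =>
    obtain ⟨e, w⟩ := x
    have hmem : (e, w) ∈ adjList G es u := by rw [hadj]; simp
    obtain ⟨he, hj⟩ := mem_adjList.1 hmem
    have hadj' : adjList G es u = (d ++ [(e, w)]) ++ rest := by rw [hadj]; simp
    by_cases h1 : (T.par u).map Prod.snd = some e
    · obtain ⟨T', next', h2, h3⟩ := ih hadj' h fun w' e' hw' hp =>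
        List.mem_append_left _ (hd w' e' hw' hp)
      refine ⟨T', next', h2, ?_⟩
      have hrun : (scanForCycle u ((e, w) :: rest) (T, next)).val =
          (scanForCycle u rest (T, next)).val := by
        simp [scanForCycle, h1]
      rw [hrun]
      refine h3.imp_left fun ⟨h4, h5⟩ => ⟨h4, fun h6 => h5 (h6.imp_right ?_)⟩
      rintro ⟨x, hx, hne⟩
      rcases List.mem_cons.1 hx with rfl | hx
      · exact absurd h1 hne
      · exact ⟨x, hx, hne⟩
    · by_cases h2 : T.seen w = true
      · refine ⟨T, next, h, Or.inr ⟨e, w, by simp [scanForCycle, h1, h2], h.tree, by simp [hu],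
          (h.seen w).1 h2, hj, fun hne c hc p hp => ?_⟩⟩
        obtain ⟨-, -, -, hj', -⟩ := h.tree.of_par hc hp
        rcases hj'.cases_eq hj with ⟨rfl, rfl⟩ | ⟨rfl, rfl⟩
        · exact not_mem_of_adjList_eq G hes hne hadj (hd _ _ hc hp)
        · exact h1 (by rw [hp]; rfl)
      · have hw : w ∉ next ++ l₀ := fun hw => h2 ((h.seen w).2 hw)
        have hu' : u ∈ next ++ l₀ := List.mem_append_right _ hu
        have hne : ∀ v ∈ next ++ l₀, v ≠ w := fun v hv hvw => hw (hvw ▸ hv)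
        have hpar : ∀ v ∈ next ++ l₀, (T.addChild u e w).par v = T.par v := fun v hv => by
          simp [Forest.addChild, Function.update_of_ne (hne v hv)]
        have hparw : (T.addChild u e w).par w = some (u, e) := by simp [Forest.addChild]
        have h' : SearchInv G es r (T.addChild u e w) (w :: next) l₀ us := by
          refine ⟨h.tree.addChild hu' hw he hj, fun v => ?_, fun w' p f hw' hp => ?_, h.subset,
            h.nodup⟩
          · by_cases hvw : v = w
            · subst hvw; simp [Forest.addChild]
            · simpa [Forest.addChild, Function.update_of_ne hvw, hvw] using h.seen v
          · rcases List.mem_cons.1 hw' with rfl | hw'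
            · rw [hparw] at hp
              simp only [Option.some.injEq, Prod.mk.injEq] at hp
              obtain ⟨rfl, rfl⟩ := hp
              exact ⟨hu, hus⟩
            · rw [hpar w' hw'] at hp
              exact h.par w' p f hw' hp
        obtain ⟨T', next', h3, h4⟩ := ih hadj' h' fun w' f hw' hp => by
          rcases List.mem_cons.1 hw' with rfl | hw'
          · rw [hparw] at hp
            simp only [Option.some.injEq, Prod.mk.injEq, true_and] at hp
            subst hp
            simp
          · rw [hpar w' hw'] at hp
            exact List.mem_append_left _ (hd w' f hw' hp)
        refine ⟨T', next', h3, ?_⟩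
        have hrun : (scanForCycle u ((e, w) :: rest) (T, next)).val =
            (scanForCycle u rest (T.addChild u e w, w :: next)).val := by
          simp [scanForCycle, h1, h2]
        rw [hrun]
        exact h4.imp_left fun ⟨h5, h6⟩ => ⟨h5, fun _ => h6 (Or.inl (by simp))⟩

/-- By the field `par`, no reached vertex has a parent that is still to be scanned, so the scan of a
vertex begins with an empty `d`. Degree at least `3` provides an edge other than the parent edge, so
each scan enlarges the next layer or closes a cycle. -/
theorem scanLayerForCycle_spec {G : MGraph n m} {es : List (Fin m)} (hes : es.Nodup) {r : Fin n}
    {l₀ us : List (Fin n)} (hdeg : ∀ u ∈ l₀, 3 ≤ degIn G es u) {T : Forest n m}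
    {next : List (Fin n)} (h : SearchInv G es r T next l₀ us) :
    ∃ T' next', (scanLayerForCycle (adjList G es) us (T, next)).val.1 = (T', next') ∧
      (((scanLayerForCycle (adjList G es) us (T, next)).val.2 = none ∧
          SearchInv G es r T' next' l₀ [] ∧ (next ≠ [] ∨ us ≠ [] → next' ≠ [])) ∨
        ∃ u e w, (scanLayerForCycle (adjList G es) us (T, next)).val.2 = some (u, e, w) ∧
          IsClosing G es r T' (next' ++ l₀) u e w) := by
  induction us generalizing T next with
  | nil => exact ⟨T, next, rfl, Or.inl ⟨rfl, h, by simp⟩⟩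
  | cons u us ih =>
    have hu : u ∈ l₀ := h.subset (by simp)
    have hnd := List.nodup_cons.1 h.nodup
    have h' : SearchInv G es r T next l₀ us :=
      ⟨h.tree, h.seen, fun w p e hw hp => ⟨(h.par w p e hw hp).1,
        fun hm => (h.par w p e hw hp).2 (List.mem_cons_of_mem _ hm)⟩,
        fun x hx => h.subset (List.mem_cons_of_mem _ hx), hnd.2⟩
    obtain ⟨T₁, next₁, h1, h2⟩ := scanForCycle_spec hes hu hnd.1 (d := []) (rest := adjList G es u)
      rfl h' fun w e hw hp => absurd (h.par w u e hw hp).2 (by simp)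
    rcases h2 with ⟨h2, h3⟩ | ⟨e, w, h2, h3⟩
    · obtain ⟨T', next', h4, h5⟩ := ih h1
      have hrun : (scanLayerForCycle (adjList G es) (u :: us) (T, next)).val =
          (scanLayerForCycle (adjList G es) us (T₁, next₁)).val := by
        simp [scanLayerForCycle, h2]
      rw [hrun]
      refine ⟨T', next', h4, h5.imp_left fun ⟨h6, h7, h8⟩ => ⟨h6, h7, fun _ => h8 (Or.inl ?_)⟩⟩
      exact h3 (Or.inr (exists_mem_adjList_ne G hes (hdeg u hu) _))
    · have hrun : (scanLayerForCycle (adjList G es) (u :: us) (T, next)).val =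
          ((T₁, next₁), some (u, e, w)) := by
        simp [scanLayerForCycle, h2]
      rw [hrun]
      exact ⟨T₁, next₁, rfl, Or.inr ⟨u, e, w, rfl, h3⟩⟩

/-- The tree path from `w` to `u` is followed by `e`. This fails to be a cycle only if the path is
`e` itself, which `par_ne` excludes. -/
theorem IsClosing.isCycle {G : MGraph n m} {es : List (Fin m)} {r : Fin n} {T : Forest n m}
    {l : List (Fin n)} {u w : Fin n} {e : Fin m} (h : IsClosing G es r T l u e w) :
    G.IsCycle (treePath T (n + 1) w u [(u, e)]).val ∧
      ∀ x ∈ (treePath T (n + 1) w u [(u, e)]).val, x.1 ∈ l := by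
  have hlen : l.length ≤ n + 1 := by
    have := h.tree.nodup.length_le_card
    rw [Fintype.card_fin] at this
    omega
  obtain ⟨P, h1, h2, h3, h4, -, -⟩ := treePath_spec h.tree (S := fun _ => True)
    (Q := fun _ => True) (by simp) hlen h.right_mem h.left_mem trivial trivial [(u, e)]
  rw [h1]
  refine ⟨MGraph.IsWalk.isCycle' (a := w) (h2.append (.single h.joins)) (by simp)
    (by simpa using h3) fun x y hxy => ?_, fun x hx => ?_⟩
  · cases P with
    | nil => simp at hxy
    | cons z P =>
      obtain ⟨hz, -⟩ := h2
      simp only [List.cons_append, List.cons.injEq] at hxy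
      obtain ⟨rfl, hxy⟩ := hxy
      cases P with
      | cons z' P => simp at hxy
      | nil =>
        simp only [List.nil_append, List.cons.injEq, and_true] at hxy
        subst hxy
        obtain ⟨-, -, c, p, hc, -, -, hp⟩ := h4 z (by simp)
        intro hze
        refine h.par_ne ?_ c hc p (by rw [hp, hze])
        rintro rfl
        simp [hz] at h3
  · rcases List.mem_append.1 hx with hx | hx
    · exact (h4 x hx).1
    · simp at hx; subst hx; exact h.left_mem

/-- Without a closing edge every layer is followed by a nonempty one, so the tree would outgrow the
`n` vertices before the fuel is spent. -/
theorem findCycle_spec {G : MGraph n m} {vs : List (Fin n)} {es : List (Fin m)} (hes : es.Nodup)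
    (hmem : ∀ e ∈ es, (G e).1 ∈ vs ∧ (G e).2 ∈ vs) (hdeg : ∀ u ∈ vs, 3 ≤ degIn G es u) {r : Fin n}
    (hr : r ∈ vs) {fuel : ℕ} {l₀ us : List (Fin n)} {T : Forest n m}
    (h : SearchInv G es r T [] l₀ us) (hus : us ≠ []) (hfuel : n < l₀.length + fuel) :
    ∃ c, (findCycle (adjList G es) fuel T us).val = some c ∧ G.IsCycle c ∧
      ∀ x ∈ c, x.1 ∈ vs := by
  have hsub : ∀ (T : Forest n m) (l : List (Fin n)), TreeOrder G es T r l → l ⊆ vs :=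
    fun T l hT => hT.subset hr hmem
  induction fuel generalizing l₀ us T with
  | zero =>
    have := h.tree.nodup.length_le_card
    rw [Fintype.card_fin] at this
    simp at this hfuel
    omega
  | succ fuel ih =>
    cases us with
    | nil => exact absurd rfl hus
    | cons u us =>
      obtain ⟨T', next, h1, h2⟩ := scanLayerForCycle_spec hes
        (fun u hu => hdeg u (hsub T _ h.tree hu)) h
      rcases h2 with ⟨h2, h3, h4⟩ | ⟨u', e, w, h2, h3⟩
      · have hnext := h4 (Or.inr (by simp))
        obtain ⟨c, h5, h6⟩ := ih (l₀ := next ++ l₀) (us := next) (T := T')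
          ⟨h3.tree, h3.seen, fun w p e hw hp => ⟨List.mem_append_right _ (h3.par w p e hw hp).1,
            fun hm => List.disjoint_of_nodup_append h3.tree.nodup hm (h3.par w p e hw hp).1⟩,
            List.subset_append_left _ _, (List.nodup_append.1 h3.tree.nodup).1⟩ hnext (by
            have := List.length_pos_of_ne_nil hnext
            rw [List.length_append]; omega)
        refine ⟨c, ?_, h6⟩
        simp [findCycle, h1, h2, h5]
      · obtain ⟨h4, h5⟩ := h3.isCycle
        refine ⟨_, ?_, h4, fun x hx => hsub _ _ h3.tree (h5 x hx)⟩
        simp [findCycle, h1, h2]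

theorem findCycle_root {G : MGraph n m} {vs : List (Fin n)} {es : List (Fin m)} (hes : es.Nodup)
    (hmem : ∀ e ∈ es, (G e).1 ∈ vs ∧ (G e).2 ∈ vs) (hdeg : ∀ u ∈ vs, 3 ≤ degIn G es u) {r : Fin n}
    (hr : r ∈ vs) :
    ∃ c, (findCycle (adjList G es) n (Forest.empty.addRoot r) [r]).val = some c ∧ G.IsCycle c ∧
      ∀ x ∈ c, x.1 ∈ vs := by
  refine findCycle_spec hes hmem hdeg hr (l₀ := [r])
    ⟨TreeOrder.addRoot _, fun v => ?_, fun w p e hw hp => ?_, by simp, by simp⟩ (by simp) (by simp)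
  · by_cases hv : v = r
    · subst hv; simp [Forest.addRoot]
    · simp [Forest.addRoot, Forest.empty, hv]
  · simp at hw
    subst hw
    simp [Forest.addRoot] at hp

/-- The accounting is in `hm`: the deleted edges number at most two for each deleted vertex plus the
maximum degree for each vertex on a cycle. When no vertices are left there are no edges left either.
-/
theorem naiveLoop_spec {G : MGraph n m} {fuel : ℕ} {vs : List (Fin n)} {es : List (Fin m)}
    {C : List (Cyc n m)} (hfuel : vs.length ≤ fuel) (hes : es.Nodup)
    (hmem : ∀ e ∈ es, (G e).1 ∈ vs ∧ (G e).2 ∈ vs) (hC : ∀ c ∈ C, G.IsCycle c)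
    (hdisj : C.Pairwise fun c d => List.Disjoint (c.map Prod.fst) (d.map Prod.fst))
    (hvs : ∀ c ∈ C, ∀ v ∈ vs, v ∉ c.map Prod.fst)
    (hm : m + 2 * vs.length ≤ es.length + 2 * n + G.maxDegree * (C.map List.length).sum) :
    (∀ c ∈ (naiveLoop G fuel vs es C).val, G.IsCycle c) ∧
      ((naiveLoop G fuel vs es C).val.Pairwise fun c d =>
        List.Disjoint (c.map Prod.fst) (d.map Prod.fst)) ∧
      m ≤ 2 * n + G.maxDegree * ((naiveLoop G fuel vs es C).val.map List.length).sum := by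
  have hend : ∀ {es : List (Fin m)} {C : List (Cyc n m)},
      (∀ e ∈ es, (G e).1 ∈ ([] : List (Fin n)) ∧ (G e).2 ∈ ([] : List (Fin n))) →
      m + 2 * 0 ≤ es.length + 2 * n + G.maxDegree * (C.map List.length).sum →
      m ≤ 2 * n + G.maxDegree * (C.map List.length).sum := by
    intro es C hmem hm
    have : es = [] := List.eq_nil_iff_forall_not_mem.2 fun e he => by simpa using hmem e he
    subst this
    simpa using hm
  induction fuel generalizing vs es C with
  | zero =>
    obtain rfl := List.length_eq_zero_iff.1 (Nat.le_zero.1 hfuel)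
    exact ⟨hC, hdisj, hend hmem hm⟩
  | succ fuel ih =>
    cases vs with
    | nil => exact ⟨hC, hdisj, hend hmem hm⟩
    | cons r vs =>
      have hsplit := length_le_filter_add_degIn G es
      have hlt : ∀ (del : List (Fin n)) v, v ∈ del → v ∈ r :: vs →
          ((r :: vs).filter fun v => !decide (v ∈ del)).length < (r :: vs).length := by
        intro del v hv hvs
        rw [List.length_filter_lt_length_iff_exists]
        exact ⟨v, hvs, by simpa using hv⟩
      have hmem' : ∀ del : List (Fin n),
          ∀ e ∈ es.filter fun e => !decide ((G e).1 ∈ del) && !decide ((G e).2 ∈ del),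
          (G e).1 ∈ ((r :: vs).filter fun v => !decide (v ∈ del)) ∧
            (G e).2 ∈ ((r :: vs).filter fun v => !decide (v ∈ del)) := by
        intro del e he
        simp only [List.mem_filter, Bool.and_eq_true] at he ⊢
        exact ⟨⟨(hmem e he.1).1, he.2.1⟩, (hmem e he.1).2, he.2.2⟩
      by_cases hlow : ∃ u us, (r :: vs).filter (fun v => decide (degIn G es v ≤ 2)) = u :: us
      · obtain ⟨u, us, hlow⟩ := hlow
        have hu : u ∈ (r :: vs).filter (fun v => decide (degIn G es v ≤ 2)) := by
          rw [hlow]; simp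
        simp only [List.mem_filter, decide_eq_true_eq] at hu
        have hrun : (naiveLoop G (fuel + 1) (r :: vs) es C).val =
            (naiveLoop G fuel ((r :: vs).filter fun v => !decide (v ∈ [u]))
              (es.filter fun e => !decide ((G e).1 ∈ [u]) && !decide ((G e).2 ∈ [u])) C).val := by
          rw [naiveLoop]
          simp only [Timed.bind_val, degrees_val, Timed.filter_val]
          rw [hlow]
          simp only [Timed.bind_val, deleteVerts_val]
        rw [hrun]
        have h1 := hlt [u] u (by simp) hu.1
        have h2 := hsplit [u]
        simp only [List.map_cons, List.map_nil, List.sum_cons, List.sum_nil] at h2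
        exact ih (by omega) (hes.filter _) (hmem' [u]) hC hdisj
          (fun c hc v hv => hvs c hc v (List.mem_of_mem_filter hv)) (by omega)
      · have hlow' : (r :: vs).filter (fun v => decide (degIn G es v ≤ 2)) = [] := by
          by_contra hne
          obtain ⟨u, us, h⟩ := List.exists_cons_of_ne_nil hne
          exact hlow ⟨u, us, h⟩
        obtain ⟨c, h1, h2, h3⟩ := findCycle_root hes hmem (fun u hu => by
          have := List.filter_eq_nil_iff.1 hlow' u hu
          simp at this
          omega) (List.mem_cons_self (a := r))
        have hrun : (naiveLoop G (fuel + 1) (r :: vs) es C).val =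
            (naiveLoop G fuel ((r :: vs).filter fun v => !decide (v ∈ c.map Prod.fst))
              (es.filter fun e => !decide ((G e).1 ∈ c.map Prod.fst) &&
                !decide ((G e).2 ∈ c.map Prod.fst)) (c :: C)).val := by
          rw [naiveLoop]
          simp only [Timed.bind_val, degrees_val, Timed.filter_val]
          rw [hlow']
          simp only [Timed.bind_val, Timed.tabulate_val, buildAdj_val, h1, deleteVerts_val]
        rw [hrun]
        obtain ⟨x, hx⟩ := List.exists_mem_of_ne_nil _ h2.1
        have h4 := hlt (c.map Prod.fst) x.1 (List.mem_map_of_mem hx) (h3 x hx)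
        have h5 := hsplit (c.map Prod.fst)
        have h6 : ((c.map Prod.fst).map (degIn G es)).sum ≤ c.length * G.maxDegree := by
          have := List.sum_le_card_nsmul ((c.map Prod.fst).map (degIn G es)) G.maxDegree
            (fun x hx => by
              obtain ⟨v, -, rfl⟩ := List.mem_map.1 hx
              exact (degIn_le_degree G hes v).trans (G.degree_le_maxDegree v))
          simpa using this
        have h7 : G.maxDegree * ((c :: C).map List.length).sum =
            c.length * G.maxDegree + G.maxDegree * (C.map List.length).sum := by
          rw [List.map_cons, List.sum_cons]; ring
        refine ih (by omega) (hes.filter _) (hmem' (c.map Prod.fst)) ?_ ?_ ?_ (by omega)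
        · intro d hd
          rcases List.mem_cons.1 hd with rfl | hd
          · exact h2
          · exact hC d hd
        · refine List.pairwise_cons.2 ⟨fun d hd v hv hv' => ?_, hdisj⟩
          obtain ⟨y, hy, rfl⟩ := List.mem_map.1 hv
          exact hvs d hd _ (h3 y hy) hv'
        · intro d hd v hv
          have hv' := List.mem_filter.1 hv
          rcases List.mem_cons.1 hd with rfl | hd
          · simpa using hv'.2
          · exact hvs d hd v hv'.1

theorem naiveShortCycle_isOutput (G : MGraph n (10 * n)) (hn : n ≤ 100) :
    IsOutput G 100 (naiveShortCycle G).val := by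
  obtain ⟨h1, h2, h3⟩ := naiveLoop_spec (G := G) (fuel := n) (vs := List.finRange n)
    (es := List.finRange (10 * n)) (C := []) (by simp) (List.nodup_finRange _) (by simp) (by simp)
    (by simp) (by simp) (by simp)
  refine ⟨fun c hc => ⟨h1 c hc, ?_⟩, h2, ?_⟩
  · have := (h1 c hc).2.1.length_le_card
    rw [List.length_map, Fintype.card_fin] at this
    omega
  -- From `10 * n ≤ 2 * n + Δ * L`, with `L` the sum of the lengths, one has `8 * n ≤ Δ * L`, while
  -- only `n ≤ Δ * L` is needed.
  · rw [naiveShortCycle, mul_assoc]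
    omega

end Naive

/-! ### Ball growing -/

section Growing

theorem Timed.ext {α : Type} {x y : Timed α} (hv : x.val = y.val) (ht : x.time = y.time) :
    x = y := by
  cases x; cases y; simp_all

variable {n m : ℕ}

/-- One step of the construction of the next layer of the cluster with center `v`. -/
def claimStep (v : Fin n) (s : (Fin n → Option (Fin n)) × List (Fin n))
    (x : Fin n × Fin m × Fin n) : (Fin n → Option (Fin n)) × List (Fin n) :=
  if s.1 x.2.2 = none then (Function.update s.1 x.2.2 (some v), x.2.2 :: s.2) else s

/-- The clusters after the cluster with center `v` has grown beyond `layer`, and the new layer. -/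
def claimLayer (adj : Fin n → List (Fin m × Fin n)) (v : Fin n) (layer : List (Fin n))
    (cl : Fin n → Option (Fin n)) : (Fin n → Option (Fin n)) × List (Fin n) :=
  (adjDarts adj layer).foldl (claimStep v) (cl, [])

/-- The number of entries of the adjacency lists of `layer` that lead to vertices without a
cluster. -/
def layerCut (adj : Fin n → List (Fin m × Fin n)) (layer : List (Fin n))
    (cl : Fin n → Option (Fin n)) : ℕ :=
  (layer.map fun u => ((adj u).map fun x => if cl x.2 = none then 1 else 0).sum).sum

theorem List.foldl_add_sum {α : Type} (f : α → ℕ) (l : List α) (x : ℕ) :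
    l.foldl (fun x a => x + f a) x = x + (l.map f).sum := by
  induction l generalizing x with
  | nil => simp
  | cons a l ih => rw [List.foldl_cons, ih, List.map_cons, List.sum_cons, add_assoc]

/-- A layer is scanned once to compute the cut and, if the cluster keeps growing, once more to claim
the next layer; hence the factor `2` in the second time. -/
theorem growCluster_succ (k : ℕ) (adj : Fin n → List (Fin m × Fin n)) (v : Fin n) (fuel : ℕ)
    (layer : List (Fin n)) (w : ℕ) (cl : Fin n → Option (Fin n)) :
    growCluster k adj v (fuel + 1) layer w cl =
      if 2 * k * n * layerCut adj layer cl ≤ m + n * w then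
        ⟨cl, 1 + (layer.map fun u => 1 + (adj u).length).sum⟩
      else
        ⟨(growCluster k adj v fuel (claimLayer adj v layer cl).2 (w + layerCut adj layer cl)
            (claimLayer adj v layer cl).1).val,
          1 + 2 * (layer.map fun u => 1 + (adj u).length).sum +
          (growCluster k adj v fuel (claimLayer adj v layer cl).2 (w + layerCut adj layer cl)
            (claimLayer adj v layer cl).1).time⟩ := by
  have hcut : Timed.fold (fun x u =>
      Timed.fold (fun x (ew : Fin m × Fin n) =>
        pure (if cl ew.2 = none then x + 1 else x)) x (adj u)) 0 layer =
      ⟨layerCut adj layer cl, (layer.map fun u => 1 + (adj u).length).sum⟩ := by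
    have h1 : (Timed.fold (fun x u =>
      Timed.fold (fun x (ew : Fin m × Fin n) =>
        pure (if cl ew.2 = none then x + 1 else x)) x (adj u)) 0 layer).val =
        layerCut adj layer cl := by
      simp only [Timed.fold_val, Timed.pure_val]
      have : ∀ (x : ℕ) (u : Fin n), (adj u).foldl (fun x ew => if cl ew.2 = none then x + 1 else x)
          x = x + ((adj u).map fun x => if cl x.2 = none then 1 else 0).sum := by
        intro x u
        rw [← List.foldl_add_sum]
        congr 1
        funext y z
        split_ifs <;> rfl
      simp only [this]
      rw [List.foldl_add_sum, Nat.zero_add, layerCut]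
    have h2 := Timed.fold_time_eq (f := fun x u =>
      Timed.fold (fun x (ew : Fin m × Fin n) =>
        pure (if cl ew.2 = none then x + 1 else x)) x (adj u)) (g := fun u => (adj u).length)
        (fun s a => by simp) 0 layer
    rw [← h1, ← h2]
  have hnext : Timed.fold (fun s u =>
        Timed.fold (fun (s : (Fin n → Option (Fin n)) × List (Fin n)) (ew : Fin m × Fin n) =>
          pure (if s.1 ew.2 = none then (Function.update s.1 ew.2 (some v), ew.2 :: s.2)
            else s)) s (adj u)) (cl, []) layer =
      ⟨claimLayer adj v layer cl, (layer.map fun u => 1 + (adj u).length).sum⟩ := by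
    have h1 : (Timed.fold (fun s u =>
        Timed.fold (fun (s : (Fin n → Option (Fin n)) × List (Fin n)) (ew : Fin m × Fin n) =>
          pure (if s.1 ew.2 = none then (Function.update s.1 ew.2 (some v), ew.2 :: s.2)
            else s)) s (adj u)) (cl, []) layer).val = claimLayer adj v layer cl := by
      simp only [Timed.fold_val, Timed.pure_val]
      exact List.foldl_foldl_flatMap (fun s u ew => claimStep v s (u, ew)) adj layer (cl, [])
    have h2 := Timed.fold_time_eq (f := fun s u =>
        Timed.fold (fun (s : (Fin n → Option (Fin n)) × List (Fin n)) (ew : Fin m × Fin n) =>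
          pure (if s.1 ew.2 = none then (Function.update s.1 ew.2 (some v), ew.2 :: s.2)
            else s)) s (adj u)) (g := fun u => (adj u).length)
        (fun s a => by simp) (cl, []) layer
    rw [← h1, ← h2]
  rw [growCluster, hcut]
  by_cases h : 2 * k * n * layerCut adj layer cl ≤ m + n * w
  · rw [if_pos h]
    refine Timed.ext ?_ ?_
    · simp only [Timed.bind_val, if_pos h, Timed.pure_val]
    · simp only [Timed.bind_time, if_pos h, Timed.pure_time, Timed.tick_time, add_zero]
  · rw [if_neg h]
    refine Timed.ext ?_ ?_
    · simp only [Timed.bind_val, if_neg h, hnext]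
    · simp only [Timed.bind_time, if_neg h, hnext, Timed.tick_time]
      omega

theorem claimLayer_spec (G : MGraph n m) (v : Fin n) (layer : List (Fin n))
    (cl : Fin n → Option (Fin n)) :
    let s := claimLayer (adjList G (List.finRange m)) v layer cl
    (∀ y, s.1 y = if y ∈ s.2 then some v else cl y) ∧ s.2.Nodup ∧
      (∀ y ∈ s.2, cl y = none ∧ ∃ u ∈ layer, ∃ e, G.Joins e u y) ∧
      ∀ u ∈ layer, ∀ e y, G.Joins e u y → s.1 y ≠ none := by
  intro s
  have h := List.foldl_induction (f := claimStep v) (b := (cl, []))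
    (l := adjDarts (adjList G (List.finRange m)) layer)
    (fun d s => (∀ y, s.1 y = if y ∈ s.2 then some v else cl y) ∧ s.2.Nodup ∧
      (∀ y ∈ s.2, cl y = none ∧ ∃ u ∈ layer, ∃ e, G.Joins e u y) ∧
      ∀ x ∈ d, s.1 x.2.2 ≠ none) (by simp) (by
    rintro d ⟨u, e, w⟩ r ⟨c, next⟩ hl ⟨h1, h2, h3, h4⟩
    have hx : (u, e, w) ∈ adjDarts (adjList G (List.finRange m)) layer := by rw [hl]; simp
    obtain ⟨hu, hew⟩ := mem_adjDarts.1 hx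
    have hj := (mem_adjList.1 hew).2
    simp only at h1 h2 h3 h4 hu hj
    by_cases hc : c w = none
    · rw [claimStep, if_pos hc]
      have hw : w ∉ next := fun hw => by rw [h1, if_pos hw] at hc; simp at hc
      have hcw : cl w = none := by rwa [h1, if_neg hw] at hc
      refine ⟨fun y => ?_, List.nodup_cons.2 ⟨hw, h2⟩, fun y hy => ?_, fun x hx => ?_⟩
      · by_cases hy : y = w
        · subst hy; simp
        · simp [h1 y, hy]
      · rcases List.mem_cons.1 hy with rfl | hy
        · exact ⟨hcw, u, hu, e, hj⟩
        · exact h3 y hy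
      · by_cases hxw : x.2.2 = w
        · simp [hxw]
        · simp only [Function.update_of_ne hxw]
          rcases List.mem_append.1 hx with hx | hx
          · exact h4 x hx
          · simp at hx; subst hx; exact absurd rfl hxw
    · rw [claimStep, if_neg hc]
      refine ⟨h1, h2, h3, fun x hx => ?_⟩
      rcases List.mem_append.1 hx with hx | hx
      · exact h4 x hx
      · simp at hx; subst hx; exact hc)
  refine ⟨h.1, h.2.1, h.2.2.1, fun u hu e y hj => h.2.2.2 (u, e, y) (mem_adjDarts.2 ⟨hu, ?_⟩)⟩
  exact mem_adjList.2 ⟨by simp, hj⟩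

/-- The number of edges that do not lie inside of a cluster. -/
def numCutEdges (G : MGraph n m) (cl : Fin n → Option (Fin n)) : ℕ :=
  ∑ e, if cl (G e).1 = cl (G e).2 then 0 else 1

/-- The number of edges inside of clusters. -/
def numInnerEdges (G : MGraph n m) (cl : Fin n → Option (Fin n)) : ℕ :=
  ∑ e, if cl (G e).1 = cl (G e).2 ∧ cl (G e).1 ≠ none then 1 else 0

/-- The number of vertices with a cluster. -/
def numClustered (cl : Fin n → Option (Fin n)) : ℕ :=
  ∑ v, if cl v = none then 0 else 1

/-- The steps that may still be spent on the vertices without a cluster. -/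
def remainingCost (G : MGraph n m) (cl : Fin n → Option (Fin n)) : ℕ :=
  ∑ v, if cl v = none then 3 + 2 * G.degree v else 0

theorem numInnerEdges_le (G : MGraph n m) (cl : Fin n → Option (Fin n)) :
    numInnerEdges G cl ≤ m := by
  calc numInnerEdges G cl ≤ ∑ _e : Fin m, 1 := Finset.sum_le_sum fun e _ => by split_ifs <;> simp
    _ = m := by simp

theorem numClustered_le (cl : Fin n → Option (Fin n)) : numClustered cl ≤ n := by
  calc numClustered cl ≤ ∑ _e : Fin n, 1 := Finset.sum_le_sum fun e _ => by split_ifs <;> simp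
    _ = n := by simp

theorem layerCut_adjList (G : MGraph n m) {layer : List (Fin n)} (hl : layer.Nodup)
    (cl : Fin n → Option (Fin n)) :
    layerCut (adjList G (List.finRange m)) layer cl =
      ∑ e, ((if (G e).1 ∈ layer ∧ cl (G e).2 = none then 1 else 0) +
        (if (G e).2 ∈ layer ∧ cl (G e).1 = none then 1 else 0)) := by
  have h1 : ∀ u, ((adjList G (List.finRange m) u).map fun x => if cl x.2 = none then 1 else 0).sum
      = ∑ e, ((if (G e).1 = u then (if cl (G e).2 = none then 1 else 0) else 0) +
        (if (G e).2 = u then (if cl (G e).1 = none then 1 else 0) else 0)) := by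
    intro u
    rw [sum_adjList, ← List.sum_toFinset _ (List.nodup_finRange m), List.toFinset_finRange]
  rw [layerCut]
  simp only [h1]
  rw [← Finset.sum_list_sum_comm]
  refine Finset.sum_congr rfl fun e _ => ?_
  rw [← List.sum_toFinset _ hl, Finset.sum_add_distrib, Finset.sum_ite_eq, Finset.sum_ite_eq]
  simp only [List.mem_toFinset, ite_and]

/-- There is a walk from `c` to `x` of length at most `d` inside of the cluster with center `c`. -/
def HasClusterPath (G : MGraph n m) (cl : Fin n → Option (Fin n)) (c x : Fin n) (d : ℕ) : Prop :=
  ∃ P, G.IsWalk c P x ∧ (∀ y ∈ P, cl y.1 = some c) ∧ P.length ≤ d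

theorem HasClusterPath.mono {G : MGraph n m} {cl cl' : Fin n → Option (Fin n)} {c x : Fin n}
    {d : ℕ} (h : HasClusterPath G cl c x d) (hcl : ∀ y, cl y ≠ none → cl' y = cl y) :
    HasClusterPath G cl' c x d := by
  obtain ⟨P, h1, h2, h3⟩ := h
  exact ⟨P, h1, fun y hy => by rw [hcl _ (by simp [h2 y hy]), h2 y hy], h3⟩

/-- The state between two clusters. -/
structure ClusterInv (G : MGraph n m) (cl : Fin n → Option (Fin n)) : Prop where
  near : ∀ x c, cl x = some c → ∃ d, 25 ^ d ≤ 24 ^ d * (n + 1) ∧ HasClusterPath G cl c x d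
  count : 24 * (n * numCutEdges G cl) ≤ m * numClustered cl + n * numInnerEdges G cl

/-- The state after `j` steps of the growth of the cluster with center `v`, starting from `cl₀`. -/
structure GrowInv (G : MGraph n m) (cl₀ : Fin n → Option (Fin n)) (v : Fin n) (j : ℕ)
    (layer : List (Fin n)) (w : ℕ) (cl : Fin n → Option (Fin n)) : Prop where
  unclaimed : cl₀ v = none
  center : cl v = some v
  old : ∀ x, cl₀ x ≠ none → cl x = cl₀ x
  new : ∀ x, cl₀ x = none → cl x ≠ none → cl x = some v ∧
    ∃ d, 25 ^ d ≤ 24 ^ d * (n + 1) ∧ HasClusterPath G cl v x d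
  nodup : layer.Nodup
  front : ∀ u ∈ layer, cl₀ u = none ∧ cl u = some v ∧ HasClusterPath G cl v u j
  closed : ∀ x, cl₀ x = none → cl x ≠ none → x ∉ layer → ∀ e y, G.Joins e x y → cl y ≠ none
  growth : 25 ^ j * m ≤ 24 ^ j * (m + n * w)
  inner : numInnerEdges G cl₀ + w ≤ numInnerEdges G cl

theorem GrowInv.init (G : MGraph n m) {cl₀ : Fin n → Option (Fin n)} {v : Fin n}
    (hv : cl₀ v = none) : GrowInv G cl₀ v 0 [v] 0 (Function.update cl₀ v (some v)) := by
  have hne : ∀ x, cl₀ x ≠ none → x ≠ v := by rintro x hx rfl; exact hx hv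
  have hpath : HasClusterPath G (Function.update cl₀ v (some v)) v v 0 :=
    ⟨[], rfl, by simp, le_rfl⟩
  have hnew : ∀ x, cl₀ x = none → Function.update cl₀ v (some v) x ≠ none → x = v := by
    intro x hx hx'
    by_contra hxv
    rw [Function.update_of_ne hxv] at hx'
    exact hx' hx
  refine ⟨hv, by simp, fun x hx => by rw [Function.update_of_ne (hne x hx)], fun x hx hx' => ?_,
    by simp, fun u hu => ?_, fun x hx hx' hxl => ?_, by simp, ?_⟩
  · obtain rfl := hnew x hx hx'
    exact ⟨by simp, 0, by simp, hpath⟩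
  · simp at hu
    subst hu
    exact ⟨hv, by simp, hpath⟩
  · exact absurd (hnew x hx hx') (by simpa using hxl)
  · rw [add_zero]
    refine Finset.sum_le_sum fun e _ => ?_
    by_cases h : cl₀ (G e).1 = cl₀ (G e).2 ∧ cl₀ (G e).1 ≠ none
    · rw [if_pos h, Function.update_of_ne (hne _ h.2), Function.update_of_ne (hne _ (h.1 ▸ h.2)),
        if_pos h]
    · rw [if_neg h]; exact Nat.zero_le _

/-- By `closed`, every edge newly cut leaves from the last layer, so `layerCut` bounds their number.
The stopping rule charges them to `m`, paid by the newly clustered center, and to `n * w`, paid by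
inner edges that are new by the field `inner`. So nothing is charged twice. -/
theorem GrowInv.clusterInv {G : MGraph n m} {cl₀ cl : Fin n → Option (Fin n)} {v : Fin n} {j w : ℕ}
    {layer : List (Fin n)} (h₀ : ClusterInv G cl₀) (h : GrowInv G cl₀ v j layer w cl)
    (hdone : 2 * 12 * n * layerCut (adjList G (List.finRange m)) layer cl ≤ m + n * w) :
    ClusterInv G cl := by
  refine ⟨fun x c hx => ?_, ?_⟩
  · by_cases hx₀ : cl₀ x = none
    · obtain ⟨h1, h2⟩ := h.new x hx₀ (by simp [hx])
      rw [h1] at hx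
      obtain rfl := Option.some.inj hx
      exact h2
    · rw [h.old x hx₀] at hx
      obtain ⟨d, h1, h2⟩ := h₀.near x c hx
      exact ⟨d, h1, h2.mono h.old⟩
  · have h1 : numCutEdges G cl ≤ numCutEdges G cl₀ +
        layerCut (adjList G (List.finRange m)) layer cl := by
      rw [layerCut_adjList G h.nodup, numCutEdges, numCutEdges, ← Finset.sum_add_distrib]
      refine Finset.sum_le_sum fun e _ => ?_
      by_cases he : cl (G e).1 = cl (G e).2
      · rw [if_pos he]; exact Nat.zero_le _
      by_cases he₀ : cl₀ (G e).1 = cl₀ (G e).2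
      · by_cases h2 : cl₀ (G e).1 = none
        · have h3 : cl₀ (G e).2 = none := he₀ ▸ h2
          by_cases h4 : cl (G e).1 = none
          · have h5 : cl (G e).2 ≠ none := fun h5 => he (h4.trans h5.symm)
            have h6 : (G e).2 ∈ layer := by
              by_contra h6
              exact h.closed _ h3 h5 h6 e _ (G.joins_self e).symm h4
            rw [if_neg he, if_pos (show (G e).2 ∈ layer ∧ cl (G e).1 = none from ⟨h6, h4⟩)]
            omega
          · by_cases h5 : cl (G e).2 = none
            · have h6 : (G e).1 ∈ layer := by
                by_contra h6
                exact h.closed _ h2 h4 h6 e _ (G.joins_self e) h5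
              rw [if_neg he, if_pos (show (G e).1 ∈ layer ∧ cl (G e).2 = none from ⟨h6, h5⟩)]
              omega
            · exact absurd ((h.new _ h2 h4).1.trans (h.new _ h3 h5).1.symm) he
        · exact absurd (by rw [h.old _ h2, h.old _ (he₀ ▸ h2), he₀]) he
      · rw [if_neg he, if_neg he₀]; omega
    have h2 : numClustered cl₀ + 1 ≤ numClustered cl := by
      rw [numClustered, numClustered]
      refine Nat.succ_le_of_lt (Finset.sum_lt_sum (fun x _ => ?_) ⟨v, Finset.mem_univ v, ?_⟩)
      · by_cases hx : cl₀ x = none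
        · rw [if_pos hx]; exact Nat.zero_le _
        · rw [h.old x hx]
      · simp [h.unclaimed, h.center]
    calc 24 * (n * numCutEdges G cl)
        ≤ 24 * (n * (numCutEdges G cl₀ + layerCut (adjList G (List.finRange m)) layer cl)) := by
          gcongr
      _ = 24 * (n * numCutEdges G cl₀) +
          2 * 12 * n * layerCut (adjList G (List.finRange m)) layer cl := by ring
      _ ≤ (m * numClustered cl₀ + n * numInnerEdges G cl₀) + (m + n * w) :=
          add_le_add h₀.count hdone
      _ = m * (numClustered cl₀ + 1) + n * (numInnerEdges G cl₀ + w) := by ring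
      _ ≤ m * numClustered cl + n * numInnerEdges G cl := by
          gcongr
          exact h.inner

/-- If the rule does not stop the cluster, the edges of the cut become inner edges and `m + n * w`
grows by a factor above `25 / 24`. As `w` never exceeds `m`, this quantity stays at most `(n + 1) *
m`, and this bounds the number of layers. -/
theorem GrowInv.step {G : MGraph n m} {cl₀ cl : Fin n → Option (Fin n)} {v : Fin n} {j w : ℕ}
    {layer : List (Fin n)} (h : GrowInv G cl₀ v j layer w cl)
    (hgo : ¬ 2 * 12 * n * layerCut (adjList G (List.finRange m)) layer cl ≤ m + n * w) :
    GrowInv G cl₀ v (j + 1) (claimLayer (adjList G (List.finRange m)) v layer cl).2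
        (w + layerCut (adjList G (List.finRange m)) layer cl)
        (claimLayer (adjList G (List.finRange m)) v layer cl).1 ∧
      (claimLayer (adjList G (List.finRange m)) v layer cl).2 ≠ [] := by
  obtain ⟨s1, s2, s3, s4⟩ := claimLayer_spec G v layer cl
  set cl' := (claimLayer (adjList G (List.finRange m)) v layer cl).1
  set next := (claimLayer (adjList G (List.finRange m)) v layer cl).2
  set cut := layerCut (adjList G (List.finRange m)) layer cl with hcut
  rw [layerCut_adjList G h.nodup] at hcut
  have hext : ∀ y, cl y ≠ none → cl' y = cl y := fun y hy => by
    rw [s1, if_neg fun hy' => hy (s3 y hy').1]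
  have hnext : ∀ u ∈ layer, ∀ e y, G.Joins e u y → cl y = none → y ∈ next := by
    intro u hu e y hj hy
    by_contra hy'
    have := s4 u hu e y hj
    rw [s1, if_neg hy'] at this
    exact this hy
  have hlay : ∀ u ∈ layer, cl' u = some v := fun u hu => by
    rw [hext u (by simp [(h.front u hu).2.1]), (h.front u hu).2.1]
  have hnx : ∀ y ∈ next, cl' y = some v := fun y hy => by rw [s1, if_pos hy]
  -- An edge of the cut has one end in the layer, hence in the cluster, and one end without a
  -- cluster. So it is counted once and was not an inner edge before.
  have hinner : numInnerEdges G cl + cut ≤ numInnerEdges G cl' := by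
    rw [hcut, numInnerEdges, numInnerEdges, ← Finset.sum_add_distrib]
    refine Finset.sum_le_sum fun e _ => ?_
    by_cases h1 : (G e).1 ∈ layer ∧ cl (G e).2 = none
    · have h2 := hnext _ h1.1 e _ (G.joins_self e) h1.2
      have h3 := (h.front _ h1.1).2.1
      simp [h1.1, h1.2, h3, hlay _ h1.1, hnx _ h2]
    · by_cases h2 : (G e).2 ∈ layer ∧ cl (G e).1 = none
      · have h3 := hnext _ h2.1 e _ (G.joins_self e).symm h2.2
        have h4 := (h.front _ h2.1).2.1
        simp [h2.1, h2.2, h4, hlay _ h2.1, hnx _ h3]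
      · rw [if_neg h1, if_neg h2]
        by_cases h3 : cl (G e).1 = cl (G e).2 ∧ cl (G e).1 ≠ none
        · rw [if_pos h3, hext _ h3.2, hext _ (h3.1 ▸ h3.2), if_pos h3]
        · rw [if_neg h3]; exact Nat.zero_le _
  have hpos : 0 < cut := by
    rcases Nat.eq_zero_or_pos cut with h0 | h0
    · rw [h0] at hgo; simp at hgo
    · exact h0
  -- An edge of the cut shows that `m` is positive, so that it can be cancelled in `hdepth`, and
  -- that the next layer is not empty.
  obtain ⟨e, he⟩ : ∃ e, ((G e).1 ∈ layer ∧ cl (G e).2 = none) ∨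
      ((G e).2 ∈ layer ∧ cl (G e).1 = none) := by
    by_contra! hno
    rw [hcut, Finset.sum_eq_zero] at hpos
    · exact lt_irrefl _ hpos
    · intro e _
      rw [if_neg fun h => (hno e).1 h.1 h.2, if_neg fun h => (hno e).2 h.1 h.2, add_zero]
  have hgrowth : 25 ^ (j + 1) * m ≤ 24 ^ (j + 1) * (m + n * (w + cut)) := by
    have h1 : 25 * (m + n * w) ≤ 24 * (m + n * (w + cut)) := by
      have : 24 * (m + n * (w + cut)) = 24 * (m + n * w) + 2 * 12 * n * cut := by ring
      omega
    calc 25 ^ (j + 1) * m = 25 * (25 ^ j * m) := by ring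
      _ ≤ 25 * (24 ^ j * (m + n * w)) := Nat.mul_le_mul_left _ h.growth
      _ = 24 ^ j * (25 * (m + n * w)) := by ring
      _ ≤ 24 ^ j * (24 * (m + n * (w + cut))) := Nat.mul_le_mul_left _ h1
      _ = 24 ^ (j + 1) * (m + n * (w + cut)) := by ring
  have hw : numInnerEdges G cl₀ + (w + cut) ≤ numInnerEdges G cl' := by
    have := h.inner
    omega
  have hdepth : 25 ^ (j + 1) ≤ 24 ^ (j + 1) * (n + 1) := by
    have h1 : w + cut ≤ m := by
      have := numInnerEdges_le G cl'
      omega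
    refine Nat.le_of_mul_le_mul_right (hgrowth.trans ?_) e.pos
    calc 24 ^ (j + 1) * (m + n * (w + cut)) ≤ 24 ^ (j + 1) * (m + n * m) := by gcongr
      _ = 24 ^ (j + 1) * (n + 1) * m := by ring
  have hpath : ∀ y ∈ next, HasClusterPath G cl' v y (j + 1) := by
    intro y hy
    obtain ⟨-, u, hu, f, hj⟩ := s3 y hy
    obtain ⟨P, p1, p2, p3⟩ := (h.front u hu).2.2.mono hext
    refine ⟨P ++ [(u, f)], p1.append (.single hj), fun z hz => ?_, by simpa using p3⟩
    rcases List.mem_append.1 hz with hz | hz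
    · exact p2 z hz
    · simp at hz; subst hz; exact hlay u hu
  refine ⟨⟨h.unclaimed, ?_, fun x hx => ?_, fun x hx hx' => ?_, s2, fun u hu => ⟨?_, hnx u hu,
    hpath u hu⟩, fun x hx hx' hxn f y hj => ?_, hgrowth, hw⟩, ?_⟩
  · rw [hext v (by simp [h.center]), h.center]
  · rw [hext x (by rwa [h.old x hx]), h.old x hx]
  · by_cases hxn : x ∈ next
    · exact ⟨hnx x hxn, j + 1, hdepth, hpath x hxn⟩
    · rw [s1, if_neg hxn] at hx'
      obtain ⟨h1, d, h2, h3⟩ := h.new x hx hx'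
      exact ⟨by rw [hext x hx', h1], d, h2, h3.mono hext⟩
  · by_contra hu'
    have := h.old u hu'
    rw [(s3 u hu).1] at this
    exact hu' this.symm
  · rw [s1, if_neg hxn] at hx'
    by_cases hxl : x ∈ layer
    · exact s4 x hxl f y hj
    · have := h.closed x hx hx' hxl f y hj
      rwa [hext y this]
  · rcases he with he | he
    · exact List.ne_nil_of_mem (hnext _ he.1 e _ (G.joins_self e) he.2)
    · exact List.ne_nil_of_mem (hnext _ he.1 e _ (G.joins_self e).symm he.2)

theorem List.sum_map_eq_sum_ite {l : List (Fin n)} (hl : l.Nodup) (f : Fin n → ℕ) :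
    (l.map f).sum = ∑ v, if v ∈ l then f v else 0 := by
  rw [← List.sum_toFinset _ hl, ← Finset.sum_filter]
  congr 1
  ext
  simp

/-- Claiming a vertex moves its allowance `3 + 2 * degree` from the remaining cost to the new layer.
-/
theorem claimLayer_cost (G : MGraph n m) (v : Fin n) (layer : List (Fin n))
    (cl : Fin n → Option (Fin n)) :
    let s := claimLayer (adjList G (List.finRange m)) v layer cl
    remainingCost G s.1 + (s.2.map fun u => 3 + 2 * G.degree u).sum = remainingCost G cl ∧
      numClustered s.1 = numClustered cl + s.2.length := by
  have h := claimLayer_spec G v layer cl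
  generalize claimLayer (adjList G (List.finRange m)) v layer cl = s at h ⊢
  obtain ⟨s1, s2, s3, -⟩ := h
  show remainingCost G s.1 + _ = _ ∧ numClustered s.1 = _
  have hlen : s.2.length = (s.2.map fun _ => 1).sum := by simp
  rw [hlen, List.sum_map_eq_sum_ite s2, List.sum_map_eq_sum_ite s2, remainingCost, remainingCost,
    numClustered, numClustered, ← Finset.sum_add_distrib, ← Finset.sum_add_distrib]
  constructor <;>
  · refine Finset.sum_congr rfl fun x _ => ?_
    rw [s1 x]
    by_cases hx : x ∈ s.2
    · simp [hx, (s3 x hx).1]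
    · simp [hx]

/-- Two scans take `1 + degree` for each vertex. The third unit pays for the single step of the
round, because the layer is not empty. -/
theorem time_le_cost (G : MGraph n m) {layer : List (Fin n)} (h : layer ≠ []) :
    1 + 2 * (layer.map fun u => 1 + (adjList G (List.finRange m) u).length).sum ≤
      (layer.map fun u => 3 + 2 * G.degree u).sum := by
  have h1 : (layer.map fun u => 3 + 2 * G.degree u).sum = layer.length +
      2 * (layer.map fun u => 1 + (adjList G (List.finRange m) u).length).sum := by
    simp only [length_adjList, degIn_finRange]
    clear h
    induction layer with
    | nil => simp
    | cons u l ih => simp only [List.map_cons, List.sum_cons, List.length_cons, ih]; ring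
  have := List.length_pos_of_ne_nil h
  omega

/-- The steps are paid by the allowances of the vertices in the current layer, and every vertex
enters a layer at most once. Each further layer contains a newly claimed vertex, so the cluster
stops before the fuel is used up. -/
theorem growCluster_spec {G : MGraph n m} {cl₀ cl : Fin n → Option (Fin n)} {v : Fin n}
    {j w fuel : ℕ} {layer : List (Fin n)} (h₀ : ClusterInv G cl₀)
    (h : GrowInv G cl₀ v j layer w cl) (hne : layer ≠ []) (hfuel : n < numClustered cl + fuel) :
    let r := growCluster 12 (adjList G (List.finRange m)) v fuel layer w cl
    ClusterInv G r.val ∧ (∀ x, cl₀ x ≠ none → r.val x = cl₀ x) ∧ r.val v ≠ none ∧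
      r.time + remainingCost G r.val ≤
        remainingCost G cl + (layer.map fun u => 3 + 2 * G.degree u).sum := by
  induction fuel generalizing j layer w cl with
  | zero =>
    have := numClustered_le cl
    omega
  | succ fuel ih =>
    have ht := time_le_cost G hne
    rw [growCluster_succ]
    split_ifs with hdone
    · refine ⟨h.clusterInv h₀ hdone, h.old, by simp [h.center], ?_⟩
      simp only
      omega
    · obtain ⟨h1, h2⟩ := h.step hdone
      obtain ⟨c1, c2⟩ := claimLayer_cost G v layer cl
      have := List.length_pos_of_ne_nil h2
      obtain ⟨i1, i2, i3, i4⟩ := ih h1 h2 (by omega)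
      refine ⟨i1, i2, i3, ?_⟩
      simp only
      omega

theorem remainingCost_update (G : MGraph n m) {cl : Fin n → Option (Fin n)} {v : Fin n}
    (hv : cl v = none) :
    remainingCost G (Function.update cl v (some v)) + (3 + 2 * G.degree v) =
      remainingCost G cl := by
  rw [remainingCost, remainingCost, ← Finset.sum_erase_add _ _ (Finset.mem_univ v),
    ← Finset.sum_erase_add (a := v) Finset.univ _ (Finset.mem_univ v)]
  simp only [Function.update_self, hv, if_true, reduceCtorEq, if_false, add_zero]
  congr 1
  refine Finset.sum_congr rfl fun x hx => ?_
  rw [Function.update_of_ne (Finset.ne_of_mem_erase hx)]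

/-- The clusters found by ball growing. -/
def growAll (G : MGraph n m) : Timed (Fin n → Option (Fin n)) :=
  Timed.fold (fun cl v =>
    if cl v = none then
      growCluster 12 (adjList G (List.finRange m)) v n [v] 0 (Function.update cl v (some v))
    else pure cl) (fun _ => none) (List.finRange n)

theorem growAll_spec (G : MGraph n m) :
    ClusterInv G (growAll G).val ∧ (∀ v, (growAll G).val v ≠ none) ∧
      (growAll G).time ≤ 4 * n + 4 * m := by
  have h := Timed.fold_induction (f := fun cl v =>
    if cl v = none then
      growCluster 12 (adjList G (List.finRange m)) v n [v] 0 (Function.update cl v (some v))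
    else pure cl) (b := fun _ => none) (l := List.finRange n)
    (fun d cl t => ClusterInv G cl ∧ (∀ v ∈ d, cl v ≠ none) ∧
      t + remainingCost G cl ≤ d.length + remainingCost G fun _ => none)
    ⟨⟨by simp, by simp [numCutEdges]⟩, by simp, by simp⟩ (by
    rintro d v r cl t - ⟨h1, h2, h3⟩
    by_cases hv : cl v = none
    · rw [if_pos hv]
      have hg := GrowInv.init G hv
      have hcl : 0 < numClustered (Function.update cl v (some v)) := by
        refine Finset.sum_pos' (by simp) ⟨v, Finset.mem_univ v, by simp⟩
      obtain ⟨g1, g2, g3, g4⟩ := growCluster_spec h1 hg (by simp) (by omega : n < _ + n)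
      refine ⟨g1, fun x hx => ?_, ?_⟩
      · rcases List.mem_append.1 hx with hx | hx
        · rw [g2 x (h2 x hx)]; exact h2 x hx
        · simp at hx; subst hx; exact g3
      · have := remainingCost_update G hv
        simp only [List.map_cons, List.map_nil, List.sum_cons, List.sum_nil] at g4
        rw [List.length_append, List.length_singleton]
        omega
    · rw [if_neg hv]
      refine ⟨h1, fun x hx => ?_, ?_⟩
      · rcases List.mem_append.1 hx with hx | hx
        · exact h2 x hx
        · simp at hx; subst hx; exact hv
      · rw [List.length_append, List.length_singleton, Timed.pure_val, Timed.pure_time]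
        omega)
  refine ⟨h.1, fun v => h.2.1 v (by simp), ?_⟩
  have h1 : remainingCost G (fun _ => none) = 3 * n + 4 * m := by
    have := sum_degIn G (List.finRange m)
    simp only [degIn_finRange, List.length_finRange] at this
    simp only [remainingCost, if_true, Finset.sum_add_distrib, ← Finset.mul_sum, this]
    simp
    ring
  have := h.2.2
  rw [h1, List.length_finRange] at this
  rw [growAll]
  omega

theorem ballGrowing_eq (G : MGraph n m) : ballGrowing 12 G =
    ⟨fun e => decide ((growAll G).val (G e).1 ≠ (growAll G).val (G e).2),
      2 * n + 2 * m + (growAll G).time⟩ := by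
  refine Timed.ext ?_ ?_
  · simp only [ballGrowing, Timed.bind_val, buildAdj_val, Timed.tabulate_val]
    rfl
  · simp only [ballGrowing, Timed.bind_time, buildAdj_val, buildAdj_time, Timed.tabulate_time,
      Timed.tabulate_val, List.length_finRange]
    rw [growAll]
    omega

/-! ### From clusters of small radius to components of small strong diameter. -/

theorem MGraph.IsWalk.exists_walk {G : MGraph n m} {R : Fin m → Bool} {a b : Fin n}
    {P : Cyc n m} (h : G.IsWalk a P b) (hR : ∀ x ∈ P, R x.2 = false) :
    ∃ p : (G.simpleMinus R).Walk a b, p.length ≤ P.length := by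
  induction P generalizing a with
  | nil => cases h; exact ⟨.nil, le_rfl⟩
  | cons x P ih =>
    obtain ⟨rfl, y, hy, h⟩ := h
    obtain ⟨p, hp⟩ := ih h fun z hz => hR z (by simp [hz])
    by_cases hxy : x.1 = y
    · subst hxy
      exact ⟨p, hp.trans (by simp)⟩
    · have hadj : (G.simpleMinus R).Adj x.1 y := by
        rw [MGraph.simpleMinus, SimpleGraph.fromRel_adj]
        exact ⟨hxy, Or.inl ⟨x.2, hR x (by simp), hy⟩⟩
      exact ⟨.cons hadj p, by simpa using hp⟩

theorem eq_of_reachable {G : MGraph n m} {α : Type} [DecidableEq α] {cl : Fin n → α} {u v : Fin n}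
    (h : (G.simpleMinus fun e => decide (cl (G e).1 ≠ cl (G e).2)).Reachable u v) :
    cl u = cl v := by
  obtain ⟨p⟩ := h
  induction p with
  | nil => rfl
  | cons h _ ih =>
    rw [← ih]
    rw [MGraph.simpleMinus, SimpleGraph.fromRel_adj] at h
    rcases h.2 with ⟨e, he, hj⟩ | ⟨e, he, hj⟩ <;> rcases hj with hj | hj <;>
      simp [hj] at he <;> simp [he]

/-- All vertices of the path, including its end, lie in one cluster, so none of its edges belongs to
`R`. This makes the bound one on the strong diameter. -/
theorem HasClusterPath.exists_walk {G : MGraph n m} {cl : Fin n → Option (Fin n)} {c x : Fin n}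
    {d : ℕ} (h : HasClusterPath G cl c x d) (hx : cl x = some c) :
    ∃ p : (G.simpleMinus fun e => decide (cl (G e).1 ≠ cl (G e).2)).Walk c x, p.length ≤ d := by
  obtain ⟨P, h1, h2, h3⟩ := h
  obtain ⟨p, hp⟩ := h1.exists_walk (R := fun e => decide (cl (G e).1 ≠ cl (G e).2)) fun z hz => by
    obtain ⟨z', hj, hz'⟩ := h1.joins_of_mem (z := z.1) (e := z.2) hz
    have h4 : cl z' = some c := by
      rcases List.mem_append.1 hz' with hm | hm
      · obtain ⟨y, hy, rfl⟩ := List.mem_map.1 hm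
        exact h2 y hy
      · simp at hm; subst hm; exact hx
    rcases hj with hj | hj <;> simp [hj, h4, h2 z hz]
  exact ⟨p, hp.trans h3⟩

/-- Since `n + 1 ≤ n ^ 2`, the hypothesis gives `(25 / 24) ^ d ≤ n ^ 2`. With `log (25 / 24) ≥ 1 -
24 / 25` this yields `d / 25 ≤ 2 * log n`. -/
theorem depth_le_log {n d : ℕ} (hn : 2 ≤ n) (h : 25 ^ d ≤ 24 ^ d * (n + 1)) :
    (d : ℝ) ≤ 50 * Real.log n := by
  have hn' : (2 : ℝ) ≤ n := by exact_mod_cast hn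
  have h1 : (25 : ℝ) ^ d ≤ 24 ^ d * (n + 1) := by exact_mod_cast h
  have h2 : (25 / 24 : ℝ) ^ d ≤ (n : ℝ) ^ 2 := by
    rw [div_pow, div_le_iff₀ (by positivity)]
    refine h1.trans ?_
    rw [mul_comm]
    gcongr
    nlinarith
  have h3 := Real.log_le_log (by positivity) h2
  rw [Real.log_pow, Real.log_pow] at h3
  have h4 := Real.one_sub_inv_le_log_of_pos (by norm_num : (0 : ℝ) < 25 / 24)
  have h5 : (d : ℝ) * (1 / 25) ≤ d * Real.log (25 / 24) := by
    refine mul_le_mul_of_nonneg_left ?_ (by positivity)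
    norm_num at h4 ⊢
    linarith
  push_cast at h3
  linarith

/-- The procedure is deterministic and always succeeds, so any exponent `b` is allowed. Two radii
give a diameter of at most `100 * log n ≤ 9 * 12 * log n`, and the time is at most `6 * (n + m)`. -/
theorem ballGrowingProc_isLowDiamDecomp (b : ℝ) :
    IsLowDiamDecomp (1 / 12) b 9 ballGrowingProc := by
  intro n m G hn
  obtain ⟨h1, h2, h3⟩ := growAll_spec G
  rw [ballGrowingProc, ballGrowing_eq]
  set cl := (growAll G).val
  constructor
  · intro x hx
    rw [PMF.mem_support_pure_iff] at hx
    subst hx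
    have : ((growAll G).time : ℝ) ≤ 4 * n + 4 * m := by exact_mod_cast h3
    push_cast
    linarith [(Nat.cast_nonneg n : (0 : ℝ) ≤ n), (Nat.cast_nonneg m : (0 : ℝ) ≤ m)]
  · refine le_trans (b := 1) ?_ (le_of_eq (Eq.symm ?_))
    · rw [← ENNReal.ofReal_one]
      refine ENNReal.ofReal_le_ofReal ?_
      have : 0 ≤ (n : ℝ) ^ (-b) := by positivity
      linarith
    rw [PMF.toOuterMeasure_apply_eq_one_iff]
    intro x hx
    rw [PMF.mem_support_pure_iff] at hx
    subst hx
    refine ⟨?_, fun u v huv => ?_⟩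
    · have hcard : (Finset.univ.filter fun e : Fin m =>
          decide (cl (G e).1 ≠ cl (G e).2) = true).card = numCutEdges G cl := by
        rw [Finset.card_filter, numCutEdges]
        refine Finset.sum_congr rfl fun e _ => ?_
        by_cases he : cl (G e).1 = cl (G e).2 <;> simp [he]
      -- There are at most `n` clustered vertices and at most `m` inner edges, so `count` bounds `24
      -- * n` times the number of cut edges by `2 * n * m`.
      have h4 : 12 * numCutEdges G cl ≤ m := by
        have h5 := h1.count
        have h6 : m * numClustered cl ≤ m * n := Nat.mul_le_mul_left _ (numClustered_le cl)
        have h8 : m * n = n * m := mul_comm m n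
        have h7 : n * numInnerEdges G cl ≤ n * m := Nat.mul_le_mul_left _ (numInnerEdges_le G cl)
        refine Nat.le_of_mul_le_mul_left ?_ (by omega : 0 < 2 * n)
        calc 2 * n * (12 * numCutEdges G cl) = 24 * (n * numCutEdges G cl) := by ring
          _ ≤ m * n + n * m := by omega
          _ = 2 * n * m := by ring
      show ((Finset.univ.filter fun e : Fin m =>
          decide (cl (G e).1 ≠ cl (G e).2) = true).card : ℝ) ≤ 1 / 12 * m
      rw [hcard]
      have : (12 : ℝ) * numCutEdges G cl ≤ m := by exact_mod_cast h4
      linarith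
    · show ((G.simpleMinus fun e => decide (cl (G e).1 ≠ cl (G e).2)).dist u v : ℝ) ≤ _
      have hcl := eq_of_reachable (cl := cl) huv
      obtain ⟨c, hc⟩ := Option.ne_none_iff_exists'.1 (h2 u)
      obtain ⟨d, hd, hp⟩ := h1.near u c hc
      obtain ⟨d', hd', hp'⟩ := h1.near v c (hcl ▸ hc)
      obtain ⟨p, hp⟩ := hp.exists_walk hc
      obtain ⟨p', hp'⟩ := hp'.exists_walk (hcl ▸ hc)
      have hdist := SimpleGraph.dist_le (p.reverse.append p')
      rw [SimpleGraph.Walk.length_append, SimpleGraph.Walk.length_reverse] at hdist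
      -- For a single vertex `log n = 0`, and the distance is `0` as well.
      rcases Nat.lt_or_ge n 2 with hn2 | hn2
      · obtain rfl : n = 1 := by omega
        obtain rfl : u = v := Subsingleton.elim _ _
        simp
      · have e1 := depth_le_log hn2 hd
        have e2 := depth_le_log hn2 hd'
        have e3 : ((G.simpleMinus fun e => decide (cl (G e).1 ≠ cl (G e).2)).dist u v : ℝ)
            ≤ d + d' := by exact_mod_cast hdist.trans (add_le_add hp hp')
        have e4 : 0 ≤ Real.log n := Real.log_natCast_nonneg n
        have e5 : 9 * (1 / 12 : ℝ)⁻¹ * Real.log n = 108 * Real.log n := by norm_num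
        linarith

end Growing

theorem mainTheorem3 (a : ℝ) (ha : 0 < a) :
    (∃ C : ℝ, ShortCycleGuarantee a C ballGrowingProc) ∧
    (∃ A : ℝ, IsLowDiamDecomp (1 / 12) (a + 2) A ballGrowingProc) ∧
    (∀ A : ℝ, ∃ C : ℝ, ∀ D : DecompProc,
      IsLowDiamDecomp (1 / 12) (a + 2) A D → ShortCycleGuarantee a C D) := by
  have h : ∀ A : ℝ, ∃ C : ℝ, ∀ D : DecompProc,
      IsLowDiamDecomp (1 / 12) (a + 2) A D → ShortCycleGuarantee a C D := fun A =>
    shortCycleGuarantee_of_naive fun n G _ hn => naiveShortCycle_isOutput G hn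
  have hball := ballGrowingProc_isLowDiamDecomp (a + 2)
  -- The guarantee for ball growing is the general one for the constant `9` with which it is a
  -- decomposition procedure.
  obtain ⟨C, hC⟩ := h 9
  exact ⟨⟨C, hC _ hball⟩, ⟨9, hball⟩, h⟩
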